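/- Let $G=(-1,1)^2$ and $\Omega=G\times(-1,1)$, with coordinates $(x,y,z)$, let $T\in(0,\infty)$, and for $\delta>0$ write $\Delta_H=\partial_x^2+\partial_y^2$, $\Delta_\delta=\Delta_H+\delta\,\partial_z^2$, $\nabla_H=(\partial_x,\partial_y)$. All functions are real-valued. For $s\ge 0$, $H^s_{per}$ (on $G$ or $\Omega$) is the Bessel potential space of functions of period $2$ in each coordinate, with norm given through Fourier series, $\|f\|_{H^s}^2=2^d\sum_{k\in\mathbb Z^d}(1+\pi^2|k|^2)^s|\hat f(k)|^2$, where $d=2$ or $3$ is the dimension and $\hat f(k)=2^{-d}\int f(x)e^{-i\pi k\cdot x}\,dx$. $L^2_\sigma(G)$ is the $L^2$-closure of the smooth periodic divergence-free fields $G\to\mathbb R^2$, and $L^2_\sigma(\Omega)$ is the $L^2$-closure of the smooth periodic divergence-free fields $(v,w):\Omega\to\mathbb R^2\times\mathbb R$ with $v$ even and $w$ odd in $z$. Let $\mathbb E_1(T)=L^2(0,T;H^2_{per})\cap H^1(0,T;L^2)$, and let $\mathbb E_1^p(T)$ be the space of all $p\in L^2(0,T;H^1_{per})$ with spatial mean zero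 for a.e. $t$. Let $$\overline v_0\in H^1_{per}(G)^2\cap L^2_\sigma(G),\qquad \tilde u_0=(\tilde v_0,w_0)\in H^{3/2}_{per}(\Omega)^3\cap L^2_\sigma(\Omega)\quad\text{with}\quad \int_{-1}^1\tilde u_0(\cdot,\cdot,z)\,dz=0.$$ (a) For all $\varepsilon,\delta>0$ there are unique $\overline v\in\mathbb E_1(T)^2$ (on $G$) and $\tilde u=(\tilde v,w)\in\mathbb E_1(T)^3$ (on $\Omega$) for which there exist pressures $\overline p\in\mathbb E_1^p(T)$ on $G$ and $\tilde p\in\mathbb E_1^p(T)$ on $\Omega$ such that, almost everywhere, $$\begin{aligned} &\partial_t\overline v+\overline v\cdot\nabla_H\overline v-\Delta_H\overline v+\nabla_H\overline p=0,\quad \operatorname{div}_H\overline v=0 &&\text{in }(0,T)\times G,\\ &\partial_t\tilde v-\Delta_\delta\tilde v+\nabla_H\tilde p=0,\quad \partial_t w-\Delta_\delta w+\tfrac1{\varepsilon^2}\partial_z\tilde p=0,\quad \operatorname{div}\tilde u=0 &&\text{in }(0,T)\times\Omega,\\ &\textstyle\int_{-1}^1\tilde v\,dz=0,\quad \int_{-1}^1\tilde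 p\,dz=0 &&\text{in }(0,T)\times G, \end{aligned}$$ with $\tilde v,\tilde p$ even and $w$ odd in $z$, and with $\overline v(0)=\overline v_0$ and $\tilde u(0)=\tilde u_0$. (b) There is a constant $C>0$, which may depend on $T$ but is independent of $\varepsilon$, $\delta$ and the initial data, such that for every $\delta\ge 1$ the solutions $\tilde u^{\varepsilon,\delta}=(\tilde v^{\varepsilon,\delta},w^{\varepsilon,\delta})$ of the Stokes part satisfy $$\sup_{\varepsilon\in(0,1]}\big\|(\tilde v^{\varepsilon,\delta},\varepsilon w^{\varepsilon,\delta})\big\|_{L^4(0,T;H^{3/2}_{per}(\Omega))}\le \frac{C}{\delta^{1/4}}\,\|\tilde u_0\|_{H^{3/2}_{per}(\Omega)}.$$ -/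

import Mathlib

open MeasureTheory Set
open scoped ENNReal ContDiff

namespace ScaledStokes

noncomputable section

/-- The open cube `(-1,1)^d`; `box 2` is the horizontal domain `G` and `box 3` is `Ω = G × (-1,1)`.
The coordinates `0, 1, 2` are `x, y, z`. -/
def box (d : ℕ) : Set (Fin d → ℝ) := Set.univ.pi fun _ => Ioo (-1) 1

/-- The real Hilbert space `L²((-1,1)^d)`. -/
abbrev L2 (d : ℕ) : Type := Lp ℝ 2 (volume.restrict (box d))

/-! ### Periodic Sobolev spaces -/

/-- The `k`-th Fourier coefficient `2^{-d} ∫ f(x) exp(-iπ k·x) dx` of `f`, seen as a function of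
period `2` in every coordinate. -/
def boxFourierCoeff {d : ℕ} (f : L2 d) (k : Fin d → ℤ) : ℂ :=
  (1 / 2 ^ d : ℂ) * ∫ x in box d,
    (f x : ℂ) * Complex.exp (-(Complex.I * ((Real.pi * ∑ i, (k i : ℝ) * x i : ℝ) : ℂ)))

/-- The norm of the periodic Bessel potential space `H^s_per = H^{s,2}_per`,
`‖f‖² = 2^d ∑_k (1 + π²|k|²)^s |f̂(k)|²`, with value `⊤` when `f` is not in `H^s_per`. -/
def sobolevNorm {d : ℕ} (s : ℝ) (f : L2 d) : ℝ≥0∞ :=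
  (∑' k : Fin d → ℤ, ENNReal.ofReal
    (2 ^ d * (1 + Real.pi ^ 2 * ∑ i, (k i : ℝ) ^ 2) ^ s * ‖boxFourierCoeff f k‖ ^ 2)) ^ (1 / 2 : ℝ)

/-- The `H^s_per`-norm of a vector field. -/
def sobolevNormVec {d n : ℕ} (s : ℝ) (f : Fin n → L2 d) : ℝ≥0∞ :=
  (∑ i, sobolevNorm s (f i) ^ 2) ^ (1 / 2 : ℝ)

/-- Membership in `H^s_per`. -/
def MemH {d : ℕ} (s : ℝ) (f : L2 d) : Prop := sobolevNorm s f < ⊤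

/-! ### Smooth periodic functions and weak derivatives -/

/-- Smooth functions on `ℝ^d` with period `2` in every coordinate, that is `C^∞_per` of the closed
cube. -/
def SmoothPeriodic {d : ℕ} (φ : (Fin d → ℝ) → ℝ) : Prop :=
  ContDiff ℝ ∞ φ ∧ ∀ (i : Fin d) (x : Fin d → ℝ), φ (x + Pi.single i 2) = φ x

/-- The classical partial derivative `∂_j φ`. -/
def partialDeriv {d : ℕ} (j : Fin d) (φ : (Fin d → ℝ) → ℝ) (x : Fin d → ℝ) : ℝ :=
  fderiv ℝ φ x (Pi.single j 1)

/-- `g` is the weak derivative `∂_j f` of the periodic function `f`. -/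
def IsWeakDeriv {d : ℕ} (j : Fin d) (f g : L2 d) : Prop :=
  ∀ φ : (Fin d → ℝ) → ℝ, SmoothPeriodic φ →
    ∫ x in box d, f x * partialDeriv j φ x = -∫ x in box d, g x * φ x

open Classical in
/-- The weak derivative `∂_j f` in `L²` (it is only used where it exists, i.e. for `f` in
`H¹_per`; otherwise the value is `0`). -/
def weakDeriv {d : ℕ} (j : Fin d) (f : L2 d) : L2 d :=
  if h : ∃ g, IsWeakDeriv j f g then h.choose else 0

/-- `div u = ∑ ∂_i u_i`. -/
def divergence {d : ℕ} (u : Fin d → L2 d) : L2 d := ∑ i, weakDeriv i (u i)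

/-- The anisotropic Laplacian `∑_j a_j ∂_j² f`. -/
def laplacian {d : ℕ} (a : Fin d → ℝ) (f : L2 d) : L2 d :=
  ∑ j, a j • weakDeriv j (weakDeriv j f)

/-! ### Parity and vertical average -/

/-- The reflection `(x, y, z) ↦ (x, y, -z)`. -/
def reflectZ (x : Fin 3 → ℝ) : Fin 3 → ℝ := ![x 0, x 1, -x 2]

/-- `f` is even in `z`. -/
def EvenZ (f : L2 3) : Prop := ∀ᵐ x ∂(volume.restrict (box 3)), f (reflectZ x) = f x

/-- `f` is odd in `z`. -/
def OddZ (f : L2 3) : Prop := ∀ᵐ x ∂(volume.restrict (box 3)), f (reflectZ x) = -f x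

/-- `∫_{-1}^{1} f(x,y,ξ) dξ = 0` for almost every `(x,y)` in `G`. -/
def VerticalMeanZero (f : L2 3) : Prop :=
  ∀ᵐ y ∂(volume.restrict (box 2)), ∫ ξ in (-1 : ℝ)..1, f ![y 0, y 1, ξ] = 0

/-! ### Solenoidal fields -/

/-- `L²_σ(G)`: the `L²`-closure of the smooth periodic divergence free fields on `G`. -/
def L2sigmaG : Set (Fin 2 → L2 2) :=
  closure {u | ∃ φ : Fin 2 → (Fin 2 → ℝ) → ℝ,
    (∀ i, SmoothPeriodic (φ i)) ∧
    (∀ x, ∑ i, partialDeriv i (φ i) x = 0) ∧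
    ∀ i, u i =ᵐ[volume.restrict (box 2)] φ i}

/-- `L²_σ(Ω)`: the `L²`-closure of the smooth periodic divergence free fields `(v, w)` on `Ω` with
`v` even in `z` and `w` odd in `z`. -/
def L2sigmaOmega : Set (Fin 3 → L2 3) :=
  closure {u | ∃ φ : Fin 3 → (Fin 3 → ℝ) → ℝ,
    (∀ i, SmoothPeriodic (φ i)) ∧
    (∀ x, ∑ i, partialDeriv i (φ i) x = 0) ∧
    (∀ x, φ 0 (reflectZ x) = φ 0 x) ∧
    (∀ x, φ 1 (reflectZ x) = φ 1 x) ∧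
    (∀ x, φ 2 (reflectZ x) = -φ 2 x) ∧
    ∀ i, u i =ᵐ[volume.restrict (box 3)] φ i}

/-! ### Time dependent functions -/

/-- `u` is in `H¹(0,T;L²)` with `∂_t u = u'` in `L²(0,T;L²)`. An element of `H¹(0,T;L²)` is
represented by its (unique) absolutely continuous representative on `[0,T]`, so that `u 0` is its
initial value. -/
structure IsTimeDeriv {d : ℕ} (T : ℝ) (u u' : ℝ → L2 d) : Prop where
  memLp : MemLp u' 2 (volume.restrict (Ioo 0 T))
  eq_integral : ∀ t ∈ Icc 0 T, u t = u 0 + ∫ s in (0 : ℝ)..t, u' s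

/-- The maximal regularity space `𝔼₁(T) = L²(0,T;H²_per) ∩ H¹(0,T;L²)`. -/
structure MemE1 {d : ℕ} (T : ℝ) (u : ℝ → L2 d) : Prop where
  memH1 : ∃ u', IsTimeDeriv T u u'
  memL2H2 : ∫⁻ t in Ioo 0 T, sobolevNorm 2 (u t) ^ 2 < ⊤

/-- Pressures: `p` in `L²(0,T;H¹_per)` with mean zero for almost every time. -/
structure MemPressure {d : ℕ} (T : ℝ) (p : ℝ → L2 d) : Prop where
  aestronglyMeasurable : AEStronglyMeasurable p (volume.restrict (Ioo 0 T))
  memL2H1 : ∫⁻ t in Ioo 0 T, sobolevNorm 1 (p t) ^ 2 < ⊤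
  mean_zero : ∀ᵐ t ∂(volume.restrict (Ioo 0 T)), ∫ x in box d, p t x = 0

/-- The norm of `L⁴(0,T;H^s_per)` for vector fields. -/
def normL4H {d n : ℕ} (T s : ℝ) (u : ℝ → Fin n → L2 d) : ℝ≥0∞ :=
  (∫⁻ t in Ioo 0 T, sobolevNormVec s (u t) ^ 4) ^ (1 / 4 : ℝ)

/-! ### The equations -/

/-- `v` is a strong solution on `(0,T)` of the two-dimensional periodic Navier-Stokes equations
`∂_t v + v·∇v - Δ_H v + ∇_H p = 0`, `div v = 0` in `(0,T) × G`, `v(0) = v₀`. -/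
structure IsNavierStokesSolution (T : ℝ) (v₀ : Fin 2 → L2 2) (v : ℝ → Fin 2 → L2 2) : Prop where
  memE1 : ∀ i, MemE1 T fun t => v t i
  initial : v 0 = v₀
  equations : ∃ (v' : ℝ → Fin 2 → L2 2) (p : ℝ → L2 2),
    (∀ i, IsTimeDeriv T (fun t => v t i) fun t => v' t i) ∧
    MemPressure T p ∧
    ∀ᵐ t ∂(volume.restrict (Ioo 0 T)),
      (∀ i, ∀ᵐ x ∂(volume.restrict (box 2)),
        v' t i x + ∑ j, v t j x * weakDeriv j (v t i) x
          - laplacian ![1, 1] (v t i) x + weakDeriv i (p t) x = 0) ∧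
      divergence (v t) = 0

/-- `u = (ṽ, w)` is a strong solution on `(0,T)` of the vertically average free scaled Stokes
equations `∂_t ṽ - Δ_δ ṽ + ∇_H p = 0`, `∂_t w - Δ_δ w + ε⁻² ∂_z p = 0`, `div u = 0` in
`(0,T) × Ω`, `u(0) = u₀`, where `Δ_δ = ∂_x² + ∂_y² + δ ∂_z²`, with periodic `ṽ, w, p`, with
`∫_{-1}^{1} ṽ dz = 0` and `∫_{-1}^{1} p dz = 0`, with `ṽ, p` even in `z` and `w` odd in `z`. -/
structure IsScaledStokesSolution (T ε δ : ℝ) (u₀ : Fin 3 → L2 3) (u : ℝ → Fin 3 → L2 3) :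
    Prop where
  memE1 : ∀ i, MemE1 T fun t => u t i
  initial : u 0 = u₀
  equations : ∃ (u' : ℝ → Fin 3 → L2 3) (p : ℝ → L2 3),
    (∀ i, IsTimeDeriv T (fun t => u t i) fun t => u' t i) ∧
    MemPressure T p ∧
    ∀ᵐ t ∂(volume.restrict (Ioo 0 T)),
      u' t 0 - laplacian ![1, 1, δ] (u t 0) + weakDeriv 0 (p t) = 0 ∧
      u' t 1 - laplacian ![1, 1, δ] (u t 1) + weakDeriv 1 (p t) = 0 ∧
      u' t 2 - laplacian ![1, 1, δ] (u t 2) + (1 / ε ^ 2) • weakDeriv 2 (p t) = 0 ∧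
      divergence (u t) = 0 ∧
      VerticalMeanZero (u t 0) ∧ VerticalMeanZero (u t 1) ∧ VerticalMeanZero (p t) ∧
      EvenZ (u t 0) ∧ EvenZ (u t 1) ∧ OddZ (u t 2) ∧ EvenZ (p t)

/-- `(v, u)` is a strong solution of the decoupled system consisting of the two-dimensional
Navier-Stokes equations and the vertically average free scaled Stokes equations. -/
structure IsStrongSolution (T ε δ : ℝ) (v₀ : Fin 2 → L2 2) (u₀ : Fin 3 → L2 3)
    (v : ℝ → Fin 2 → L2 2) (u : ℝ → Fin 3 → L2 3) : Prop where
  navierStokes : IsNavierStokesSolution T v₀ v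
  stokes : IsScaledStokesSolution T ε δ u₀ u

/-- The rescaled field `(ṽ, ε w)` of `u = (ṽ, w)`. -/
def rescale (ε : ℝ) (u : Fin 3 → L2 3) : Fin 3 → L2 3 := ![u 0, u 1, ε • u 2]

end

end ScaledStokes

/-! Everything is done on Fourier coefficients. Parseval and Riesz-Fischer identify real L²
functions with Hermitian ℓ² families, and derivatives, parity, divergence and vertical mean become
conditions on coefficients (`isWeakDeriv_iff`, `evenZ_iff`, `divergence_eq_zero_iff`,
`verticalMeanZero_iff`).

Stokes part. The symbol λ(k) of -Δ_δ is the same for all three components, so the operator commutes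
with the divergence. The divergence of the momentum equations therefore reads (k₀² + k₁² + k₂²/ε²)
p̂(k) = 0: the pressure gradient vanishes, and every solution is û(t,k) = exp(-λ(k)t) û₀(k),
whatever ε is (`IsScaledStokesSolution.boxFourierCoeff_eq`). The formula gives uniqueness, and the
flow it defines is a solution (`isScaledStokesSolution_stokesFlow`). A vanishing vertical mean
leaves only modes with k₂ ≠ 0, where λ ≥ π²δ. Hence every Sobolev norm decays like exp(-π²δt), whose
L⁴ norm in time is at most (4π²δ)^(-1/4) ≤ δ^(-1/4), so that C = 1 works
(`IsScaledStokesSolution.normL4H_le`).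

Navier-Stokes part. The Galerkin truncation is applied to the vorticity equation. Transport by a
divergence free field is antisymmetric, also after truncation to a finite symmetric set of modes
(`sum_advection_mul_conj`), so the enstrophy identity holds exactly. It gives global approximations
bounded in L^∞(H¹) and L²(H²), uniformly in the truncation (`exists_vorticity`, `exists_galerkin`).
The Biot-Savart law turns them into truncated velocity equations (`curl_nonlinearity`,
`velocity_vorticityField`).

One L² energy estimate with Grönwall's inequality does the rest (`IsFourierSolution.stability`). Its
Grönwall coefficient is the squared ℓ¹ norm of the Fourier coefficients, integrable in time because
H² embeds into the Wiener algebra in two dimensions (`normOne_sq_le`). Comparing two truncations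
makes the approximations Cauchy in L², uniformly in time, which passes the quadratic term to the
limit (`exists_fourier_limit`); comparing two untruncated solutions gives uniqueness. -/

namespace ScaledStokes

noncomputable section

/-! ### Fourier analysis on the cube, transported from the unit torus. -/

section TorusTransport

open Filter Topology

local instance : MeasureSpace UnitAddCircle := ⟨AddCircle.haarAddCircle⟩

local instance : Measure.IsAddHaarMeasure (volume : Measure UnitAddCircle) :=
  inferInstanceAs (Measure.IsAddHaarMeasure AddCircle.haarAddCircle)

local instance : IsProbabilityMeasure (volume : Measure UnitAddCircle) :=
  inferInstanceAs (IsProbabilityMeasure AddCircle.haarAddCircle)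

variable {d : ℕ}

lemma measurableSet_box : MeasurableSet (box d) :=
  MeasurableSet.univ_pi fun _ => measurableSet_Ioo

lemma volume_box : volume (box d) = 2 ^ d := by
  rw [box, volume_pi, Measure.pi_pi]
  norm_num [Real.volume_Ioo]

instance isFiniteMeasure_restrict_box : IsFiniteMeasure (volume.restrict (box d)) :=
  ⟨by rw [Measure.restrict_apply_univ, volume_box]; exact ENNReal.pow_lt_top (by norm_num)⟩

/-- The covering map from `ℝ^d` to the torus `(ℝ / 2ℤ)^d`, the latter rescaled to period `1`. -/
def toTorus (x : Fin d → ℝ) : UnitAddTorus (Fin d) := fun i => ((x i / 2 : ℝ) : UnitAddCircle)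

/-- The section of `toTorus` with values in `(-1, 1]^d`. -/
def fromTorus (y : UnitAddTorus (Fin d)) : Fin d → ℝ :=
  fun i => 2 * (AddCircle.equivIoc 1 (-1 / 2) (y i)).1

lemma measurable_toTorus : Measurable (toTorus (d := d)) :=
  measurable_pi_lambda _ fun i =>
    AddCircle.measurable_mk'.comp ((measurable_pi_apply i).div_const 2)

lemma measurable_fromTorus : Measurable (fromTorus (d := d)) := by
  refine measurable_pi_lambda _ fun i => ?_
  have h := (AddCircle.measurableEquivIoc (T := 1) (-1 / 2)).measurable
  exact (measurable_subtype_coe.comp (h.comp (measurable_pi_apply i))).const_mul 2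

lemma fromTorus_toTorus {x : Fin d → ℝ} (hx : x ∈ box d) : fromTorus (toTorus x) = x := by
  funext i
  have hi := hx i (mem_univ i)
  have : ((AddCircle.equivIoc 1 (-1 / 2) ((x i / 2 : ℝ) : UnitAddCircle)) : ℝ) = x i / 2 := by
    rw [AddCircle.equivIoc_coe_of_mem]
    constructor <;> linarith [hi.1, hi.2]
  simp only [fromTorus, toTorus, this]
  ring

lemma toTorus_fromTorus (y : UnitAddTorus (Fin d)) : toTorus (fromTorus y) = y := by
  funext i
  have := (AddCircle.equivIoc 1 (-1 / 2)).symm_apply_apply (y i)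
  simp only [fromTorus, toTorus]
  rw [mul_div_cancel_left₀ _ two_ne_zero]
  exact this

/-- Halving coordinates turns the cube into a fundamental domain of the unit torus up to null faces.
The factor is the volume of the cube, the torus carrying its Haar probability measure. -/
lemma map_toTorus : (volume.restrict (box d)).map toTorus = (2 ^ d : ℝ≥0∞) • volume := by
  have hm : Measurable (fun (x : Fin d → ℝ) i => (x i : UnitAddCircle)) :=
    measurable_pi_lambda _ fun i => AddCircle.measurable_mk'.comp (measurable_pi_apply i)
  have hIoc : (volume.restrict {x : Fin d → ℝ | ∀ i, x i ∈ Ioc (-1 / 2 : ℝ) (-1 / 2 + 1)}).map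
      (fun x i => (x i : UnitAddCircle)) = volume := by
    ext s hs
    rw [Measure.map_apply hm hs, ← lintegral_indicator_one hs,
      UnitAddTorus.lintegral_preimage _ (fun _ => -1 / 2), ← lintegral_indicator_one (hm hs)]
    rfl
  have hs : (volume.restrict (box d)).map (fun x => (2⁻¹ : ℝ) • x) =
      (2 ^ d : ℝ≥0∞) • volume.restrict {x : Fin d → ℝ | ∀ i, x i ∈ Ioc (-1 / 2 : ℝ) (-1 / 2 + 1)} := by
    have hpre : box d = (fun x : Fin d → ℝ => (2⁻¹ : ℝ) • x) ⁻¹'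
        (univ.pi fun _ => Ioo (-1 / 2 : ℝ) (-1 / 2 + 1)) := by
      ext x
      refine forall_congr' fun i => forall_congr' fun _ => ?_
      simp only [Pi.smul_apply, smul_eq_mul, mem_Ioo]
      refine and_congr ?_ ?_ <;> constructor <;> intro h <;> linarith
    rw [hpre, ← Measure.restrict_map (measurable_const_smul _)
      (MeasurableSet.univ_pi fun _ => measurableSet_Ioo),
      Measure.map_addHaar_smul _ (by norm_num), Measure.restrict_smul]
    congr 1
    · simp [abs_of_pos, ENNReal.ofReal_pow]
    · refine Measure.restrict_congr_set ?_
      have h1 := Measure.univ_pi_Ioo_ae_eq_Icc (μ := fun _ : Fin d => (volume : Measure ℝ))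
        (f := fun _ => (-1 / 2 : ℝ)) (g := fun _ => (-1 / 2 + 1 : ℝ))
      have h2 := Measure.univ_pi_Ioc_ae_eq_Icc (μ := fun _ : Fin d => (volume : Measure ℝ))
        (f := fun _ => (-1 / 2 : ℝ)) (g := fun _ => (-1 / 2 + 1 : ℝ))
      refine (h1.trans h2.symm).trans (Filter.EventuallyEq.of_eq ?_)
      ext x
      exact Set.mem_univ_pi
  have hc : toTorus (d := d) = (fun x i => (x i : UnitAddCircle)) ∘ fun x => (2⁻¹ : ℝ) • x := by
    funext x i
    simp [toTorus, div_eq_inv_mul]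
  rw [hc, ← Measure.map_map hm (measurable_const_smul _), hs, Measure.map_smul, hIoc]

lemma map_fromTorus :
    (volume : Measure (UnitAddTorus (Fin d))).map fromTorus =
      (2 ^ d : ℝ≥0∞)⁻¹ • volume.restrict (box d) := by
  have h : (2 ^ d : ℝ≥0∞) • (volume : Measure (UnitAddTorus (Fin d))).map fromTorus =
      volume.restrict (box d) := by
    rw [← Measure.map_smul, ← map_toTorus, Measure.map_map measurable_fromTorus measurable_toTorus]
    conv_rhs => rw [← Measure.map_id (μ := volume.restrict (box d))]
    refine Measure.map_congr ?_
    filter_upwards [ae_restrict_mem measurableSet_box] with x hx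
    exact fromTorus_toTorus hx
  rw [← h, smul_smul, ENNReal.inv_mul_cancel (by simp) (by simp), one_smul]

lemma mFourier_toTorus (k : Fin d → ℤ) (x : Fin d → ℝ) :
    UnitAddTorus.mFourier k (toTorus x) =
      Complex.exp (Complex.I * ((Real.pi * ∑ i, (k i : ℝ) * x i : ℝ) : ℂ)) := by
  simp only [UnitAddTorus.mFourier, ContinuousMap.coe_mk, toTorus, fourier_coe_apply]
  rw [← Complex.exp_sum]
  congr 1
  push_cast
  rw [Finset.mul_sum, Finset.mul_sum]
  refine Finset.sum_congr rfl fun i _ => ?_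
  ring

lemma integral_fromTorus {E : Type*} [NormedAddCommGroup E] [NormedSpace ℝ E]
    {g : (Fin d → ℝ) → E} (hg : AEStronglyMeasurable g (volume.restrict (box d))) :
    ∫ y, g (fromTorus (d := d) y) = ((2 : ℝ) ^ d)⁻¹ • ∫ x in box d, g x := by
  rw [← integral_map measurable_fromTorus.aemeasurable
    (by rw [map_fromTorus]; exact hg.smul_measure _), map_fromTorus, integral_smul_measure]
  simp

lemma memLp_fromTorus {E : Type*} [NormedAddCommGroup E] {p : ℝ≥0∞}
    {g : (Fin d → ℝ) → E} (hg : MemLp g p (volume.restrict (box d))) :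
    MemLp (fun y => g (fromTorus (d := d) y)) p volume := by
  have : MemLp g p ((volume : Measure (UnitAddTorus (Fin d))).map fromTorus) := by
    rw [map_fromTorus]
    exact hg.smul_measure (by simp)
  exact this.comp_of_map measurable_fromTorus.aemeasurable

lemma memLp_toTorus {E : Type*} [NormedAddCommGroup E] {p : ℝ≥0∞}
    {g : UnitAddTorus (Fin d) → E} (hg : MemLp g p volume) :
    MemLp (fun x => g (toTorus (d := d) x)) p (volume.restrict (box d)) := by
  have : MemLp g p ((volume.restrict (box d)).map toTorus) := by
    rw [map_toTorus]
    exact hg.smul_measure (by simp)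
  exact this.comp_of_map measurable_toTorus.aemeasurable

/-- The exponential `exp(iπ k·x)`. -/
def expk (k : Fin d → ℤ) (x : Fin d → ℝ) : ℂ :=
  Complex.exp (Complex.I * ((Real.pi * ∑ i, (k i : ℝ) * x i : ℝ) : ℂ))

lemma continuous_expk (k : Fin d → ℤ) : Continuous (expk k) := by
  unfold expk
  fun_prop

lemma norm_expk (k : Fin d → ℤ) (x : Fin d → ℝ) : ‖expk k x‖ = 1 := by
  rw [expk, mul_comm, Complex.norm_exp_ofReal_mul_I]

lemma expk_neg (k : Fin d → ℤ) (x : Fin d → ℝ) :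
    expk (-k) x = Complex.exp (-(Complex.I * ((Real.pi * ∑ i, (k i : ℝ) * x i : ℝ) : ℂ))) := by
  simp [expk, Finset.sum_neg_distrib]

lemma conj_expk (k : Fin d → ℤ) (x : Fin d → ℝ) :
    (starRingEnd ℂ) (expk k x) = expk (-k) x := by
  rw [expk_neg, expk, ← Complex.exp_conj]
  simp

lemma expk_add (k l : Fin d → ℤ) (x : Fin d → ℝ) : expk (k + l) x = expk k x * expk l x := by
  simp only [expk, ← Complex.exp_add]
  congr 1
  push_cast [Pi.add_apply]
  rw [← mul_add, ← mul_add, ← Finset.sum_add_distrib]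
  simp [add_mul]

lemma boxFourierCoeff_eq (f : L2 d) (k : Fin d → ℤ) :
    boxFourierCoeff f k = (1 / 2 ^ d : ℂ) * ∫ x in box d, (f x : ℂ) * expk (-k) x := by
  simp only [boxFourierCoeff, expk_neg]

/-- The function on the torus that corresponds to `f`. -/
def torusLift (f : L2 d) : Lp ℂ 2 (volume : Measure (UnitAddTorus (Fin d))) :=
  (memLp_fromTorus (g := fun x => ((f x : ℝ) : ℂ)) (Lp.memLp f).ofReal).toLp _

lemma coeFn_torusLift (f : L2 d) : torusLift f =ᵐ[volume] fun y => ((f (fromTorus y) : ℝ) : ℂ) :=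
  MemLp.coeFn_toLp _

lemma mFourierCoeff_torusLift (f : L2 d) (k : Fin d → ℤ) :
    UnitAddTorus.mFourierCoeff (torusLift f) k = boxFourierCoeff f k := by
  have h : ∀ y : UnitAddTorus (Fin d), UnitAddTorus.mFourier (-k) y = expk (-k) (fromTorus y) := by
    intro y
    conv_lhs => rw [← toTorus_fromTorus y, mFourier_toTorus]
    rfl
  rw [UnitAddTorus.mFourierCoeff, boxFourierCoeff_eq]
  have : ∫ y, UnitAddTorus.mFourier (-k) y • torusLift f y =
      ∫ y, ((f (fromTorus (d := d) y) : ℂ) * expk (-k) (fromTorus y)) := by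
    refine integral_congr_ae ?_
    filter_upwards [coeFn_torusLift f] with y hy
    rw [hy, h, smul_eq_mul, mul_comm]
  rw [this, integral_fromTorus (g := fun x => (f x : ℂ) * expk (-k) x)
    ((Complex.continuous_ofReal.comp_aestronglyMeasurable (Lp.aestronglyMeasurable f)).mul
      (continuous_expk _).aestronglyMeasurable), Complex.real_smul]
  push_cast
  rw [one_div]

/-- **Parseval's identity** on the box for inner products. -/
lemma hasSum_boxFourierCoeff_mul (f g : L2 d) :
    HasSum (fun k => (starRingEnd ℂ) (boxFourierCoeff f k) * boxFourierCoeff g k)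
      ((((2 : ℝ) ^ d)⁻¹ * ∫ x in box d, f x * g x : ℝ) : ℂ) := by
  have h := UnitAddTorus.hasSum_prod_mFourierCoeff (torusLift f) (torusLift g)
  simp only [mFourierCoeff_torusLift] at h
  convert! h using 1
  have : ∫ y, (starRingEnd ℂ) (torusLift f y) * torusLift g y =
      ∫ y, ((fun x => f x * g x) (fromTorus (d := d) y) : ℂ) := by
    refine integral_congr_ae ?_
    filter_upwards [coeFn_torusLift f, coeFn_torusLift g] with y hy hy'
    simp [hy, hy']
  rw [this]
  have h2 := integral_fromTorus (g := fun x => ((f x * g x : ℝ) : ℂ))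
    (Complex.continuous_ofReal.comp_aestronglyMeasurable
      ((Lp.aestronglyMeasurable f).mul (Lp.aestronglyMeasurable g)))
  simp only [Complex.ofReal_mul] at h2 ⊢
  rw [h2]
  rw [Complex.real_smul, ← integral_complex_ofReal]
  push_cast
  rfl

lemma norm_sq_eq_integral (f : L2 d) : ‖f‖ ^ 2 = ∫ x in box d, f x * f x := by
  rw [← real_inner_self_eq_norm_sq, MeasureTheory.L2.inner_def]
  rfl

/-- **Parseval's identity** on the box. -/
lemma hasSum_norm_sq_boxFourierCoeff (f : L2 d) :
    HasSum (fun k => ‖boxFourierCoeff f k‖ ^ 2) (((2 : ℝ) ^ d)⁻¹ * ‖f‖ ^ 2) := by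
  have h := hasSum_boxFourierCoeff_mul f f
  rw [← norm_sq_eq_integral] at h
  have h2 := Complex.hasSum_re h
  refine HasSum.congr_fun h2 fun k => ?_
  rw [← Complex.normSq_eq_conj_mul_self, Complex.ofReal_re, Complex.normSq_eq_norm_sq]

lemma integrable_mul_expk {f : (Fin d → ℝ) → ℝ} (hf : Integrable f (volume.restrict (box d)))
    (k : Fin d → ℤ) : Integrable (fun x => (f x : ℂ) * expk k x) (volume.restrict (box d)) :=
  hf.ofReal.mul_bdd (c := 1) (continuous_expk k).aestronglyMeasurable
    (Filter.Eventually.of_forall fun x => (norm_expk k x).le)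

lemma integrable_L2 (f : L2 d) : Integrable f (volume.restrict (box d)) :=
  (Lp.memLp f).integrable one_le_two

lemma norm_boxFourierCoeff_le (f : L2 d) (k : Fin d → ℤ) : ‖boxFourierCoeff f k‖ ≤ ‖f‖ := by
  have h := (hasSum_norm_sq_boxFourierCoeff f)
  have h1 := le_hasSum h k fun _ _ => sq_nonneg _
  have h2 : ((2 : ℝ) ^ d)⁻¹ ≤ 1 := inv_le_one_of_one_le₀ (one_le_pow₀ one_le_two)
  refine le_of_sq_le_sq (h1.trans ?_) (norm_nonneg _)
  nlinarith [sq_nonneg ‖f‖]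

/-- The `k`-th Fourier coefficient as a continuous linear map. -/
def coeffCLM (k : Fin d → ℤ) : L2 d →L[ℝ] ℂ :=
  LinearMap.mkContinuous
    { toFun := fun f => boxFourierCoeff f k
      map_add' := fun f g => by
        simp only [boxFourierCoeff_eq]
        rw [← mul_add, ← integral_add (integrable_mul_expk (integrable_L2 f) _)
          (integrable_mul_expk (integrable_L2 g) _)]
        congr 1
        refine integral_congr_ae ?_
        filter_upwards [Lp.coeFn_add f g] with x hx
        rw [hx, Pi.add_apply]
        push_cast
        ring
      map_smul' := fun c f => by
        simp only [boxFourierCoeff_eq, RingHom.id_apply, Complex.real_smul]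
        rw [mul_left_comm, ← integral_const_mul (c : ℂ)]
        congr 1
        refine integral_congr_ae ?_
        filter_upwards [Lp.coeFn_smul c f] with x hx
        rw [hx, Pi.smul_apply, smul_eq_mul]
        push_cast
        ring } 1 fun f => by rw [one_mul]; exact norm_boxFourierCoeff_le f k

@[simp] lemma boxFourierCoeff_add (f g : L2 d) (k : Fin d → ℤ) :
    boxFourierCoeff (f + g) k = boxFourierCoeff f k + boxFourierCoeff g k :=
  map_add (coeffCLM k) f g

@[simp] lemma boxFourierCoeff_sub (f g : L2 d) (k : Fin d → ℤ) :
    boxFourierCoeff (f - g) k = boxFourierCoeff f k - boxFourierCoeff g k :=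
  map_sub (coeffCLM k) f g

@[simp] lemma boxFourierCoeff_smul (c : ℝ) (f : L2 d) (k : Fin d → ℤ) :
    boxFourierCoeff (c • f) k = c * boxFourierCoeff f k :=
  map_smul (coeffCLM k) c f

@[simp] lemma boxFourierCoeff_zero (k : Fin d → ℤ) : boxFourierCoeff (0 : L2 d) k = 0 :=
  map_zero (coeffCLM k)

@[simp] lemma boxFourierCoeff_sum {ι : Type*} (s : Finset ι) (f : ι → L2 d) (k : Fin d → ℤ) :
    boxFourierCoeff (∑ i ∈ s, f i) k = ∑ i ∈ s, boxFourierCoeff (f i) k :=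
  map_sum (coeffCLM k) f s

/-- Parseval applied to the difference. This is how all identities in L² are reduced to identities
between coefficients. -/
lemma eq_of_boxFourierCoeff_eq {f g : L2 d}
    (h : ∀ k, boxFourierCoeff f k = boxFourierCoeff g k) : f = g := by
  have hs := hasSum_norm_sq_boxFourierCoeff (f - g)
  simp only [boxFourierCoeff_sub, h, sub_self, norm_zero, ne_eq, OfNat.ofNat_ne_zero,
    not_false_eq_true, zero_pow] at hs
  have h0 := hs.unique hasSum_zero
  rw [mul_eq_zero, or_iff_right (by positivity), sq_eq_zero_iff, norm_eq_zero] at h0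
  exact sub_eq_zero.mp h0

lemma boxFourierCoeff_neg (f : L2 d) (k : Fin d → ℤ) :
    boxFourierCoeff f (-k) = (starRingEnd ℂ) (boxFourierCoeff f k) := by
  simp only [boxFourierCoeff_eq, map_mul, ← integral_conj, conj_expk, Complex.conj_ofReal]
  simp [Complex.conj_ofNat]

lemma summable_norm_sq_boxFourierCoeff (f : L2 d) :
    Summable fun k => ‖boxFourierCoeff f k‖ ^ 2 :=
  (hasSum_norm_sq_boxFourierCoeff f).summable

lemma norm_sq_eq_tsum (f : L2 d) : ‖f‖ ^ 2 = 2 ^ d * ∑' k, ‖boxFourierCoeff f k‖ ^ 2 := by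
  rw [(hasSum_norm_sq_boxFourierCoeff f).tsum_eq]
  field_simp

lemma ae_fromTorus {p : (Fin d → ℝ) → Prop} (h : ∀ᵐ x ∂(volume.restrict (box d)), p x) :
    ∀ᵐ y : UnitAddTorus (Fin d), p (fromTorus y) := by
  refine ae_of_ae_map measurable_fromTorus.aemeasurable ?_
  rw [map_fromTorus]
  exact Measure.ae_smul_measure h _

lemma ae_toTorus {p : UnitAddTorus (Fin d) → Prop} (h : ∀ᵐ y, p y) :
    ∀ᵐ x ∂(volume.restrict (box d)), p (toTorus x) := by
  refine ae_of_ae_map measurable_toTorus.aemeasurable ?_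
  rw [map_toTorus]
  exact Measure.ae_smul_measure h _

/-- **Riesz-Fischer**: a square summable family with the symmetry of a real function is the family
of Fourier coefficients of a function in `L²`. -/
lemma exists_boxFourierCoeff_eq {a : (Fin d → ℤ) → ℂ} (ha : Summable fun k => ‖a k‖ ^ 2)
    (hs : ∀ k, a (-k) = (starRingEnd ℂ) (a k)) : ∃ f : L2 d, ∀ k, boxFourierCoeff f k = a k := by
  have hmem : Memℓp a 2 := by
    rw [memℓp_gen_iff (by norm_num)]
    simpa using ha
  set F := UnitAddTorus.mFourierBasis.repr.symm (⟨a, hmem⟩ : lp (fun _ : Fin d → ℤ => ℂ) 2) with hF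
  have hFc : ∀ k, UnitAddTorus.mFourierCoeff F k = a k := fun k => by
    rw [← UnitAddTorus.mFourierBasis_repr, hF, LinearIsometryEquiv.apply_symm_apply]
  -- Taking the real part averages `a k` with the conjugate of `a (-k)`, which changes nothing for a
  -- Hermitian family; so the reality of `F` need not be shown.
  have hre : MemLp (fun x => (F (toTorus x)).re) 2 (volume.restrict (box d)) :=
    (memLp_toTorus (Lp.memLp F)).re
  refine ⟨hre.toLp _, fun k => ?_⟩
  rw [← mFourierCoeff_torusLift]
  have hae : torusLift (hre.toLp _) =ᵐ[volume] fun y => ((F y).re : ℂ) := by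
    filter_upwards [coeFn_torusLift (hre.toLp _), ae_fromTorus hre.coeFn_toLp] with y h1 h2
    rw [h1, h2, toTorus_fromTorus]
  have hint : ∀ l : Fin d → ℤ, Integrable (fun y => UnitAddTorus.mFourier l y • F y) := fun l =>
    ((Lp.memLp F).integrable one_le_two).bdd_mul (c := 1)
      (UnitAddTorus.mFourier l).continuous.aestronglyMeasurable
      (Filter.Eventually.of_forall fun y =>
        ((UnitAddTorus.mFourier l).norm_coe_le_norm y).trans UnitAddTorus.mFourier_norm.le)
  have : UnitAddTorus.mFourierCoeff (torusLift (hre.toLp _)) k =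
      ∫ y, ((1 / 2 : ℂ) * (UnitAddTorus.mFourier (-k) y • F y) +
        (1 / 2 : ℂ) * (starRingEnd ℂ) (UnitAddTorus.mFourier k y • F y)) := by
    refine integral_congr_ae ?_
    filter_upwards [hae] with y hy
    rw [hy, Complex.re_eq_add_conj, smul_eq_mul, smul_eq_mul, smul_eq_mul, map_mul,
      ← UnitAddTorus.mFourier_neg]
    ring
  rw [this, integral_add ((hint _).const_mul _) ?_, integral_const_mul, integral_const_mul,
    integral_conj]
  · have h1 : ∫ y, UnitAddTorus.mFourier (-k) y • F y = a k := hFc k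
    have h2 : ∫ y, UnitAddTorus.mFourier k y • F y = a (-k) := by
      rw [← hFc (-k), UnitAddTorus.mFourierCoeff, neg_neg]
    rw [h1, h2, hs, Complex.conj_conj]
    ring
  · exact (((Complex.conjCLE : ℂ →L[ℝ] ℂ).integrable_comp (hint k)).const_mul _)

/-- The Fourier series converges in L², hence almost everywhere along a sequence of finite partial
sums, each of which obeys the bound. -/
lemma norm_le_tsum_norm_boxFourierCoeff (f : L2 d)
    (hf : Summable fun k => ‖boxFourierCoeff f k‖) :
    ∀ᵐ x ∂(volume.restrict (box d)), ‖f x‖ ≤ ∑' k, ‖boxFourierCoeff f k‖ := by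
  have h := UnitAddTorus.hasSum_mFourier_series_L2 (torusLift f)
  simp only [mFourierCoeff_torusLift] at h
  obtain ⟨ns, -, hns⟩ := (tendstoInMeasure_of_tendsto_Lp h).exists_seq_tendsto_ae'
  have hsum : ∀ s : Finset (Fin d → ℤ), ∀ᵐ y, ‖(∑ k ∈ s, boxFourierCoeff f k •
      UnitAddTorus.mFourierLp 2 k : Lp ℂ 2 (volume : Measure (UnitAddTorus (Fin d)))) y‖ ≤
      ∑' k, ‖boxFourierCoeff f k‖ := by
    intro s
    have h1 : ∀ k ∈ s, ∀ᵐ y, (boxFourierCoeff f k • UnitAddTorus.mFourierLp 2 k :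
        Lp ℂ 2 (volume : Measure (UnitAddTorus (Fin d)))) y =
        boxFourierCoeff f k • UnitAddTorus.mFourier k y := fun k _ => by
      filter_upwards [Lp.coeFn_smul (boxFourierCoeff f k) (UnitAddTorus.mFourierLp 2 k),
        UnitAddTorus.coeFn_mFourierLp 2 k] with y hy hy'
      rw [hy, Pi.smul_apply, hy']
    filter_upwards [Lp.coeFn_finsetSum s fun k => (boxFourierCoeff f k • UnitAddTorus.mFourierLp 2 k :
        Lp ℂ 2 (volume : Measure (UnitAddTorus (Fin d)))),
      (Finset.eventually_all s).2 h1] with y hy hy'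
    rw [hy, Finset.sum_apply, Finset.sum_congr rfl hy']
    refine (norm_sum_le _ _).trans (le_trans (Finset.sum_le_sum fun k _ => ?_)
      (hf.sum_le_tsum s fun _ _ => norm_nonneg _))
    rw [norm_smul]
    exact mul_le_of_le_one_right (norm_nonneg _)
      (((UnitAddTorus.mFourier k).norm_coe_le_norm y).trans UnitAddTorus.mFourier_norm.le)
  have hall : ∀ᵐ y, ‖torusLift f y‖ ≤ ∑' k, ‖boxFourierCoeff f k‖ := by
    filter_upwards [hns, ae_all_iff.2 fun n => hsum (ns n)] with y h1 h2
    exact le_of_tendsto h1.norm (Filter.Eventually.of_forall h2)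
  filter_upwards [ae_toTorus hall, ae_toTorus (coeFn_torusLift f),
    ae_restrict_mem measurableSet_box] with x h1 h2 hx
  rw [h2, fromTorus_toTorus hx, Complex.norm_real] at h1
  exact h1

/-- The family of Fourier coefficients as an element of `ℓ²`. -/
def coeffLp (f : L2 d) : lp (fun _ : Fin d → ℤ => ℂ) 2 :=
  ⟨boxFourierCoeff f, (memℓp_gen_iff (by norm_num)).2
    (by simpa using summable_norm_sq_boxFourierCoeff f)⟩

lemma norm_coeffLp_sub_sq (f g : L2 d) :
    ‖f - g‖ ^ 2 = 2 ^ d * ‖coeffLp f - coeffLp g‖ ^ 2 := by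
  have h := lp.norm_rpow_eq_tsum (p := 2) (by norm_num) (coeffLp f - coeffLp g)
  norm_num at h
  rw [h, norm_sq_eq_tsum]
  simp only [boxFourierCoeff_sub]
  rfl

/-- By Parseval the map scales distances by a fixed factor. It serves to test strong measurability
coefficient by coefficient. -/
lemma isEmbedding_coeffLp : IsEmbedding (coeffLp (d := d)) := by
  have hs : (0 : ℝ) < √(2 ^ d) := by positivity
  have hnorm : ∀ f g : L2 d, dist f g = √(2 ^ d) * dist (coeffLp f) (coeffLp g) := by
    intro f g
    rw [dist_eq_norm, dist_eq_norm, ← Real.sqrt_sq (norm_nonneg (f - g)), norm_coeffLp_sub_sq,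
      Real.sqrt_mul (by positivity), Real.sqrt_sq (norm_nonneg _)]
  have h1 : AntilipschitzWith (Real.toNNReal √(2 ^ d)) (coeffLp (d := d)) :=
    AntilipschitzWith.of_le_mul_dist fun f g => by
      rw [hnorm f g, Real.coe_toNNReal _ hs.le]
  have h2 : LipschitzWith (Real.toNNReal (√(2 ^ d))⁻¹) (coeffLp (d := d)) :=
    LipschitzWith.of_dist_le_mul fun f g => by
      rw [hnorm f g, Real.coe_toNNReal _ (inv_nonneg.2 hs.le), inv_mul_cancel_left₀ hs.ne']
  exact (h1.isUniformEmbedding h2.uniformContinuous).isEmbedding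

/-- A curve in `L²` is strongly measurable as soon as its Fourier coefficients are. -/
lemma aestronglyMeasurable_of_boxFourierCoeff {α : Type*} [MeasurableSpace α] {μ : Measure α}
    {f : α → L2 d} (h : ∀ k, AEStronglyMeasurable (fun t => boxFourierCoeff (f t) k) μ) :
    AEStronglyMeasurable f μ := by
  classical
  rw [← isEmbedding_coeffLp.aestronglyMeasurable_comp_iff]
  refine aestronglyMeasurable_of_tendsto_ae (Filter.atTop (α := Finset (Fin d → ℤ)))
    (f := fun s t => ∑ k ∈ s, lp.single 2 k (boxFourierCoeff (f t) k)) (fun s => ?_)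
    (Filter.Eventually.of_forall fun t => lp.hasSum_single (by norm_num) (coeffLp (f t)))
  refine Finset.aestronglyMeasurable_fun_sum s fun k _ => ?_
  exact (lp.isometry_single (E := fun _ : Fin d → ℤ => ℂ) (p := 2) k).continuous.comp_aestronglyMeasurable
    (h k)

lemma memLp_mul_of_bounded (f : L2 d) {c : (Fin d → ℝ) → ℝ} (hc : AEStronglyMeasurable c
    (volume.restrict (box d))) {M : ℝ} (hM : ∀ᵐ x ∂(volume.restrict (box d)), ‖c x‖ ≤ M) :
    MemLp (fun x => c x * f x) 2 (volume.restrict (box d)) :=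
  (Lp.memLp f).of_le_mul (c := M) (hc.mul (Lp.aestronglyMeasurable f)) (by
    filter_upwards [hM] with x hx
    rw [norm_mul]
    exact mul_le_mul_of_nonneg_right hx (norm_nonneg _))

/-- The Fourier coefficients of a product are given by convolution. -/
lemma hasSum_boxFourierCoeff_conv (f g : L2 d) (k : Fin d → ℤ) :
    HasSum (fun p => boxFourierCoeff f p * boxFourierCoeff g (k - p))
      ((1 / 2 ^ d : ℂ) * ∫ x in box d, ((f x * g x : ℝ) : ℂ) * expk (-k) x) := by
  -- Parseval is available for real functions only, so `g` times an exponential is split into its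
  -- products with a cosine and a sine.
  have hc : Continuous fun x => (expk k x).re := Complex.continuous_re.comp (continuous_expk k)
  have hs : Continuous fun x => (expk k x).im := Complex.continuous_im.comp (continuous_expk k)
  have hC := memLp_mul_of_bounded g hc.aestronglyMeasurable (M := 1)
    (Filter.Eventually.of_forall fun x => (Complex.abs_re_le_norm _).trans (norm_expk k x).le)
  have hS := memLp_mul_of_bounded g hs.aestronglyMeasurable (M := 1)
    (Filter.Eventually.of_forall fun x => (Complex.abs_im_le_norm _).trans (norm_expk k x).le)
  have hconj : ∀ x, expk (-k) x = ((expk k x).re : ℂ) - Complex.I * (expk k x).im := by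
    intro x
    rw [← conj_expk]
    apply Complex.ext <;> simp
  have key : ∀ p, boxFourierCoeff g (k - p) =
      boxFourierCoeff (hC.toLp _) (-p) - Complex.I * boxFourierCoeff (hS.toLp _) (-p) := by
    intro p
    simp only [boxFourierCoeff_eq]
    rw [mul_left_comm, ← mul_sub, ← integral_const_mul Complex.I, ← integral_sub
      (integrable_mul_expk (integrable_L2 _) _)
      ((integrable_mul_expk (integrable_L2 _) _).const_mul _)]
    congr 1
    refine integral_congr_ae ?_
    filter_upwards [hC.coeFn_toLp, hS.coeFn_toLp] with x h1 h2
    rw [h1, h2, neg_sub, sub_eq_add_neg, add_comm, expk_add, hconj, neg_neg]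
    push_cast
    ring
  have hneg : ∀ G : L2 d, HasSum (fun p => boxFourierCoeff f p * boxFourierCoeff G (-p))
      ((((2 : ℝ) ^ d)⁻¹ * ∫ x in box d, f x * G x : ℝ) : ℂ) := by
    intro G
    have := (Equiv.neg (Fin d → ℤ)).hasSum_iff.2 (hasSum_boxFourierCoeff_mul f G)
    refine this.congr_fun fun p => ?_
    simp [boxFourierCoeff_neg]
  have h := (hneg (hC.toLp _)).sub ((hneg (hS.toLp _)).mul_left Complex.I)
  convert! h using 1
  · funext p
    rw [key]
    ring
  · have hm : ∀ G : L2 d, Integrable (fun x => ((f x * G x : ℝ) : ℂ)) (volume.restrict (box d)) :=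
      fun G => ((Lp.memLp f).integrable_mul (Lp.memLp G)).ofReal
    push_cast
    rw [← integral_complex_ofReal, ← integral_complex_ofReal, mul_left_comm, ← mul_sub,
      ← integral_const_mul Complex.I, ← integral_sub (hm _)
      ((hm _).const_mul _), one_div]
    congr 1
    refine integral_congr_ae ?_
    filter_upwards [hC.coeFn_toLp, hS.coeFn_toLp] with x h1 h2
    rw [h1, h2, hconj]
    push_cast
    ring

end TorusTransport

/-! ### Weak derivatives, Sobolev spaces and solenoidal fields as Fourier multipliers and
constraints. -/

section WeakDerivatives

variable {d : ℕ}

lemma box_subset_Icc : box d ⊆ Icc (fun _ => -1) (fun _ => 1) := fun _ hx =>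
  ⟨fun i => (hx i (mem_univ i)).1.le, fun i => (hx i (mem_univ i)).2.le⟩

lemma box_ae_eq_Icc : box d =ᵐ[volume] Icc (fun _ => (-1 : ℝ)) (fun _ => 1) :=
  Measure.univ_pi_Ioo_ae_eq_Icc (μ := fun _ : Fin d => (volume : Measure ℝ))

lemma memLp_box_of_continuous {φ : (Fin d → ℝ) → ℝ} (hφ : Continuous φ) (p : ℝ≥0∞) :
    MemLp φ p (volume.restrict (box d)) := by
  obtain ⟨M, hM⟩ := (isCompact_Icc (a := fun _ : Fin d => (-1 : ℝ)) (b := fun _ => 1)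
    ).exists_bound_of_continuousOn hφ.continuousOn
  refine MemLp.of_bound hφ.aestronglyMeasurable M ?_
  filter_upwards [ae_restrict_mem measurableSet_box] with x hx
  exact hM x (box_subset_Icc hx)

lemma SmoothPeriodic.continuous {φ : (Fin d → ℝ) → ℝ} (hφ : SmoothPeriodic φ) : Continuous φ :=
  hφ.1.continuous

lemma SmoothPeriodic.differentiable {φ : (Fin d → ℝ) → ℝ} (hφ : SmoothPeriodic φ) :
    Differentiable ℝ φ :=
  hφ.1.differentiable (by simp)

lemma SmoothPeriodic.continuous_partialDeriv {φ : (Fin d → ℝ) → ℝ} (hφ : SmoothPeriodic φ)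
    (j : Fin d) : Continuous (partialDeriv j φ) :=
  (hφ.1.continuous_fderiv (by simp)).clm_apply continuous_const

lemma SmoothPeriodic.mul {φ ψ : (Fin d → ℝ) → ℝ} (hφ : SmoothPeriodic φ)
    (hψ : SmoothPeriodic ψ) : SmoothPeriodic fun x => φ x * ψ x :=
  ⟨hφ.1.mul hψ.1, fun i x => by simp only [hφ.2, hψ.2]⟩

lemma partialDeriv_mul {φ ψ : (Fin d → ℝ) → ℝ} (hφ : SmoothPeriodic φ) (hψ : SmoothPeriodic ψ)
    (j : Fin d) (x : Fin d → ℝ) : partialDeriv j (fun x => φ x * ψ x) x =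
      partialDeriv j φ x * ψ x + φ x * partialDeriv j ψ x := by
  unfold partialDeriv
  rw [fderiv_fun_mul (hφ.differentiable x) (hψ.differentiable x)]
  simp only [add_apply, smul_apply, smul_eq_mul]
  ring

/-- Divergence theorem for the field with the single component φ in direction `j`; the two opposite
faces cancel by periodicity. -/
lemma integral_partialDeriv_eq_zero {φ : (Fin d → ℝ) → ℝ} (hφ : SmoothPeriodic φ) (j : Fin d) :
    ∫ x in box d, partialDeriv j φ x = 0 := by
  obtain _ | n := d
  · exact j.elim0
  rw [setIntegral_congr_set box_ae_eq_Icc]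
  have h := integral_divergence_of_hasFDerivAt_off_countable' (n := n) (E := ℝ)
    (fun _ => -1) (fun _ => 1) (fun _ => by norm_num)
    (fun i => if i = j then φ else 0) (fun i => if i = j then fderiv ℝ φ else 0) ∅
    countable_empty (fun i => by
      split_ifs
      · exact hφ.continuous.continuousOn
      · exact continuousOn_const) (fun x _ i => by
      split_ifs
      · exact (hφ.differentiable x).hasFDerivAt
      · exact hasFDerivAt_const _ _) ?_
  · have h1 : ∀ x, ∑ i, (if i = j then fderiv ℝ φ else 0) x (Pi.single i 1) =
        partialDeriv j φ x := by
      intro x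
      rw [Finset.sum_eq_single j (fun b _ hb => by simp [hb]) (by simp)]
      simp [partialDeriv]
    simp only [h1] at h
    rw [h]
    refine Finset.sum_eq_zero fun i _ => ?_
    by_cases hi : i = j
    · subst hi
      clear h h1
      rw [sub_eq_zero]
      congr 1
      funext x
      simp only [if_true]
      rw [← hφ.2 i (i.insertNth (-1) x)]
      congr 1
      funext l
      rcases eq_or_ne l i with rfl | hl
      · simp
        norm_num
      · obtain ⟨m, rfl⟩ := Fin.exists_succAbove_eq hl
        simp
    · simp [hi]
  · refine Continuous.integrableOn_Icc ?_
    refine continuous_finsetSum _ fun i _ => ?_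
    split_ifs
    · exact (hφ.1.continuous_fderiv (by simp)).clm_apply continuous_const
    · exact continuous_const

lemma integral_mul_partialDeriv {φ ψ : (Fin d → ℝ) → ℝ} (hφ : SmoothPeriodic φ)
    (hψ : SmoothPeriodic ψ) (j : Fin d) :
    ∫ x in box d, φ x * partialDeriv j ψ x = -∫ x in box d, partialDeriv j φ x * ψ x := by
  have h := integral_partialDeriv_eq_zero (hφ.mul hψ) j
  simp only [partialDeriv_mul hφ hψ] at h
  rw [integral_add] at h
  · linarith
  · exact (memLp_box_of_continuous ((hφ.continuous_partialDeriv j).mul hψ.continuous)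
      1).integrable le_rfl
  · exact (memLp_box_of_continuous (hφ.continuous.mul (hψ.continuous_partialDeriv j))
      1).integrable le_rfl

/-- The phase `π k·x`. -/
def phase (k : Fin d → ℤ) (x : Fin d → ℝ) : ℝ := Real.pi * ∑ i, (k i : ℝ) * x i

lemma contDiff_phase (k : Fin d → ℤ) : ContDiff ℝ ∞ (phase k) := by
  unfold phase
  fun_prop

lemma phase_add_single (k : Fin d → ℤ) (x : Fin d → ℝ) (i : Fin d) :
    phase k (x + Pi.single i 2) = phase k x + (k i : ℤ) * (2 * Real.pi) := by
  simp only [phase, Pi.add_apply, mul_add, Finset.sum_add_distrib]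
  rw [Finset.sum_eq_single (f := fun l => (k l : ℝ) * Pi.single (M := fun _ => ℝ) i 2 l) i
    (fun b _ hb => by simp [hb]) (by simp)]
  simp only [Pi.single_eq_same]
  ring

lemma fderiv_phase (k : Fin d → ℤ) (x : Fin d → ℝ) (j : Fin d) :
    fderiv ℝ (phase k) x (Pi.single j 1) = Real.pi * k j := by
  have h : phase k = (Real.pi • ∑ i, (k i : ℝ) • ContinuousLinearMap.proj (R := ℝ)
      (φ := fun _ : Fin d => ℝ) i : (Fin d → ℝ) →L[ℝ] ℝ) := by
    funext y
    simp [phase]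
  rw [h, ContinuousLinearMap.fderiv]
  simp only [smul_apply, sum_apply,
    ContinuousLinearMap.proj_apply, smul_eq_mul]
  rw [Finset.sum_eq_single j (fun b _ hb => by simp [hb]) (by simp)]
  simp

lemma smoothPeriodic_cos (k : Fin d → ℤ) : SmoothPeriodic fun x => Real.cos (phase k x) :=
  ⟨Real.contDiff_cos.comp (contDiff_phase k), fun i x => by
    simp only [phase_add_single, Real.cos_add_int_mul_two_pi]⟩

lemma smoothPeriodic_sin (k : Fin d → ℤ) : SmoothPeriodic fun x => Real.sin (phase k x) :=
  ⟨Real.contDiff_sin.comp (contDiff_phase k), fun i x => by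
    simp only [phase_add_single, Real.sin_add_int_mul_two_pi]⟩

lemma partialDeriv_cos (k : Fin d → ℤ) (j : Fin d) (x : Fin d → ℝ) :
    partialDeriv j (fun x => Real.cos (phase k x)) x = -(Real.pi * k j) * Real.sin (phase k x) := by
  rw [partialDeriv, fderiv_cos ((contDiff_phase k).differentiable (by simp) x)]
  simp only [smul_apply, fderiv_phase, smul_eq_mul]
  ring

lemma partialDeriv_sin (k : Fin d → ℤ) (j : Fin d) (x : Fin d → ℝ) :
    partialDeriv j (fun x => Real.sin (phase k x)) x = Real.pi * k j * Real.cos (phase k x) := by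
  rw [partialDeriv, fderiv_sin ((contDiff_phase k).differentiable (by simp) x)]
  simp only [smul_apply, fderiv_phase, smul_eq_mul]
  ring

/-- Test functions for weak derivatives are real, so a coefficient has to be expressed through
cosine and sine integrals before they can be applied. -/
lemma boxFourierCoeff_eq_cos_sin (f : L2 d) (k : Fin d → ℤ) :
    boxFourierCoeff f k = (1 / 2 ^ d : ℂ) * ((∫ x in box d, f x * Real.cos (phase k x) : ℝ) -
      Complex.I * (∫ x in box d, f x * Real.sin (phase k x) : ℝ)) := by
  have h1 : Integrable (fun x => f x * Real.cos (phase k x)) (volume.restrict (box d)) :=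
    (integrable_L2 f).mul_bdd (c := 1) (smoothPeriodic_cos k).continuous.aestronglyMeasurable
      (Filter.Eventually.of_forall fun x => Real.abs_cos_le_one _)
  have h2 : Integrable (fun x => f x * Real.sin (phase k x)) (volume.restrict (box d)) :=
    (integrable_L2 f).mul_bdd (c := 1) (smoothPeriodic_sin k).continuous.aestronglyMeasurable
      (Filter.Eventually.of_forall fun x => Real.abs_sin_le_one _)
  have h3 : Integrable (fun x => ((f x * Real.cos (phase k x) : ℝ) : ℂ))
    (volume.restrict (box d)) := h1.ofReal
  have h4 : Integrable (fun x => ((f x * Real.sin (phase k x) : ℝ) : ℂ))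
    (volume.restrict (box d)) := h2.ofReal
  rw [boxFourierCoeff, ← integral_complex_ofReal, ← integral_complex_ofReal,
    ← integral_const_mul Complex.I, ← integral_sub h3 (h4.const_mul Complex.I)]
  congr 1
  refine integral_congr_ae (Filter.Eventually.of_forall fun x => ?_)
  simp only
  rw [show -(Complex.I * ((Real.pi * ∑ i, (k i : ℝ) * x i : ℝ) : ℂ)) =
    ((-phase k x : ℝ) : ℂ) * Complex.I by rw [phase]; push_cast; ring, Complex.exp_mul_I,
    ← Complex.ofReal_cos, ← Complex.ofReal_sin, Real.cos_neg, Real.sin_neg]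
  push_cast
  ring

lemma IsWeakDeriv.boxFourierCoeff {j : Fin d} {f g : L2 d} (h : IsWeakDeriv j f g)
    (k : Fin d → ℤ) :
    boxFourierCoeff g k = Complex.I * (Real.pi * k j) * boxFourierCoeff f k := by
  have hc := h _ (smoothPeriodic_cos k)
  have hs := h _ (smoothPeriodic_sin k)
  simp only [partialDeriv_cos, partialDeriv_sin] at hc hs
  rw [boxFourierCoeff_eq_cos_sin, boxFourierCoeff_eq_cos_sin, ← neg_eq_iff_eq_neg.2 hc,
    ← neg_eq_iff_eq_neg.2 hs]
  simp only [mul_left_comm (f _), integral_const_mul]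
  push_cast
  linear_combination (1 / 2 ^ d : ℂ) * (Real.pi * k j) *
    (∫ x in box d, f x * Real.sin (phase k x) : ℝ) * Complex.I_sq

lemma SmoothPeriodic.isWeakDeriv {φ : (Fin d → ℝ) → ℝ} (hφ : SmoothPeriodic φ) (j : Fin d)
    {g f : L2 d} (hf : f =ᵐ[volume.restrict (box d)] φ)
    (hg : g =ᵐ[volume.restrict (box d)] partialDeriv j φ) : IsWeakDeriv j f g := by
  intro ψ hψ
  have h1 : ∫ x in box d, f x * partialDeriv j ψ x = ∫ x in box d, φ x * partialDeriv j ψ x :=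
    integral_congr_ae (hf.mul (ae_eq_refl (partialDeriv j ψ)))
  have h2 : ∫ x in box d, g x * ψ x = ∫ x in box d, partialDeriv j φ x * ψ x :=
    integral_congr_ae (hg.mul (ae_eq_refl ψ))
  rw [h1, h2]
  exact integral_mul_partialDeriv hφ hψ j

/-- Forwards, cosines and sines are admissible test functions. Backwards, Parseval expands both
pairings with a smooth test function, whose own derivative obeys the same multiplier rule. -/
lemma isWeakDeriv_iff {j : Fin d} {f g : L2 d} : IsWeakDeriv j f g ↔
    ∀ k, boxFourierCoeff g k = Complex.I * (Real.pi * k j) * boxFourierCoeff f k := by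
  refine ⟨fun h => h.boxFourierCoeff, fun h φ hφ => ?_⟩
  have hd := memLp_box_of_continuous (hφ.continuous_partialDeriv j) 2
  have h0 := memLp_box_of_continuous hφ.continuous 2
  have hw := hφ.isWeakDeriv j h0.coeFn_toLp hd.coeFn_toLp
  have h1 := hasSum_boxFourierCoeff_mul f (hd.toLp _)
  have h2 := (hasSum_boxFourierCoeff_mul g (h0.toLp _)).neg
  have h3 := h1.unique (h2.congr_fun fun k => by
    rw [hw.boxFourierCoeff, h]
    simp only [map_mul, Complex.conj_I, Complex.conj_ofReal, map_intCast]
    ring)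
  rw [← Complex.ofReal_neg, Complex.ofReal_inj, ← mul_neg] at h3
  have h4 := mul_left_cancel₀ (by positivity) h3
  have h5 : ∫ x in box d, f x * hd.toLp _ x = ∫ x in box d, f x * partialDeriv j φ x :=
    integral_congr_ae ((ae_eq_refl f).mul hd.coeFn_toLp)
  have h6 : ∫ x in box d, g x * h0.toLp _ x = ∫ x in box d, g x * φ x :=
    integral_congr_ae ((ae_eq_refl g).mul h0.coeFn_toLp)
  rw [← h5, ← h6, h4]

/-- Riesz-Fischer applied to the family multiplied by iπk_j, which is again Hermitian. -/
lemma exists_isWeakDeriv {j : Fin d} {f : L2 d}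
    (hf : Summable fun k => (k j : ℝ) ^ 2 * ‖boxFourierCoeff f k‖ ^ 2) :
    ∃ g, IsWeakDeriv j f g := by
  have h1 : Summable fun k => ‖Complex.I * (Real.pi * k j) * boxFourierCoeff f k‖ ^ 2 := by
    refine (hf.mul_left (Real.pi ^ 2)).congr fun k => ?_
    simp only [norm_mul, Complex.norm_I, Complex.norm_real, Complex.norm_intCast, mul_pow,
      Real.norm_eq_abs, sq_abs]
    ring_nf
  obtain ⟨g, hg⟩ := exists_boxFourierCoeff_eq h1 fun k => by simp [boxFourierCoeff_neg]
  exact ⟨g, isWeakDeriv_iff.2 hg⟩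

lemma boxFourierCoeff_weakDeriv {j : Fin d} {f : L2 d} (h : ∃ g, IsWeakDeriv j f g)
    (k : Fin d → ℤ) :
    boxFourierCoeff (weakDeriv j f) k = Complex.I * (Real.pi * k j) * boxFourierCoeff f k := by
  rw [weakDeriv, dif_pos h]
  exact h.choose_spec.boxFourierCoeff k

/-- The symbol `1 + π² |k|²` of `1 - Δ`. -/
def bessel (k : Fin d → ℤ) : ℝ := 1 + Real.pi ^ 2 * ∑ i, (k i : ℝ) ^ 2

lemma one_le_bessel (k : Fin d → ℤ) : 1 ≤ bessel k := by
  unfold bessel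
  have : 0 ≤ Real.pi ^ 2 * ∑ i, (k i : ℝ) ^ 2 := by positivity
  linarith

lemma bessel_pos (k : Fin d → ℤ) : 0 < bessel k := one_pos.trans_le (one_le_bessel k)

lemma sq_le_bessel (k : Fin d → ℤ) (j : Fin d) : (Real.pi * k j) ^ 2 ≤ bessel k := by
  have : (k j : ℝ) ^ 2 ≤ ∑ i, (k i : ℝ) ^ 2 :=
    Finset.single_le_sum (f := fun i => (k i : ℝ) ^ 2) (fun i _ => sq_nonneg _) (Finset.mem_univ j)
  unfold bessel
  nlinarith [sq_nonneg Real.pi]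

lemma sobolevNorm_sq (s : ℝ) (f : L2 d) : sobolevNorm s f ^ 2 =
    ∑' k, ENNReal.ofReal (2 ^ d * bessel k ^ s * ‖boxFourierCoeff f k‖ ^ 2) := by
  rw [sobolevNorm, ← ENNReal.rpow_natCast, ← ENNReal.rpow_mul]
  norm_num
  rfl

lemma memH_iff {s : ℝ} {f : L2 d} :
    MemH s f ↔ Summable fun k => bessel k ^ s * ‖boxFourierCoeff f k‖ ^ 2 := by
  have h0 : ∀ k, 0 ≤ 2 ^ d * bessel k ^ s * ‖boxFourierCoeff f k‖ ^ 2 := fun k => by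
    have := Real.rpow_nonneg (bessel_pos k).le s
    positivity
  have h1 : MemH s f ↔ sobolevNorm s f ^ 2 < ⊤ := by
    rw [MemH, ENNReal.pow_lt_top_iff]
    simp
  rw [h1, sobolevNorm_sq, lt_top_iff_ne_top]
  constructor
  · intro h
    have h2 : Summable fun k => (2 : ℝ) ^ d * (bessel k ^ s * ‖boxFourierCoeff f k‖ ^ 2) :=
      (ENNReal.summable_toReal h).congr fun k => by
        rw [ENNReal.toReal_ofReal (h0 k), mul_assoc]
    exact (summable_mul_left_iff (by positivity : (2 : ℝ) ^ d ≠ 0)).1 h2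
  · intro h
    have h2 : Summable fun k => (2 : ℝ) ^ d * bessel k ^ s * ‖boxFourierCoeff f k‖ ^ 2 :=
      (h.mul_left ((2 : ℝ) ^ d)).congr fun k => (mul_assoc _ _ _).symm
    rw [← ENNReal.ofReal_tsum_of_nonneg h0 h2]
    exact ENNReal.ofReal_ne_top

lemma MemH.mono {s t : ℝ} (hst : s ≤ t) {f : L2 d} (h : MemH t f) : MemH s f := by
  rw [memH_iff] at h ⊢
  refine h.of_nonneg_of_le (fun k => ?_) fun k => ?_
  · have := Real.rpow_nonneg (bessel_pos k).le s
    positivity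
  · exact mul_le_mul_of_nonneg_right (Real.rpow_le_rpow_of_exponent_le (one_le_bessel k) hst)
      (sq_nonneg _)

lemma MemH.exists_isWeakDeriv {f : L2 d} (h : MemH 1 f) (j : Fin d) : ∃ g, IsWeakDeriv j f g := by
  rw [memH_iff] at h
  refine ScaledStokes.exists_isWeakDeriv (h.of_nonneg_of_le (fun k => by positivity) fun k => ?_)
  refine mul_le_mul_of_nonneg_right ?_ (sq_nonneg _)
  rw [Real.rpow_one]
  refine le_trans ?_ (sq_le_bessel k j)
  rw [mul_pow]
  exact le_mul_of_one_le_left (sq_nonneg _) (one_le_pow₀ (by linarith [Real.pi_gt_three]))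

lemma MemH.boxFourierCoeff_weakDeriv {f : L2 d} (h : MemH 1 f) (j : Fin d) (k : Fin d → ℤ) :
    boxFourierCoeff (weakDeriv j f) k = Complex.I * (Real.pi * k j) * boxFourierCoeff f k :=
  ScaledStokes.boxFourierCoeff_weakDeriv (h.exists_isWeakDeriv j) k

lemma MemH.weakDeriv {f : L2 d} (h : MemH 2 f) (j : Fin d) : MemH 1 (weakDeriv j f) := by
  have h1 : MemH 1 f := h.mono one_le_two
  rw [memH_iff] at h ⊢
  refine h.of_nonneg_of_le (fun k => ?_) fun k => ?_
  · have := Real.rpow_nonneg (bessel_pos k).le 1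
    positivity
  · rw [h1.boxFourierCoeff_weakDeriv, Real.rpow_one, norm_mul, mul_pow, Real.rpow_two, sq (bessel k),
      mul_assoc, ← mul_assoc (bessel k) (bessel k)]
    rw [← mul_assoc]
    refine mul_le_mul_of_nonneg_right (mul_le_mul_of_nonneg_left ?_ (bessel_pos k).le) (sq_nonneg _)
    rw [norm_mul, Complex.norm_I, one_mul, ← Complex.ofReal_intCast, ← Complex.ofReal_mul,
      Complex.norm_real, Real.norm_eq_abs, sq_abs]
    exact sq_le_bessel k j

lemma MemH.boxFourierCoeff_laplacian {f : L2 d} (h : MemH 2 f) (a : Fin d → ℝ) (k : Fin d → ℤ) :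
    boxFourierCoeff (laplacian a f) k =
      -((Real.pi ^ 2 * ∑ j, a j * (k j : ℝ) ^ 2 : ℝ) : ℂ) * boxFourierCoeff f k := by
  rw [laplacian, boxFourierCoeff_sum]
  push_cast
  rw [Finset.mul_sum, ← Finset.sum_neg_distrib, Finset.sum_mul]
  refine Finset.sum_congr rfl fun j _ => ?_
  rw [boxFourierCoeff_smul, (h.weakDeriv j).boxFourierCoeff_weakDeriv,
    (h.mono one_le_two).boxFourierCoeff_weakDeriv]
  linear_combination (a j : ℂ) * Real.pi ^ 2 * (k j) ^ 2 * boxFourierCoeff f k * Complex.I_sq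

lemma boxFourierCoeff_divergence {u : Fin d → L2 d} (h : ∀ i, MemH 1 (u i)) (k : Fin d → ℤ) :
    boxFourierCoeff (divergence u) k =
      Complex.I * Real.pi * ∑ i, (k i : ℂ) * boxFourierCoeff (u i) k := by
  rw [divergence, boxFourierCoeff_sum, Finset.mul_sum]
  refine Finset.sum_congr rfl fun i _ => ?_
  rw [(h i).boxFourierCoeff_weakDeriv]
  ring

lemma divergence_eq_zero_iff {u : Fin d → L2 d} (h : ∀ i, MemH 1 (u i)) :
    divergence u = 0 ↔ ∀ k : Fin d → ℤ, ∑ i, (k i : ℂ) * boxFourierCoeff (u i) k = 0 := by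
  constructor
  · intro h0 k
    have h1 := boxFourierCoeff_divergence h k
    rw [h0, boxFourierCoeff_zero, eq_comm, mul_eq_zero] at h1
    exact h1.resolve_left (by simp [Real.pi_ne_zero])
  · intro h0
    refine eq_of_boxFourierCoeff_eq fun k => ?_
    rw [boxFourierCoeff_divergence h, h0, mul_zero, boxFourierCoeff_zero]

lemma continuous_boxFourierCoeff (k : Fin d → ℤ) : Continuous fun f : L2 d => boxFourierCoeff f k :=
  (coeffCLM k).continuous

/-- The Fourier form of the divergence constraint, for a smooth field. -/
lemma sum_mul_boxFourierCoeff_eq_zero {φ : Fin d → (Fin d → ℝ) → ℝ}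
    (hφ : ∀ i, SmoothPeriodic (φ i)) (hdiv : ∀ x, ∑ i, partialDeriv i (φ i) x = 0)
    {u : Fin d → L2 d} (hu : ∀ i, u i =ᵐ[volume.restrict (box d)] φ i) (k : Fin d → ℤ) :
    ∑ i, (k i : ℂ) * boxFourierCoeff (u i) k = 0 := by
  have hd := fun i => memLp_box_of_continuous ((hφ i).continuous_partialDeriv i) 2
  have h1 : ∑ i, (hd i).toLp _ = 0 := by
    refine Lp.ext ?_
    filter_upwards [Lp.coeFn_finsetSum Finset.univ fun i => (hd i).toLp _,
      ae_all_iff.2 fun i => (hd i).coeFn_toLp, Lp.coeFn_zero ℝ 2 (volume.restrict (box d))]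
      with x hx hx' hx0
    rw [hx, hx0, Finset.sum_apply, Finset.sum_congr rfl fun i _ => hx' i, hdiv]
    rfl
  have h2 : boxFourierCoeff (∑ i, (hd i).toLp _) k =
      Complex.I * Real.pi * ∑ i, (k i : ℂ) * boxFourierCoeff (u i) k := by
    rw [boxFourierCoeff_sum, Finset.mul_sum]
    refine Finset.sum_congr rfl fun i _ => ?_
    rw [((hφ i).isWeakDeriv i (hu i) (hd i).coeFn_toLp).boxFourierCoeff]
    ring
  rw [h1, boxFourierCoeff_zero, eq_comm, mul_eq_zero] at h2
  exact h2.resolve_left (by simp [Real.pi_ne_zero])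

/-- For fixed `k` the constraint is closed in L², since coefficients are continuous, so it passes
from smooth fields to the closure. -/
lemma sum_mul_boxFourierCoeff_of_mem_L2sigmaG {u : Fin 2 → L2 2} (hu : u ∈ L2sigmaG)
    (k : Fin 2 → ℤ) : ∑ i, (k i : ℂ) * boxFourierCoeff (u i) k = 0 := by
  have hcl : IsClosed {u : Fin 2 → L2 2 | ∑ i, (k i : ℂ) * boxFourierCoeff (u i) k = 0} :=
    isClosed_eq (continuous_finsetSum _ fun i _ => continuous_const.mul
      ((continuous_boxFourierCoeff k).comp (continuous_apply i))) continuous_const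
  refine closure_minimal ?_ hcl hu
  rintro v ⟨φ, h1, h2, h3⟩
  exact sum_mul_boxFourierCoeff_eq_zero h1 h2 h3 k

end WeakDerivatives

/-! ### Parity in z on the Fourier side. -/

section Parity

/-- The reflection `(k₁, k₂, k₃) ↦ (k₁, k₂, -k₃)` of frequencies. -/
def reflectFreq (k : Fin 3 → ℤ) : Fin 3 → ℤ := ![k 0, k 1, -k 2]

lemma measurePreserving_reflectZ :
    MeasurePreserving reflectZ (volume.restrict (box 3)) (volume.restrict (box 3)) := by
  have hb : volume.restrict (box 3) =
      Measure.pi fun _ : Fin 3 => (volume : Measure ℝ).restrict (Ioo (-1) 1) := by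
    rw [box, volume_pi, Measure.restrict_pi_pi]
  have hneg : MeasurePreserving (fun x : ℝ => -x) (volume.restrict (Ioo (-1) 1))
      (volume.restrict (Ioo (-1) 1)) := by
    have := (Measure.measurePreserving_neg (volume : Measure ℝ)).restrict_preimage
      (measurableSet_Ioo (a := (-1 : ℝ)) (b := 1))
    simpa using this
  rw [hb]
  have h := measurePreserving_pi (fun _ : Fin 3 => (volume : Measure ℝ).restrict (Ioo (-1) 1))
    (fun _ : Fin 3 => (volume : Measure ℝ).restrict (Ioo (-1) 1))
    (f := fun i => if i = 2 then fun x => -x else id) (fun i => by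
      split_ifs
      · exact hneg
      · exact MeasurePreserving.id _)
  convert! h using 1
  funext x i
  fin_cases i <;> simp [reflectZ]

/-- The composition with the reflection in `z`. -/
def reflectL2 (f : L2 3) : L2 3 := Lp.compMeasurePreserving reflectZ measurePreserving_reflectZ f

lemma coeFn_reflectL2 (f : L2 3) :
    reflectL2 f =ᵐ[volume.restrict (box 3)] fun x => f (reflectZ x) :=
  Lp.coeFn_compMeasurePreserving f measurePreserving_reflectZ

lemma reflectZ_reflectZ (x : Fin 3 → ℝ) : reflectZ (reflectZ x) = x := by
  funext i
  fin_cases i <;> simp [reflectZ]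

lemma boxFourierCoeff_reflectL2 (f : L2 3) (k : Fin 3 → ℤ) :
    boxFourierCoeff (reflectL2 f) k = boxFourierCoeff f (reflectFreq k) := by
  have hR : MeasurableEmbedding reflectZ :=
    (⟨⟨reflectZ, reflectZ, reflectZ_reflectZ, reflectZ_reflectZ⟩,
      measurePreserving_reflectZ.measurable, measurePreserving_reflectZ.measurable⟩ :
      (Fin 3 → ℝ) ≃ᵐ (Fin 3 → ℝ)).measurableEmbedding
  have hexp : ∀ x, expk (-k) x = expk (-reflectFreq k) (reflectZ x) := by
    intro x
    simp [expk, Fin.sum_univ_three, reflectFreq, reflectZ]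
  rw [boxFourierCoeff_eq, boxFourierCoeff_eq, ← measurePreserving_reflectZ.integral_comp hR
    (fun x => (f x : ℂ) * expk (-reflectFreq k) x)]
  congr 1
  refine integral_congr_ae ?_
  filter_upwards [coeFn_reflectL2 f] with x hx
  rw [hx, hexp]

/-- Reflecting the function reflects the frequency, and coefficients determine the function. -/
lemma evenZ_iff {f : L2 3} :
    EvenZ f ↔ ∀ k, boxFourierCoeff f (reflectFreq k) = boxFourierCoeff f k := by
  constructor
  · intro h k
    have : reflectL2 f = f := Lp.ext ((coeFn_reflectL2 f).trans h)
    rw [← boxFourierCoeff_reflectL2, this]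
  · intro h
    have : reflectL2 f = f := eq_of_boxFourierCoeff_eq fun k => by
      rw [boxFourierCoeff_reflectL2, h]
    have h2 := coeFn_reflectL2 f
    rw [this] at h2
    exact h2.symm

lemma oddZ_iff {f : L2 3} :
    OddZ f ↔ ∀ k, boxFourierCoeff f (reflectFreq k) = -boxFourierCoeff f k := by
  constructor
  · intro h k
    have : reflectL2 f = -f := by
      refine Lp.ext ?_
      filter_upwards [coeFn_reflectL2 f, Lp.coeFn_neg f, h] with x h1 h2 h3
      rw [h1, h2, h3, Pi.neg_apply]
    rw [← boxFourierCoeff_reflectL2, this]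
    exact map_neg (coeffCLM k) f
  · intro h
    have : reflectL2 f = -f := eq_of_boxFourierCoeff_eq fun k => by
      rw [boxFourierCoeff_reflectL2, h]
      exact (map_neg (coeffCLM k) f).symm
    have h2 := coeFn_reflectL2 f
    rw [this] at h2
    filter_upwards [h2, Lp.coeFn_neg f] with x h3 h4
    rw [← h3, h4, Pi.neg_apply]

lemma isClosed_boxFourierCoeff_eq {ι : Type*} (i : ι) (k l : Fin 3 → ℤ) (c : ℂ) :
    IsClosed {u : ι → L2 3 | boxFourierCoeff (u i) k = c * boxFourierCoeff (u i) l} :=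
  isClosed_eq ((continuous_boxFourierCoeff k).comp (continuous_apply i))
    (continuous_const.mul ((continuous_boxFourierCoeff l).comp (continuous_apply i)))

lemma evenZ_of_ae_eq {f : L2 3} {φ : (Fin 3 → ℝ) → ℝ} (hf : f =ᵐ[volume.restrict (box 3)] φ)
    (hφ : ∀ x, φ (reflectZ x) = φ x) : EvenZ f := by
  filter_upwards [hf, measurePreserving_reflectZ.quasiMeasurePreserving.ae_eq hf] with x h1 h2
  simp only [Function.comp_apply] at h2
  rw [h1, h2, hφ]

lemma oddZ_of_ae_eq {f : L2 3} {φ : (Fin 3 → ℝ) → ℝ} (hf : f =ᵐ[volume.restrict (box 3)] φ)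
    (hφ : ∀ x, φ (reflectZ x) = -φ x) : OddZ f := by
  filter_upwards [hf, measurePreserving_reflectZ.quasiMeasurePreserving.ae_eq hf] with x h1 h2
  simp only [Function.comp_apply] at h2
  rw [h1, h2, hφ]

/-- All four conditions are closed linear relations between finitely many coefficients, so it
suffices to check them on the smooth fields that define the closure. -/
lemma fourier_of_mem_L2sigmaOmega {u : Fin 3 → L2 3} (hu : u ∈ L2sigmaOmega) (k : Fin 3 → ℤ) :
    (∑ i, (k i : ℂ) * boxFourierCoeff (u i) k = 0) ∧
    boxFourierCoeff (u 0) (reflectFreq k) = boxFourierCoeff (u 0) k ∧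
    boxFourierCoeff (u 1) (reflectFreq k) = boxFourierCoeff (u 1) k ∧
    boxFourierCoeff (u 2) (reflectFreq k) = -boxFourierCoeff (u 2) k := by
  have h1 : IsClosed {u : Fin 3 → L2 3 | ∑ i, (k i : ℂ) * boxFourierCoeff (u i) k = 0} :=
    isClosed_eq (continuous_finsetSum _ fun i _ => continuous_const.mul
      ((continuous_boxFourierCoeff k).comp (continuous_apply i))) continuous_const
  have h2 := ((h1.inter (isClosed_boxFourierCoeff_eq (0 : Fin 3) (reflectFreq k) k 1)).inter
    (isClosed_boxFourierCoeff_eq (1 : Fin 3) (reflectFreq k) k 1)).inter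
    (isClosed_boxFourierCoeff_eq (2 : Fin 3) (reflectFreq k) k (-1))
  have h3 := closure_minimal ?_ h2 hu
  · obtain ⟨⟨⟨ha, hb⟩, hc⟩, hd⟩ := h3
    simp only [mem_ofPred_eq, one_mul, neg_mul] at ha hb hc hd
    exact ⟨ha, hb, hc, hd⟩
  · rintro v ⟨φ, hs, hdiv, e0, e1, e2, hv⟩
    refine ⟨⟨⟨sum_mul_boxFourierCoeff_eq_zero hs hdiv hv k, ?_⟩, ?_⟩, ?_⟩
    · simpa using evenZ_iff.1 (evenZ_of_ae_eq (hv 0) e0) k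
    · simpa using evenZ_iff.1 (evenZ_of_ae_eq (hv 1) e1) k
    · simpa using oddZ_iff.1 (oddZ_of_ae_eq (hv 2) e2) k

end Parity

/-! ### The vertical mean and the modes with k₂ = 0. -/

section VerticalMean

/-- The map `((x, y), z) ↦ (x, y, z)`. -/
def joinZ (p : (Fin 2 → ℝ) × ℝ) : Fin 3 → ℝ := ![p.1 0, p.1 1, p.2]

lemma joinZ_eq (p : (Fin 2 → ℝ) × ℝ) :
    joinZ p = (MeasurableEquiv.piFinSuccAbove (fun _ => ℝ) (Fin.last 2)).symm p.swap := by
  have : joinZ p = Fin.insertNth (α := fun _ => ℝ) (Fin.last 2) p.2 p.1 := by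
    funext i
    rw [Fin.insertNth_last']
    fin_cases i <;> rfl
  rw [this]
  rfl

lemma measurableEmbedding_joinZ : MeasurableEmbedding joinZ := by
  have : joinZ = (MeasurableEquiv.prodComm.trans
    (MeasurableEquiv.piFinSuccAbove (fun _ : Fin 3 => ℝ) (Fin.last 2)).symm) :=
    funext joinZ_eq
  rw [this]
  exact MeasurableEquiv.measurableEmbedding _

lemma measurePreserving_joinZ : MeasurePreserving joinZ
    ((volume.restrict (box 2)).prod (volume.restrict (Ioo (-1) 1))) (volume.restrict (box 3)) := by
  have h : MeasurePreserving joinZ (volume.prod volume) volume := by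
    have h1 := (volume_preserving_piFinSuccAbove (fun _ : Fin 3 => ℝ) (Fin.last 2)).symm
    have h2 := h1.comp (Measure.measurePreserving_swap (μ := (volume : Measure (Fin 2 → ℝ)))
      (ν := (volume : Measure ℝ)))
    convert! h2 using 1
    exact funext joinZ_eq
  have hpre : joinZ ⁻¹' box 3 = box 2 ×ˢ Ioo (-1) 1 := by
    ext p
    simp [box, joinZ, Set.mem_pi, Fin.forall_fin_succ, Set.mem_prod, and_assoc]
  rw [Measure.prod_restrict, ← hpre]
  exact h.restrict_preimage measurableSet_box

/-- The vertical integral of a function. -/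
def vertInt (f : L2 3) (y : Fin 2 → ℝ) : ℝ := ∫ ξ in Ioo (-1 : ℝ) 1, f (joinZ (y, ξ))

lemma verticalMeanZero_iff_vertInt {f : L2 3} :
    VerticalMeanZero f ↔ vertInt f =ᵐ[volume.restrict (box 2)] 0 := by
  unfold VerticalMeanZero
  refine Filter.eventually_congr (Filter.Eventually.of_forall fun y => ?_)
  rw [intervalIntegral.integral_of_le (by norm_num), integral_Ioc_eq_integral_Ioo]
  rfl

lemma integrable_joinZ (f : L2 3) : Integrable (fun p => f (joinZ p))
    ((volume.restrict (box 2)).prod (volume.restrict (Ioo (-1) 1))) :=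
  measurePreserving_joinZ.integrable_comp_of_integrable (integrable_L2 f)

/-- When k₂ = 0 the exponential does not depend on z, so Fubini integrates z out first. -/
lemma boxFourierCoeff_horizontal (f : L2 3) (k : Fin 3 → ℤ) (hk : k 2 = 0) :
    boxFourierCoeff f k =
      (1 / 2 ^ 3 : ℂ) * ∫ y in box 2, (vertInt f y : ℂ) * expk (-![k 0, k 1]) y := by
  have hexp : ∀ p, expk (-k) (joinZ p) = expk (-![k 0, k 1]) p.1 := by
    intro p
    simp [expk, Fin.sum_univ_three, joinZ, hk]
  have hi : Integrable (fun p => (f (joinZ p) : ℂ) * expk (-![k 0, k 1]) p.1)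
      ((volume.restrict (box 2)).prod (volume.restrict (Ioo (-1) 1))) :=
    (integrable_joinZ f).ofReal.mul_bdd (c := 1)
      ((continuous_expk _).comp continuous_fst).aestronglyMeasurable
      (Filter.Eventually.of_forall fun p => (norm_expk _ _).le)
  rw [boxFourierCoeff_eq, ← measurePreserving_joinZ.integral_comp measurableEmbedding_joinZ]
  simp only [hexp]
  rw [integral_prod _ hi]
  congr 1
  refine integral_congr_ae (Filter.Eventually.of_forall fun y => ?_)
  simp only [integral_mul_const, vertInt, integral_complex_ofReal]

lemma memLp_vertInt (f : L2 3) : MemLp (vertInt f) 2 (volume.restrict (box 2)) := by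
  have hm : AEStronglyMeasurable (vertInt f) (volume.restrict (box 2)) :=
    (integrable_joinZ f).integral_prod_left.aestronglyMeasurable
  have hsq : Integrable (fun p => f (joinZ p) ^ 2)
      ((volume.restrict (box 2)).prod (volume.restrict (Ioo (-1) 1))) :=
    measurePreserving_joinZ.integrable_comp_of_integrable (g := fun x => f x ^ 2)
      (Lp.memLp f).integrable_sq
  rw [memLp_two_iff_integrable_sq hm]
  refine (hsq.integral_prod_left.const_mul 2).mono' (hm.pow 2) ?_
  filter_upwards [hsq.prod_right_ae, (integrable_joinZ f).prod_right_ae] with y h1 h2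
  -- Cauchy-Schwarz on a vertical fibre of length 2: the integral of (f - mean)² is nonnegative, so
  -- the squared vertical integral is at most twice the integral of f².
  have h3 : 0 ≤ ∫ ξ in Ioo (-1 : ℝ) 1, (f (joinZ (y, ξ)) ^ 2 - vertInt f y * f (joinZ (y, ξ)) +
      vertInt f y ^ 2 / 4) := integral_nonneg fun ξ => by
    have : 0 ≤ (f (joinZ (y, ξ)) - vertInt f y / 2) ^ 2 := sq_nonneg _
    simp only [Pi.zero_apply]
    nlinarith
  rw [integral_add (f := fun ξ => f (joinZ (y, ξ)) ^ 2 - vertInt f y * f (joinZ (y, ξ)))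
    (h1.sub (h2.const_mul _)) (integrable_const _), integral_sub h1 (h2.const_mul _),
    integral_const_mul] at h3
  simp only [integral_const, measureReal_restrict_apply_univ, Real.volume_real_Ioo] at h3
  norm_num at h3
  rw [Real.norm_of_nonneg (sq_nonneg _)]
  have h4 : ∫ ξ in Ioo (-1 : ℝ) 1, f (joinZ (y, ξ)) = vertInt f y := rfl
  rw [h4] at h3
  nlinarith

/-- The coefficients with k₂ = 0 are, up to a factor, the planar Fourier coefficients of the
vertical integral, which determine it because it lies in L². -/
lemma verticalMeanZero_iff {f : L2 3} :
    VerticalMeanZero f ↔ ∀ k : Fin 3 → ℤ, k 2 = 0 → boxFourierCoeff f k = 0 := by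
  rw [verticalMeanZero_iff_vertInt]
  constructor
  · intro h k hk
    rw [boxFourierCoeff_horizontal f k hk, mul_eq_zero]
    right
    rw [integral_eq_zero_of_ae]
    filter_upwards [h] with y hy
    simp [hy]
  · intro h
    have h0 : (memLp_vertInt f).toLp _ = 0 := eq_of_boxFourierCoeff_eq fun l => by
      have h1 := boxFourierCoeff_horizontal f ![l 0, l 1, 0] rfl
      rw [h _ rfl, eq_comm, mul_eq_zero, or_iff_right (by norm_num)] at h1
      rw [boxFourierCoeff_zero, boxFourierCoeff_eq, mul_eq_zero]
      right
      rw [← h1]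
      refine integral_congr_ae ?_
      filter_upwards [(memLp_vertInt f).coeFn_toLp] with y hy
      have : ![l 0, l 1] = l := by
        funext i
        fin_cases i <;> rfl
      rw [hy]
      simp [this]
    have h2 := (memLp_vertInt f).coeFn_toLp
    rw [h0] at h2
    exact h2.symm.trans (Lp.coeFn_zero ℝ 2 _)

end VerticalMean

/-! ### Curves in L² and their coefficients as functions of time. -/

section TimeDependence

variable {d : ℕ} {T : ℝ}

lemma enorm_sq_eq_tsum (f : L2 d) : ‖f‖ₑ ^ 2 = 2 ^ d * ∑' k, ‖boxFourierCoeff f k‖ₑ ^ 2 := by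
  have h : ∀ k, ‖boxFourierCoeff f k‖ₑ ^ 2 = ENNReal.ofReal (‖boxFourierCoeff f k‖ ^ 2) := fun k => by
    rw [ENNReal.ofReal_pow (norm_nonneg _), ofReal_norm]
  simp only [h]
  rw [← ENNReal.ofReal_tsum_of_nonneg (fun k => sq_nonneg _) (summable_norm_sq_boxFourierCoeff f),
    ← ofReal_norm, ← ENNReal.ofReal_pow (norm_nonneg _), norm_sq_eq_tsum,
    ENNReal.ofReal_mul (by positivity)]
  congr 1
  rw [ENNReal.ofReal_pow (by norm_num), ENNReal.ofReal_ofNat]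

lemma memLp_two_of_boxFourierCoeff {α : Type*} [MeasurableSpace α] {μ : Measure α}
    {f : α → L2 d} (hm : ∀ k, AEStronglyMeasurable (fun t => boxFourierCoeff (f t) k) μ)
    (hf : ∫⁻ t, ∑' k, ‖boxFourierCoeff (f t) k‖ₑ ^ 2 ∂μ < ⊤) : MemLp f 2 μ := by
  refine ⟨aestronglyMeasurable_of_boxFourierCoeff hm, ?_⟩
  rw [eLpNorm_lt_top_iff_lintegral_rpow_enorm_lt_top two_ne_zero ENNReal.ofNat_ne_top]
  simp only [ENNReal.toReal_ofNat, ENNReal.rpow_ofNat, enorm_sq_eq_tsum]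
  rw [lintegral_const_mul' _ _ (by simp)]
  exact ENNReal.mul_lt_top (by simp) hf

open Classical in
/-- The function in `L²` with prescribed Fourier coefficients (`0` if there is none). -/
def synth (a : (Fin d → ℤ) → ℂ) : L2 d :=
  if h : ∃ f : L2 d, ∀ k, boxFourierCoeff f k = a k then h.choose else 0

lemma boxFourierCoeff_synth {a : (Fin d → ℤ) → ℂ} (ha : Summable fun k => ‖a k‖ ^ 2)
    (hs : ∀ k, a (-k) = (starRingEnd ℂ) (a k)) (k : Fin d → ℤ) :
    boxFourierCoeff (synth a) k = a k := by
  have h := exists_boxFourierCoeff_eq ha hs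
  rw [synth, dif_pos h]
  exact h.choose_spec k

lemma intervalIntegrable_of_memLp {E : Type*} [NormedAddCommGroup E] {f : ℝ → E}
    (hf : MemLp f 2 (volume.restrict (Ioo 0 T))) {t : ℝ} (ht : t ∈ Icc 0 T) :
    IntervalIntegrable f volume 0 t := by
  rw [intervalIntegrable_iff_integrableOn_Ioo_of_le ht.1]
  have h : IntegrableOn f (Ioo 0 T) := hf.integrable one_le_two
  exact h.mono_set (Ioo_subset_Ioo_right ht.2)

lemma ae_uIoc_of_ae_Ioo {p : ℝ → Prop} (h : ∀ᵐ s ∂(volume.restrict (Ioo 0 T)), p s) {t : ℝ}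
    (ht : t ∈ Icc 0 T) : ∀ᵐ s, s ∈ uIoc 0 t → p s := by
  rw [Measure.restrict_congr_set Ioo_ae_eq_Ioc, ae_restrict_iff' measurableSet_Ioc] at h
  filter_upwards [h] with s hs hs'
  rw [uIoc_of_le ht.1] at hs'
  exact hs ⟨hs'.1, hs'.2.trans ht.2⟩

lemma eqOn_Icc_of_ae_Ioo {E : Type*} [TopologicalSpace E] [T2Space E] {f g : ℝ → E} (hT : 0 < T)
    (h : ∀ᵐ s ∂(volume.restrict (Ioo 0 T)), f s = g s) (hf : ContinuousOn f (Icc 0 T))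
    (hg : ContinuousOn g (Icc 0 T)) : EqOn f g (Icc 0 T) := by
  rw [Measure.restrict_congr_set Ioo_ae_eq_Icc] at h
  exact Measure.eqOn_Icc_of_ae_eq volume hT.ne h hf hg

lemma boxFourierCoeff_intervalIntegral {f : ℝ → L2 d} {a b : ℝ}
    (hf : IntervalIntegrable f volume a b) (k : Fin d → ℤ) :
    boxFourierCoeff (∫ s in a..b, f s) k = ∫ s in a..b, boxFourierCoeff (f s) k :=
  ((coeffCLM k).intervalIntegral_comp_comm hf).symm

lemma intervalIntegrable_boxFourierCoeff {f : ℝ → L2 d} {a b : ℝ}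
    (hf : IntervalIntegrable f volume a b) (k : Fin d → ℤ) :
    IntervalIntegrable (fun s => boxFourierCoeff (f s) k) volume a b :=
  ⟨(coeffCLM k).integrable_comp hf.1, (coeffCLM k).integrable_comp hf.2⟩

/-- A coefficient is a continuous linear functional, so it commutes with the Bochner integral; the
identity in L² then follows from scalar ones. -/
lemma isTimeDeriv_of_boxFourierCoeff {u u' : ℝ → L2 d}
    (hu' : MemLp u' 2 (volume.restrict (Ioo 0 T)))
    (h : ∀ k, ∀ t ∈ Icc 0 T, boxFourierCoeff (u t) k =
      boxFourierCoeff (u 0) k + ∫ s in (0 : ℝ)..t, boxFourierCoeff (u' s) k) :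
    IsTimeDeriv T u u' := by
  refine ⟨hu', fun t ht => eq_of_boxFourierCoeff_eq fun k => ?_⟩
  rw [boxFourierCoeff_add, boxFourierCoeff_intervalIntegral (intervalIntegrable_of_memLp hu' ht),
    h k t ht]

lemma IsTimeDeriv.intervalIntegrable {u u' : ℝ → L2 d} (h : IsTimeDeriv T u u') {t : ℝ}
    (ht : t ∈ Icc 0 T) (k : Fin d → ℤ) :
    IntervalIntegrable (fun s => boxFourierCoeff (u' s) k) volume 0 t :=
  intervalIntegrable_boxFourierCoeff (intervalIntegrable_of_memLp h.memLp ht) k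

lemma IsTimeDeriv.boxFourierCoeff_eq {u u' : ℝ → L2 d} (h : IsTimeDeriv T u u') {t : ℝ}
    (ht : t ∈ Icc 0 T) (k : Fin d → ℤ) : boxFourierCoeff (u t) k =
      boxFourierCoeff (u 0) k + ∫ s in (0 : ℝ)..t, boxFourierCoeff (u' s) k := by
  rw [h.eq_integral t ht, boxFourierCoeff_add,
    boxFourierCoeff_intervalIntegral (intervalIntegrable_of_memLp h.memLp ht)]

lemma continuousOn_of_eq_add_intervalIntegral {E : Type*} [NormedAddCommGroup E] [NormedSpace ℝ E]
    [CompleteSpace E]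
    (hT : 0 ≤ T) {y y' : ℝ → E} {c : E} (hy' : IntervalIntegrable y' volume 0 T)
    (h : ∀ t ∈ Icc 0 T, y t = c + ∫ s in (0 : ℝ)..t, y' s) : ContinuousOn y (Icc 0 T) := by
  have h1 := intervalIntegral.continuousOn_primitive_interval'
    (μ := volume) hy' left_mem_uIcc
  rw [uIcc_of_le hT] at h1
  exact (continuousOn_const.add h1).congr h

lemma IsTimeDeriv.continuousOn (hT : 0 ≤ T) {u u' : ℝ → L2 d} (h : IsTimeDeriv T u u')
    (k : Fin d → ℤ) : ContinuousOn (fun t => boxFourierCoeff (u t) k) (Icc 0 T) :=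
  continuousOn_of_eq_add_intervalIntegral hT (h.intervalIntegrable (right_mem_Icc.2 hT) k)
    fun _ ht => h.boxFourierCoeff_eq ht k

lemma MemE1.aestronglyMeasurable (hT : 0 ≤ T) {u : ℝ → L2 d} (h : MemE1 T u) (k : Fin d → ℤ) :
    AEStronglyMeasurable (fun t => boxFourierCoeff (u t) k) (volume.restrict (Ioo 0 T)) := by
  obtain ⟨u', hu'⟩ := h.memH1
  exact ((hu'.continuousOn hT k).mono Ioo_subset_Icc_self).aestronglyMeasurable measurableSet_Ioo

lemma ae_memH {α : Type*} [MeasurableSpace α] {μ : Measure α} {s : ℝ} {u : α → L2 d}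
    (hm : ∀ k, AEStronglyMeasurable (fun t => boxFourierCoeff (u t) k) μ)
    (h : ∫⁻ t, sobolevNorm s (u t) ^ 2 ∂μ < ⊤) : ∀ᵐ t ∂μ, MemH s (u t) := by
  have hmeas : AEMeasurable (fun t => sobolevNorm s (u t) ^ 2) μ := by
    simp only [sobolevNorm_sq]
    exact AEMeasurable.tsum fun k =>
      (((hm k).norm.aemeasurable.pow_const 2).const_mul _).ennreal_ofReal
  filter_upwards [ae_lt_top' hmeas h.ne] with t ht
  rw [ENNReal.pow_lt_top_iff] at ht
  exact ht.resolve_right two_ne_zero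

lemma MemE1.ae_memH (hT : 0 ≤ T) {u : ℝ → L2 d} (h : MemE1 T u) :
    ∀ᵐ t ∂(volume.restrict (Ioo 0 T)), MemH 2 (u t) :=
  ScaledStokes.ae_memH (h.aestronglyMeasurable hT) h.memL2H2

lemma MemPressure.ae_memH {p : ℝ → L2 d} (h : MemPressure T p) :
    ∀ᵐ t ∂(volume.restrict (Ioo 0 T)), MemH 1 (p t) :=
  ScaledStokes.ae_memH (fun k => (continuous_boxFourierCoeff k).comp_aestronglyMeasurable
    h.aestronglyMeasurable) h.memL2H1

end TimeDependence

/-! ### Fourier multiplier semigroups and their maximal regularity. -/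

section HeatSemigroup

variable {d : ℕ} {T : ℝ}

/-- Integrating factor: exp(lt)y(t) has vanishing right derivative, hence is constant. Only the
integrated equation is assumed, so differentiability comes from continuity of `y`. -/
lemma eq_exp_of_eq_integral {y : ℝ → ℂ} {l : ℝ} (hc : ContinuousOn y (Icc 0 T))
    (h : ∀ t ∈ Icc 0 T, y t = y 0 - l * ∫ s in (0 : ℝ)..t, y s) {t : ℝ} (ht : t ∈ Icc 0 T) :
    y t = Real.exp (-(l * t)) * y 0 := by
  have hd : ∀ s ∈ Ico 0 T, HasDerivWithinAt y (-(l * y s)) (Ici s) s := by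
    intro s hs
    have h1 : HasDerivWithinAt (fun r => ∫ s in (0 : ℝ)..r, y s) (y s) (Icc s T) s := by
      have hi : IntervalIntegrable y volume 0 s :=
        ((hc.mono (Icc_subset_Icc_right hs.2.le)).intervalIntegrable_of_Icc hs.1)
      have : Fact (s ∈ Icc s T) := ⟨left_mem_Icc.2 hs.2.le⟩
      refine intervalIntegral.integral_hasDerivWithinAt_right hi ?_ ?_ (t := Icc s T)
      · exact (hc.mono (Icc_subset_Icc_left hs.1)).stronglyMeasurableAtFilter_nhdsWithin
          measurableSet_Icc s
      · exact (hc s ⟨hs.1, hs.2.le⟩).mono (Icc_subset_Icc_left hs.1)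
    have h2 : HasDerivWithinAt y (-(l * y s)) (Icc s T) s := by
      have h3 := (h1.const_mul (l : ℂ)).const_sub (y 0)
      exact h3.congr (fun r hr => h r ⟨hs.1.trans hr.1, hr.2⟩) (h s ⟨hs.1, hs.2.le⟩)
    exact h2.mono_of_mem_nhdsWithin (Icc_mem_nhdsGE hs.2)
  have hexp : ∀ s : ℝ, HasDerivAt (fun s : ℝ => Complex.exp (l * s)) (l * Complex.exp (l * s)) s := by
    intro s
    have h1 : HasDerivAt (fun s : ℝ => (l : ℂ) * s) l s := by
      simpa using (Complex.ofRealCLM.hasDerivAt (x := s)).const_mul (l : ℂ)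
    simpa [mul_comm] using h1.cexp
  have hconst := constant_of_has_deriv_right_zero
    (f := fun s => Complex.exp (l * s) * y s)
    ((Continuous.continuousOn (by fun_prop)).mul hc) (fun s hs => by
      have := (hexp s).hasDerivWithinAt.mul (hd s hs)
      refine this.congr_deriv ?_
      ring) t ht
  simp only [Complex.ofReal_zero, mul_zero, Complex.exp_zero, one_mul] at hconst
  rw [← hconst, ← mul_assoc]
  push_cast
  rw [← Complex.exp_add]
  simp

lemma intervalIntegral_exp (l : ℝ) (c : ℂ) (t : ℝ) :
    ∫ s in (0 : ℝ)..t, -(l : ℂ) * (Real.exp (-(l * s)) * c) = Real.exp (-(l * t)) * c - c := by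
  have h : ∀ s ∈ uIcc 0 t, HasDerivAt (fun s : ℝ => ((Real.exp (-(l * s)) : ℝ) : ℂ) * c)
      (-(l : ℂ) * (Real.exp (-(l * s)) * c)) s := by
    intro s _
    have h1 : HasDerivAt (fun s : ℝ => Real.exp (-(l * s))) (Real.exp (-(l * s)) * -(l * 1)) s :=
      (((hasDerivAt_id s).const_mul l).neg).exp
    refine (h1.ofReal_comp.mul_const c).congr_deriv ?_
    push_cast
    ring
  rw [intervalIntegral.integral_eq_sub_of_hasDerivAt h (Continuous.intervalIntegrable (by fun_prop) _ _)]
  simp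

lemma lintegral_mul_exp_le {l : ℝ} (hl : 0 ≤ l) (hT : 0 ≤ T) :
    ∫⁻ t in Ioo 0 T, ENNReal.ofReal (l * Real.exp (-(l * t))) ≤ 1 := by
  have h : ∀ s ∈ uIcc 0 T, HasDerivAt (fun s : ℝ => -Real.exp (-(l * s)))
      (l * Real.exp (-(l * s))) s := by
    intro s _
    have h1 : HasDerivAt (fun s : ℝ => Real.exp (-(l * s))) (Real.exp (-(l * s)) * -(l * 1)) s :=
      (((hasDerivAt_id s).const_mul l).neg).exp
    refine h1.neg.congr_deriv ?_
    ring
  have hc : Continuous fun s : ℝ => l * Real.exp (-(l * s)) := by fun_prop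
  have h2 := intervalIntegral.integral_eq_sub_of_hasDerivAt h (hc.intervalIntegrable _ _)
  rw [intervalIntegral.integral_of_le hT, integral_Ioc_eq_integral_Ioo] at h2
  rw [← ofReal_integral_eq_lintegral_ofReal (hc.integrableOn_Icc.mono_set Ioo_subset_Icc_self)
    (Filter.Eventually.of_forall fun s => by positivity), h2, ← ENNReal.ofReal_one]
  refine ENNReal.ofReal_le_ofReal ?_
  have := Real.exp_pos (-(l * T))
  simp
  linarith

lemma mul_exp_neg_le (x : ℝ) : x * Real.exp (-x) ≤ 1 := by
  have h1 := Real.add_one_le_exp x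
  have h2 : Real.exp x * Real.exp (-x) = 1 := by rw [← Real.exp_add]; simp
  nlinarith [Real.exp_pos (-x)]

/-- The curve `exp(-l t) f`, where `l` acts as a Fourier multiplier. -/
def heatCurve (l : (Fin d → ℤ) → ℝ) (f : L2 d) (t : ℝ) : L2 d :=
  synth fun k => Real.exp (-(l k * t)) * boxFourierCoeff f k

/-- The time derivative of `heatCurve`. -/
def heatCurveDeriv (l : (Fin d → ℤ) → ℝ) (f : L2 d) (t : ℝ) : L2 d :=
  synth fun k => -(l k : ℂ) * (Real.exp (-(l k * t)) * boxFourierCoeff f k)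

variable {l : (Fin d → ℤ) → ℝ} (hl : ∀ k, 0 ≤ l k) (hl' : ∀ k, l (-k) = l k)

include hl hl' in
lemma boxFourierCoeff_heatCurve (f : L2 d) {t : ℝ} (ht : 0 ≤ t) (k : Fin d → ℤ) :
    boxFourierCoeff (heatCurve l f t) k = Real.exp (-(l k * t)) * boxFourierCoeff f k := by
  refine boxFourierCoeff_synth ?_ (fun k => ?_) k
  · refine (summable_norm_sq_boxFourierCoeff f).of_nonneg_of_le (fun k => sq_nonneg _) fun k => ?_
    rw [norm_mul, Complex.norm_real, Real.norm_of_nonneg (Real.exp_pos _).le]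
    gcongr
    refine mul_le_of_le_one_left (norm_nonneg _) (Real.exp_le_one_iff.2 ?_)
    nlinarith [mul_nonneg (hl k) ht]
  · rw [map_mul, Complex.conj_ofReal, hl', boxFourierCoeff_neg]

include hl hl' in
-- Since x exp(-x) ≤ 1, the multiplier l exp(-lt) is at most 1/t. At t = 0 the symbol may be
-- unbounded, so a general L² function has no such derivative there.
lemma boxFourierCoeff_heatCurveDeriv (f : L2 d) {t : ℝ} (ht : 0 < t) (k : Fin d → ℤ) :
    boxFourierCoeff (heatCurveDeriv l f t) k =
      -(l k : ℂ) * (Real.exp (-(l k * t)) * boxFourierCoeff f k) := by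
  refine boxFourierCoeff_synth ?_ (fun k => ?_) k
  · refine ((summable_norm_sq_boxFourierCoeff f).mul_left ((1 / t) ^ 2)).of_nonneg_of_le
      (fun k => sq_nonneg _) fun k => ?_
    rw [← mul_assoc, norm_mul, mul_pow]
    refine mul_le_mul_of_nonneg_right ?_ (sq_nonneg _)
    rw [norm_mul, norm_neg, Complex.norm_real, Complex.norm_real, Real.norm_of_nonneg (hl k),
      Real.norm_of_nonneg (Real.exp_pos _).le]
    have h0 := hl k
    gcongr
    rw [le_div_iff₀ ht]
    nlinarith [mul_exp_neg_le (l k * t)]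
  · rw [map_mul, map_mul, map_neg, Complex.conj_ofReal, Complex.conj_ofReal, hl',
      boxFourierCoeff_neg]

include hl hl' in
lemma heatCurve_zero (f : L2 d) : heatCurve l f 0 = f :=
  eq_of_boxFourierCoeff_eq fun k => by
    rw [boxFourierCoeff_heatCurve hl hl' f le_rfl]
    simp

/-- Of the two factors of w², one is bounded by `bessel`, which the H¹ datum pays for, and the other
by 1 + l, which integration of the exponential in time pays for. The choice w = l controls the time
derivative, the choice w = `bessel` the H² norm. -/
lemma lintegral_tsum_exp_lt_top (hl : ∀ k, 0 ≤ l k) (hT : 0 ≤ T) {f : L2 d} (hf : MemH 1 f)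
    {C : ℝ} {w : (Fin d → ℤ) → ℝ} (hw0 : ∀ k, 0 ≤ w k) (hw : ∀ k, w k ≤ C * bessel k)
    (hwl : ∀ k, w k ≤ C * (1 + l k)) :
    ∫⁻ t in Ioo 0 T, ∑' k, ENNReal.ofReal
      (w k ^ 2 * ‖(Real.exp (-(l k * t)) : ℂ) * boxFourierCoeff f k‖ ^ 2) < ⊤ := by
  have hC : 0 ≤ C := by
    have := (hw0 0).trans (hw 0)
    exact nonneg_of_mul_nonneg_left this (bessel_pos 0)
  have hm : ∀ k, AEMeasurable (fun t => ENNReal.ofReal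
      (w k ^ 2 * ‖(Real.exp (-(l k * t)) : ℂ) * boxFourierCoeff f k‖ ^ 2))
      (volume.restrict (Ioo 0 T)) := fun k =>
    (Continuous.measurable (by fun_prop)).ennreal_ofReal.aemeasurable
  rw [lintegral_tsum hm]
  have hk : ∀ k, ∫⁻ t in Ioo 0 T, ENNReal.ofReal
      (w k ^ 2 * ‖(Real.exp (-(l k * t)) : ℂ) * boxFourierCoeff f k‖ ^ 2) ≤
      ENNReal.ofReal (C ^ 2 * (T + 1)) * ENNReal.ofReal (bessel k * ‖boxFourierCoeff f k‖ ^ 2) := by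
    intro k
    have hb := (bessel_pos k).le
    calc ∫⁻ t in Ioo 0 T, ENNReal.ofReal
          (w k ^ 2 * ‖(Real.exp (-(l k * t)) : ℂ) * boxFourierCoeff f k‖ ^ 2)
        ≤ ∫⁻ t in Ioo 0 T, ENNReal.ofReal (C ^ 2 * (bessel k * ‖boxFourierCoeff f k‖ ^ 2)) *
          (1 + ENNReal.ofReal (l k * Real.exp (-(l k * t)))) := by
          refine setLIntegral_mono' measurableSet_Ioo fun t ht => ?_
          have he : Real.exp (-(l k * t)) ≤ 1 :=
            Real.exp_le_one_iff.2 (by nlinarith [mul_nonneg (hl k) ht.1.le])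
          have he0 := Real.exp_pos (-(l k * t))
          have hlk := hl k
          rw [← ENNReal.ofReal_one, ← ENNReal.ofReal_add zero_le_one (by positivity),
            ← ENNReal.ofReal_mul (by positivity)]
          refine ENNReal.ofReal_le_ofReal ?_
          rw [norm_mul, Complex.norm_real, Real.norm_of_nonneg he0.le, mul_pow]
          have h1 : w k ^ 2 ≤ C ^ 2 * (bessel k * (1 + l k)) := by
            calc w k ^ 2 = w k * w k := sq _
              _ ≤ (C * bessel k) * (C * (1 + l k)) := mul_le_mul (hw k) (hwl k) (hw0 k)
                (by positivity)
              _ = _ := by ring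
          have h2 : (1 + l k) * Real.exp (-(l k * t)) ^ 2 ≤ 1 + l k * Real.exp (-(l k * t)) := by
            have h3 : Real.exp (-(l k * t)) ^ 2 ≤ Real.exp (-(l k * t)) := by nlinarith
            nlinarith
          calc w k ^ 2 * (Real.exp (-(l k * t)) ^ 2 * ‖boxFourierCoeff f k‖ ^ 2)
              ≤ C ^ 2 * (bessel k * (1 + l k)) *
                (Real.exp (-(l k * t)) ^ 2 * ‖boxFourierCoeff f k‖ ^ 2) :=
                mul_le_mul_of_nonneg_right h1 (by positivity)
            _ = C ^ 2 * (bessel k * ‖boxFourierCoeff f k‖ ^ 2) *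
                ((1 + l k) * Real.exp (-(l k * t)) ^ 2) := by ring
            _ ≤ _ := mul_le_mul_of_nonneg_left h2 (by positivity)
      _ ≤ ENNReal.ofReal (C ^ 2 * (bessel k * ‖boxFourierCoeff f k‖ ^ 2)) *
          ENNReal.ofReal (T + 1) := by
          rw [lintegral_const_mul' _ _ ENNReal.ofReal_ne_top]
          gcongr
          rw [lintegral_add_left measurable_const, ENNReal.ofReal_add hT zero_le_one,
            ENNReal.ofReal_one]
          refine add_le_add ?_ (lintegral_mul_exp_le (hl k) hT)
          simp
      _ = _ := by
          rw [← ENNReal.ofReal_mul (by positivity), ← ENNReal.ofReal_mul (by positivity)]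
          congr 1
          ring
  refine (ENNReal.tsum_le_tsum hk).trans_lt ?_
  rw [ENNReal.tsum_mul_left]
  refine ENNReal.mul_lt_top ENNReal.ofReal_lt_top ?_
  rw [memH_iff] at hf
  simp only [Real.rpow_one] at hf
  rw [← ENNReal.ofReal_tsum_of_nonneg (fun k => by have := bessel_pos k; positivity) hf]
  exact ENNReal.ofReal_lt_top

variable {C : ℝ}

include hl hl' in
lemma isTimeDeriv_heatCurve (hT : 0 ≤ T) {f : L2 d} (hf : MemH 1 f)
    (hC : ∀ k, l k ≤ C * bessel k) (hC1 : 1 ≤ C) :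
    IsTimeDeriv T (heatCurve l f) (heatCurveDeriv l f) := by
  have hae : ∀ k, (fun t => boxFourierCoeff (heatCurveDeriv l f t) k) =ᵐ[volume.restrict (Ioo 0 T)]
      fun t => -(l k : ℂ) * (Real.exp (-(l k * t)) * boxFourierCoeff f k) := fun k => by
    filter_upwards [ae_restrict_mem measurableSet_Ioo] with t ht
    exact boxFourierCoeff_heatCurveDeriv hl hl' f ht.1 k
  refine isTimeDeriv_of_boxFourierCoeff (memLp_two_of_boxFourierCoeff (fun k => ?_) ?_)
    fun k t ht => ?_
  · exact (Continuous.aestronglyMeasurable (by fun_prop)).congr (hae k).symm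
  · refine lt_of_eq_of_lt ?_ (lintegral_tsum_exp_lt_top hl hT hf (C := C) hl hC fun k => ?_)
    · refine setLIntegral_congr_fun measurableSet_Ioo fun t ht => ?_
      refine tsum_congr fun k => ?_
      rw [boxFourierCoeff_heatCurveDeriv hl hl' f ht.1, ← ofReal_norm,
        ← ENNReal.ofReal_pow (norm_nonneg _), norm_mul, norm_neg, Complex.norm_real,
        Real.norm_of_nonneg (hl k), mul_pow]
    · nlinarith [hl k]
  · rw [boxFourierCoeff_heatCurve hl hl' f ht.1, heatCurve_zero hl hl']
    have : ∫ s in (0 : ℝ)..t, boxFourierCoeff (heatCurveDeriv l f s) k =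
        ∫ s in (0 : ℝ)..t, -(l k : ℂ) * (Real.exp (-(l k * s)) * boxFourierCoeff f k) := by
      refine intervalIntegral.integral_congr_ae (Filter.Eventually.of_forall fun s hs => ?_)
      rw [uIoc_of_le ht.1] at hs
      exact boxFourierCoeff_heatCurveDeriv hl hl' f hs.1 k
    rw [this, intervalIntegral_exp]
    ring

include hl hl' in
lemma memE1_heatCurve (hT : 0 ≤ T) {f : L2 d} (hf : MemH 1 f)
    (hC : ∀ k, l k ≤ C * bessel k) (hC1 : 1 ≤ C) (hC2 : ∀ k, bessel k ≤ C * (1 + l k)) :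
    MemE1 T (heatCurve l f) := by
  refine ⟨⟨_, isTimeDeriv_heatCurve hl hl' hT hf hC hC1⟩, ?_⟩
  have h := lintegral_tsum_exp_lt_top hl hT hf (C := C) (w := bessel) (fun k => (bessel_pos k).le)
    (fun k => le_mul_of_one_le_left (bessel_pos k).le hC1) hC2
  have h2 : ∫⁻ t in Ioo 0 T, sobolevNorm 2 (heatCurve l f t) ^ 2 = ∫⁻ t in Ioo 0 T,
      ENNReal.ofReal (2 ^ d) * ∑' k, ENNReal.ofReal
      (bessel k ^ 2 * ‖(Real.exp (-(l k * t)) : ℂ) * boxFourierCoeff f k‖ ^ 2) := by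
    refine setLIntegral_congr_fun measurableSet_Ioo fun t ht => ?_
    simp only [sobolevNorm_sq]
    rw [← ENNReal.tsum_mul_left]
    refine tsum_congr fun k => ?_
    rw [boxFourierCoeff_heatCurve hl hl' f ht.1.le, ← ENNReal.ofReal_mul (by positivity),
      Real.rpow_two, mul_assoc]
  rw [h2, lintegral_const_mul' _ _ ENNReal.ofReal_ne_top]
  exact ENNReal.mul_lt_top ENNReal.ofReal_lt_top h

end HeatSemigroup

/-! ### The scaled Stokes system: explicit solution and decay in δ. -/

section Stokes

variable {T ε δ : ℝ}

/-- The symbol of `-Δ_δ`. -/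
def stokesSymbol (δ : ℝ) (k : Fin 3 → ℤ) : ℝ :=
  Real.pi ^ 2 * ∑ j, (![1, 1, δ] : Fin 3 → ℝ) j * (k j : ℝ) ^ 2

lemma stokesSymbol_eq (δ : ℝ) (k : Fin 3 → ℤ) : stokesSymbol δ k =
    Real.pi ^ 2 * ((k 0 : ℝ) ^ 2 + (k 1 : ℝ) ^ 2 + δ * (k 2 : ℝ) ^ 2) := by
  simp [stokesSymbol, Fin.sum_univ_three]

lemma stokesSymbol_nonneg (hδ : 0 < δ) (k : Fin 3 → ℤ) : 0 ≤ stokesSymbol δ k := by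
  rw [stokesSymbol_eq]
  positivity

lemma stokesSymbol_neg (δ : ℝ) (k : Fin 3 → ℤ) : stokesSymbol δ (-k) = stokesSymbol δ k := by
  simp [stokesSymbol]

lemma bessel_three (k : Fin 3 → ℤ) :
    bessel k = 1 + Real.pi ^ 2 * ((k 0 : ℝ) ^ 2 + (k 1 : ℝ) ^ 2 + (k 2 : ℝ) ^ 2) := by
  simp [bessel, Fin.sum_univ_three]

/-- The constant is chosen so that it also serves in the converse comparison
`bessel_le_stokesSymbol`; it may depend on δ because it enters regularity only, never the final
estimate. -/
lemma stokesSymbol_le (hδ : 0 < δ) (k : Fin 3 → ℤ) :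
    stokesSymbol δ k ≤ (1 + δ + 1 / δ) * bessel k := by
  rw [stokesSymbol_eq, bessel_three]
  have h1 : 0 < 1 / δ := by positivity
  have h0 : 0 ≤ Real.pi ^ 2 * (k 0 : ℝ) ^ 2 := by positivity
  have h2 : 0 ≤ Real.pi ^ 2 * (k 1 : ℝ) ^ 2 := by positivity
  have h3 : 0 ≤ Real.pi ^ 2 * (k 2 : ℝ) ^ 2 := by positivity
  nlinarith [mul_nonneg h1.le h0, mul_nonneg h1.le h2, mul_nonneg h1.le h3, mul_nonneg hδ.le h0,
    mul_nonneg hδ.le h2]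

lemma bessel_le_stokesSymbol (hδ : 0 < δ) (k : Fin 3 → ℤ) :
    bessel k ≤ (1 + δ + 1 / δ) * (1 + stokesSymbol δ k) := by
  rw [stokesSymbol_eq, bessel_three]
  have h1 : 0 < 1 / δ := by positivity
  have h4 : 1 / δ * δ = 1 := by field_simp
  have h0 : 0 ≤ Real.pi ^ 2 * (k 0 : ℝ) ^ 2 := by positivity
  have h2 : 0 ≤ Real.pi ^ 2 * (k 1 : ℝ) ^ 2 := by positivity
  have h3 : 0 ≤ Real.pi ^ 2 * (k 2 : ℝ) ^ 2 := by positivity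
  have h5 : (1 + δ + 1 / δ) * (1 + Real.pi ^ 2 * ((k 0 : ℝ) ^ 2 + (k 1 : ℝ) ^ 2 +
      δ * (k 2 : ℝ) ^ 2)) = (1 + δ + 1 / δ) * (1 + Real.pi ^ 2 * (k 0 : ℝ) ^ 2 +
      Real.pi ^ 2 * (k 1 : ℝ) ^ 2) + (δ + δ * δ + 1 / δ * δ) * (Real.pi ^ 2 * (k 2 : ℝ) ^ 2) := by
    ring
  rw [h5, h4]
  nlinarith [mul_nonneg h1.le h0, mul_nonneg h1.le h2, mul_nonneg hδ.le h3, mul_nonneg hδ.le h0,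
    mul_nonneg hδ.le h2, mul_nonneg (mul_nonneg hδ.le hδ.le) h3]

lemma memH_zero {d : ℕ} (s : ℝ) : MemH s (0 : L2 d) := by
  rw [memH_iff]
  simp [summable_zero]

lemma weakDeriv_zero {d : ℕ} (j : Fin d) : weakDeriv j (0 : L2 d) = 0 :=
  eq_of_boxFourierCoeff_eq fun k => by
    rw [(memH_zero 1).boxFourierCoeff_weakDeriv]
    simp

lemma memPressure_zero {d : ℕ} : MemPressure T (fun _ => (0 : L2 d)) := by
  refine ⟨aestronglyMeasurable_const, ?_, Filter.Eventually.of_forall fun _ => ?_⟩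
  · simp [sobolevNorm_sq]
  · rw [integral_eq_zero_of_ae]
    exact Lp.coeFn_zero ℝ 2 _

/-- The solution of the scaled Stokes problem, which is a solution of an anisotropic heat equation
because its pressure vanishes. -/
def stokesFlow (δ : ℝ) (u₀ : Fin 3 → L2 3) (t : ℝ) (i : Fin 3) : L2 3 :=
  heatCurve (stokesSymbol δ) (u₀ i) t

/-- Taking zero pressure works because the scalar multiplier exp(-λ(k)t) is common to the components
and even in k₂, hence preserves the divergence constraint, the parities and the vertical mean of the
data. -/
lemma isScaledStokesSolution_stokesFlow (hT : 0 < T) (hδ : 0 < δ) {u₀ : Fin 3 → L2 3}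
    (hu : ∀ i, MemH (3 / 2) (u₀ i)) (hσ : u₀ ∈ L2sigmaOmega)
    (hv : ∀ i, VerticalMeanZero (u₀ i)) :
    IsScaledStokesSolution T ε δ u₀ (stokesFlow δ u₀) := by
  have hl := stokesSymbol_nonneg hδ
  have hl' := stokesSymbol_neg δ
  have hC := stokesSymbol_le hδ
  have hC1 : 1 ≤ 1 + δ + 1 / δ := by
    have : 0 < 1 / δ := by positivity
    linarith
  have hH1 : ∀ i, MemH 1 (u₀ i) := fun i => (hu i).mono (by norm_num)
  have hE1 : ∀ i, MemE1 T fun t => stokesFlow δ u₀ t i := fun i =>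
    memE1_heatCurve hl hl' hT.le (hH1 i) hC hC1 (bessel_le_stokesSymbol hδ)
  refine ⟨hE1, funext fun i => heatCurve_zero hl hl' (u₀ i),
    fun t i => heatCurveDeriv (stokesSymbol δ) (u₀ i) t, fun _ => 0,
    fun i => isTimeDeriv_heatCurve hl hl' hT.le (hH1 i) hC hC1, memPressure_zero, ?_⟩
  filter_upwards [ae_all_iff.2 fun i => (hE1 i).ae_memH hT.le, ae_restrict_mem measurableSet_Ioo]
    with t h2 ht
  have hc : ∀ i k, boxFourierCoeff (stokesFlow δ u₀ t i) k =
      Real.exp (-(stokesSymbol δ k * t)) * boxFourierCoeff (u₀ i) k := fun i k =>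
    boxFourierCoeff_heatCurve hl hl' (u₀ i) ht.1.le k
  have heq : ∀ i, heatCurveDeriv (stokesSymbol δ) (u₀ i) t -
      laplacian ![1, 1, δ] (stokesFlow δ u₀ t i) = 0 := fun i =>
    eq_of_boxFourierCoeff_eq fun k => by
      rw [boxFourierCoeff_sub, boxFourierCoeff_heatCurveDeriv hl hl' _ ht.1,
        (h2 i).boxFourierCoeff_laplacian, hc, boxFourierCoeff_zero]
      simp only [stokesSymbol]
      ring
  have hsymb : ∀ k, stokesSymbol δ (reflectFreq k) = stokesSymbol δ k := fun k => by
    simp [stokesSymbol_eq, reflectFreq]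
  have hvert : ∀ i, VerticalMeanZero (stokesFlow δ u₀ t i) := fun i =>
    verticalMeanZero_iff.2 fun k hk => by rw [hc, verticalMeanZero_iff.1 (hv i) k hk, mul_zero]
  simp only [weakDeriv_zero, add_zero, smul_zero, heq, true_and]
  refine ⟨?_, hvert 0, hvert 1, ?_, ?_, ?_, ?_, ?_⟩
  · rw [divergence_eq_zero_iff fun i => (h2 i).mono one_le_two]
    intro k
    simp only [hc]
    rw [Finset.sum_congr rfl fun i _ => mul_left_comm _ _ _, ← Finset.mul_sum, (fourier_of_mem_L2sigmaOmega hσ k).1, mul_zero]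
  · exact verticalMeanZero_iff.2 fun k _ => boxFourierCoeff_zero k
  · refine evenZ_iff.2 fun k => ?_
    rw [hc, hc, hsymb, (fourier_of_mem_L2sigmaOmega hσ k).2.1]
  · refine evenZ_iff.2 fun k => ?_
    rw [hc, hc, hsymb, (fourier_of_mem_L2sigmaOmega hσ k).2.2.1]
  · refine oddZ_iff.2 fun k => ?_
    rw [hc, hc, hsymb, (fourier_of_mem_L2sigmaOmega hσ k).2.2.2, mul_neg]
  · refine evenZ_iff.2 fun k => ?_
    rw [boxFourierCoeff_zero, boxFourierCoeff_zero]

/-- The Fourier coefficients of any solution of the scaled Stokes problem. -/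
lemma IsScaledStokesSolution.boxFourierCoeff_eq (hT : 0 < T) (hε : 0 < ε)
    {u₀ : Fin 3 → L2 3} {u : ℝ → Fin 3 → L2 3} (h : IsScaledStokesSolution T ε δ u₀ u)
    {t : ℝ} (ht : t ∈ Icc 0 T) (i : Fin 3) (k : Fin 3 → ℤ) :
    boxFourierCoeff (u t i) k =
      Real.exp (-(stokesSymbol δ k * t)) * boxFourierCoeff (u₀ i) k := by
  obtain ⟨u', p, hd, hp, heq⟩ := h.equations
  set l : ℝ := stokesSymbol δ k with hl
  -- The weights with which the pressure gradient enters the three momentum equations.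
  set c : Fin 3 → ℂ := ![1, 1, 1 / (ε : ℂ) ^ 2] with hcdef
  have hcoeff : ∀ᵐ s ∂(volume.restrict (Ioo 0 T)),
      (∀ i, boxFourierCoeff (u' s i) k + l * boxFourierCoeff (u s i) k =
        -(Complex.I * Real.pi * boxFourierCoeff (p s) k) * (c i * k i)) ∧
      ∑ i, (k i : ℂ) * boxFourierCoeff (u s i) k = 0 := by
    filter_upwards [heq, ae_all_iff.2 fun i => (h.memE1 i).ae_memH hT.le, hp.ae_memH]
      with s hs h2 hp1
    obtain ⟨e0, e1, e2, hdiv, -⟩ := hs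
    refine ⟨?_, (divergence_eq_zero_iff fun i => (h2 i).mono one_le_two).1 hdiv k⟩
    have f0 := congrArg (fun f => boxFourierCoeff f k) e0
    have f1 := congrArg (fun f => boxFourierCoeff f k) e1
    have f2 := congrArg (fun f => boxFourierCoeff f k) e2
    simp only [boxFourierCoeff_add, boxFourierCoeff_sub, boxFourierCoeff_smul, boxFourierCoeff_zero,
      (h2 _).boxFourierCoeff_laplacian, hp1.boxFourierCoeff_weakDeriv] at f0 f1 f2
    push_cast at f2
    have hlc : ((Real.pi ^ 2 * ∑ j, (![1, 1, δ] : Fin 3 → ℝ) j * (k j : ℝ) ^ 2 : ℝ) : ℂ) = l := rfl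
    rw [hlc] at f0 f1
    push_cast at hlc
    rw [hlc] at f2
    intro i
    fin_cases i
    · simp only [hcdef, Fin.zero_eta, Matrix.cons_val_zero]
      linear_combination f0
    · simp only [hcdef, Fin.mk_one, Matrix.cons_val_one, Matrix.cons_val_zero]
      linear_combination f1
    · simp only [hcdef, Fin.reduceFinMk, Matrix.cons_val]
      linear_combination f2
  have hint : ∀ i, ∀ r ∈ Icc 0 T, IntervalIntegrable (fun s => boxFourierCoeff (u' s i) k)
      volume 0 r := fun i r hr => (hd i).intervalIntegrable hr k
  have hcont : ∀ i, ContinuousOn (fun s => boxFourierCoeff (u s i) k) (Icc 0 T) :=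
    fun i => (hd i).continuousOn hT.le k
  have hint' : ∀ i, ∀ r ∈ Icc 0 T, IntervalIntegrable (fun s => boxFourierCoeff (u s i) k)
      volume 0 r := fun i r hr =>
    ((hcont i).mono (Icc_subset_Icc_right hr.2)).intervalIntegrable_of_Icc hr.1
  have hI : ∀ i, ∀ r ∈ Icc 0 T, ∫ s in (0 : ℝ)..r, (boxFourierCoeff (u' s i) k +
      l * boxFourierCoeff (u s i) k) = boxFourierCoeff (u r i) k - boxFourierCoeff (u 0 i) k +
      l * ∫ s in (0 : ℝ)..r, boxFourierCoeff (u s i) k := by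
    intro i r hr
    rw [intervalIntegral.integral_add (hint i r hr) ((hint' i r hr).const_mul _),
      intervalIntegral.integral_const_mul, (hd i).boxFourierCoeff_eq hr k]
    ring
  have hae : ∀ r ∈ Icc 0 T, ∀ᵐ s, s ∈ uIoc 0 r →
      (∀ i, boxFourierCoeff (u' s i) k + l * boxFourierCoeff (u s i) k =
        -(Complex.I * Real.pi * boxFourierCoeff (p s) k) * (c i * k i)) ∧
      ∑ i, (k i : ℂ) * boxFourierCoeff (u s i) k = 0 := by
    intro r hr
    exact ae_uIoc_of_ae_Ioo hcoeff hr
  -- Continuity extends the almost everywhere constraint to every time, the initial time included,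
  -- so nothing about `u₀` has to be assumed.
  have hdiv : EqOn (fun s => ∑ i, (k i : ℂ) * boxFourierCoeff (u s i) k) (fun _ => 0) (Icc 0 T) :=
    eqOn_Icc_of_ae_Ioo hT (hcoeff.mono fun s hs => hs.2)
      (continuousOn_finsetSum _ fun i _ => continuousOn_const.mul (hcont i)) continuousOn_const
  -- The symbol of the elliptic operator that acts on the pressure; as a sum of weighted squares it
  -- vanishes only at k = 0.
  set κ : ℂ := ∑ i, c i * (k i : ℂ) ^ 2 with hκ
  have hzero : ∀ i, ∀ r ∈ Icc 0 T, ∫ s in (0 : ℝ)..r, (boxFourierCoeff (u' s i) k +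
      l * boxFourierCoeff (u s i) k) = 0 := by
    intro i r hr
    by_cases hκ0 : κ = 0
    · have hk : (k i : ℂ) = 0 := by
        have hκr : κ = (((k 0 : ℝ) ^ 2 + (k 1 : ℝ) ^ 2 + 1 / ε ^ 2 * (k 2 : ℝ) ^ 2 : ℝ) : ℂ) := by
          rw [hκ, Fin.sum_univ_three]
          simp [hcdef]
        rw [hκr, Complex.ofReal_eq_zero] at hκ0
        have h0 : (k 0 : ℝ) ^ 2 = 0 := by nlinarith [sq_nonneg (k 0 : ℝ), sq_nonneg (k 1 : ℝ),
          show 0 ≤ 1 / ε ^ 2 * (k 2 : ℝ) ^ 2 by positivity]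
        have h1 : (k 1 : ℝ) ^ 2 = 0 := by nlinarith [sq_nonneg (k 0 : ℝ), sq_nonneg (k 1 : ℝ),
          show 0 ≤ 1 / ε ^ 2 * (k 2 : ℝ) ^ 2 by positivity]
        have h2 : 1 / ε ^ 2 * (k 2 : ℝ) ^ 2 = 0 := by nlinarith
        have h2' : (k 2 : ℝ) ^ 2 = 0 := by
          rcases mul_eq_zero.1 h2 with h3 | h3
          · exact absurd h3 (by positivity)
          · exact h3
        have h3 : ∀ i, k i = 0 := by
          intro i
          fin_cases i
          · exact_mod_cast pow_eq_zero_iff two_ne_zero |>.1 h0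
          · exact_mod_cast pow_eq_zero_iff two_ne_zero |>.1 h1
          · exact_mod_cast pow_eq_zero_iff two_ne_zero |>.1 h2'
        simp [h3 i]
      rw [intervalIntegral.integral_congr_ae (g := fun _ => 0)]
      · simp
      · filter_upwards [hae r hr] with s hs hs'
        rw [(hs hs').1 i, hk, mul_zero, mul_zero]
    -- The pressure term is the multiple c_i k_i / κ of the divergence of the momentum equations.
    -- That divergence is a combination of the divergence of `u` and its increments, so its time
    -- integral vanishes. Integrating avoids differentiating the constraint in time.
    · have h1 : ∫ s in (0 : ℝ)..r, (boxFourierCoeff (u' s i) k + l * boxFourierCoeff (u s i) k) =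
          ∫ s in (0 : ℝ)..r, (c i * k i / κ) * ∑ j, (k j : ℂ) * (boxFourierCoeff (u' s j) k +
            l * boxFourierCoeff (u s j) k) := by
        refine intervalIntegral.integral_congr_ae ?_
        filter_upwards [hae r hr] with s hs hs'
        have h2 := (hs hs').1
        simp only [h2]
        have h3 : ∑ j, (k j : ℂ) * (-(Complex.I * Real.pi * boxFourierCoeff (p s) k) *
            (c j * k j)) = -(Complex.I * Real.pi * boxFourierCoeff (p s) k) * κ := by
          rw [hκ, Finset.mul_sum]
          exact Finset.sum_congr rfl fun j _ => by ring
        rw [h3]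
        field_simp
      rw [h1, intervalIntegral.integral_const_mul, intervalIntegral.integral_finsetSum fun j _ =>
        ((hint j r hr).add ((hint' j r hr).const_mul _)).const_mul _]
      simp only [intervalIntegral.integral_const_mul, hI _ r hr]
      have h3 : ∑ j, (k j : ℂ) * (boxFourierCoeff (u r j) k - boxFourierCoeff (u 0 j) k +
          l * ∫ s in (0 : ℝ)..r, boxFourierCoeff (u s j) k) =
          ∑ j, (k j : ℂ) * boxFourierCoeff (u r j) k - ∑ j, (k j : ℂ) * boxFourierCoeff (u 0 j) k +
          l * ∫ s in (0 : ℝ)..r, ∑ j, (k j : ℂ) * boxFourierCoeff (u s j) k := by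
        rw [intervalIntegral.integral_finsetSum fun j _ => (hint' j r hr).const_mul _]
        simp only [intervalIntegral.integral_const_mul, Fin.sum_univ_three]
        ring
      have h4 : ∫ s in (0 : ℝ)..r, ∑ j, (k j : ℂ) * boxFourierCoeff (u s j) k = 0 := by
        rw [intervalIntegral.integral_congr (g := fun _ => 0)]
        · simp
        · intro s hs
          rw [uIcc_of_le hr.1] at hs
          exact hdiv ⟨hs.1, hs.2.trans hr.2⟩
      have h5 := hdiv hr
      have h6 := hdiv (left_mem_Icc.2 hT.le)
      simp only at h5 h6
      rw [h3, h4, h5, h6]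
      simp
  have hfin := eq_exp_of_eq_integral (hcont i) (l := l) (fun r hr => by
    have h1 := hI i r hr
    rw [hzero i r hr] at h1
    linear_combination -h1) ht
  rw [hfin, h.initial]

lemma sobolevNorm_sq_le_of_norm_le {d : ℕ} {s : ℝ} {f g : L2 d} {c : ℝ}
    (h : ∀ k, ‖boxFourierCoeff f k‖ ^ 2 ≤ c * ‖boxFourierCoeff g k‖ ^ 2) (hc : 0 ≤ c) :
    sobolevNorm s f ^ 2 ≤ ENNReal.ofReal c * sobolevNorm s g ^ 2 := by
  simp only [sobolevNorm_sq]
  rw [← ENNReal.tsum_mul_left]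
  refine ENNReal.tsum_le_tsum fun k => ?_
  rw [← ENNReal.ofReal_mul hc]
  refine ENNReal.ofReal_le_ofReal ?_
  have := Real.rpow_nonneg (bessel_pos k).le s
  calc 2 ^ d * bessel k ^ s * ‖boxFourierCoeff f k‖ ^ 2
      ≤ 2 ^ d * bessel k ^ s * (c * ‖boxFourierCoeff g k‖ ^ 2) :=
        mul_le_mul_of_nonneg_left (h k) (by positivity)
    _ = _ := by ring

/-- Modes with k₂ = 0 are absent from the data, and a nonzero integer has k₂² ≥ 1, so every active
mode decays at rate at least π²δ. The factor ε ≤ 1 on the third component only helps. -/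
lemma IsScaledStokesSolution.sobolevNormVec_sq_le (hT : 0 < T) (hε : 0 < ε) (hε1 : ε ≤ 1)
    (hδ : 0 < δ) {u₀ : Fin 3 → L2 3} {u : ℝ → Fin 3 → L2 3}
    (hv : ∀ i, VerticalMeanZero (u₀ i)) (h : IsScaledStokesSolution T ε δ u₀ u)
    {t : ℝ} (ht : t ∈ Icc 0 T) (s : ℝ) :
    sobolevNormVec s (rescale ε (u t)) ^ 2 ≤
      ENNReal.ofReal (Real.exp (-(2 * Real.pi ^ 2 * δ * t))) * sobolevNormVec s u₀ ^ 2 := by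
  have hsq : ∀ v : Fin 3 → L2 3, sobolevNormVec s v ^ 2 = ∑ i, sobolevNorm s (v i) ^ 2 := by
    intro v
    rw [sobolevNormVec, ← ENNReal.rpow_natCast, ← ENNReal.rpow_mul]
    norm_num
  rw [hsq, hsq, Finset.mul_sum]
  refine Finset.sum_le_sum fun i _ => sobolevNorm_sq_le_of_norm_le (fun k => ?_)
    (Real.exp_pos _).le
  have h1 : ‖boxFourierCoeff (u t i) k‖ ^ 2 ≤
      Real.exp (-(2 * Real.pi ^ 2 * δ * t)) * ‖boxFourierCoeff (u₀ i) k‖ ^ 2 := by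
    rw [h.boxFourierCoeff_eq hT hε ht]
    by_cases hk : k 2 = 0
    · simp [verticalMeanZero_iff.1 (hv i) k hk]
    · rw [norm_mul, mul_pow, Complex.norm_real, Real.norm_of_nonneg (Real.exp_pos _).le,
        ← Real.exp_nat_mul]
      refine mul_le_mul_of_nonneg_right (Real.exp_le_exp.2 ?_) (sq_nonneg _)
      have hk2 : (1 : ℝ) ≤ (k 2 : ℝ) ^ 2 := by
        have : (1 : ℤ) ≤ (k 2) ^ 2 := by
          have := Int.one_le_abs hk
          nlinarith [sq_abs (k 2)]
        exact_mod_cast this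
      have h2 : Real.pi ^ 2 * δ ≤ stokesSymbol δ k := by
        rw [stokesSymbol_eq]
        have : δ ≤ (k 0 : ℝ) ^ 2 + (k 1 : ℝ) ^ 2 + δ * (k 2 : ℝ) ^ 2 := by
          nlinarith [sq_nonneg (k 0 : ℝ), sq_nonneg (k 1 : ℝ)]
        gcongr
      have h3 := mul_le_mul_of_nonneg_right h2 ht.1
      push_cast
      linarith
  refine le_trans ?_ h1
  fin_cases i
  · exact le_rfl
  · exact le_rfl
  · simp only [rescale, Fin.reduceFinMk, Matrix.cons_val, boxFourierCoeff_smul, norm_mul, mul_pow,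
      Complex.norm_real, Real.norm_of_nonneg hε.le]
    exact mul_le_of_le_one_left (sq_nonneg _) (pow_le_one₀ hε.le hε1)

/-- The fourth power of the norm decays at rate 4π²δ, so its time integral carries 1/(4π²δ) ≤ 1/δ;
the fourth root gives the power of δ, uniformly in `T`. -/
lemma IsScaledStokesSolution.normL4H_le (hT : 0 < T) (hε : 0 < ε) (hε1 : ε ≤ 1)
    (hδ : 0 < δ) {u₀ : Fin 3 → L2 3} {u : ℝ → Fin 3 → L2 3}
    (hv : ∀ i, VerticalMeanZero (u₀ i)) (h : IsScaledStokesSolution T ε δ u₀ u) (s : ℝ) :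
    normL4H T s (fun t => rescale ε (u t)) ≤
      ENNReal.ofReal (1 / δ ^ (1 / 4 : ℝ)) * sobolevNormVec s u₀ := by
  have hpi : 1 ≤ 4 * Real.pi ^ 2 := by nlinarith [Real.pi_gt_three]
  have h1 : ∫⁻ t in Ioo 0 T, sobolevNormVec s (rescale ε (u t)) ^ 4 ≤
      ENNReal.ofReal (1 / δ) * sobolevNormVec s u₀ ^ 4 := by
    set l : ℝ := 4 * Real.pi ^ 2 * δ with hl
    have hl0 : 0 < l := by positivity
    calc ∫⁻ t in Ioo 0 T, sobolevNormVec s (rescale ε (u t)) ^ 4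
        ≤ ∫⁻ t in Ioo 0 T, (ENNReal.ofReal (1 / l) * ENNReal.ofReal (l * Real.exp (-(l * t)))) *
            sobolevNormVec s u₀ ^ 4 := by
          refine setLIntegral_mono' measurableSet_Ioo fun t ht => ?_
          have h2 := pow_le_pow_left' (h.sobolevNormVec_sq_le hT hε hε1 hδ hv
            (Ioo_subset_Icc_self ht) s) 2
          rw [mul_pow, ← pow_mul, ← pow_mul, ← ENNReal.ofReal_pow (Real.exp_pos _).le,
            ← Real.exp_nat_mul] at h2
          convert! h2 using 2
          rw [← ENNReal.ofReal_mul (by positivity)]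
          congr 1
          rw [← mul_assoc, one_div_mul_cancel hl0.ne', one_mul, hl]
          congr 1
          push_cast
          ring
      _ = (∫⁻ t in Ioo 0 T, ENNReal.ofReal (1 / l) * ENNReal.ofReal (l * Real.exp (-(l * t)))) *
            sobolevNormVec s u₀ ^ 4 := by
          rw [lintegral_mul_const _ (Measurable.const_mul
            (Continuous.measurable (by fun_prop)).ennreal_ofReal _)]
      _ ≤ _ := by
          gcongr
          rw [lintegral_const_mul' _ _ ENNReal.ofReal_ne_top]
          refine (mul_le_mul_right (lintegral_mul_exp_le hl0.le hT.le) _).trans ?_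
          rw [mul_one]
          refine ENNReal.ofReal_le_ofReal (one_div_le_one_div_of_le hδ ?_)
          rw [hl]
          exact le_mul_of_one_le_left hδ.le hpi
  rw [normL4H]
  refine (ENNReal.rpow_le_rpow h1 (by norm_num)).trans (le_of_eq ?_)
  rw [ENNReal.mul_rpow_of_nonneg _ _ (by norm_num), ENNReal.ofReal_rpow_of_nonneg (by positivity)
    (by norm_num), Real.div_rpow zero_le_one hδ.le, Real.one_rpow, ← ENNReal.rpow_natCast,
    ← ENNReal.rpow_mul]
  norm_num

end Stokes

/-! ### Norms and discrete convolution of families of Fourier coefficients. -/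

section Sequences

variable {d : ℕ}

/-- The sum of the absolute values of a family. -/
def normOne (a : (Fin d → ℤ) → ℂ) : ℝ≥0∞ := ∑' p, ‖a p‖ₑ

/-- The square of the `ℓ²`-norm of a family. -/
def normTwoSq (a : (Fin d → ℤ) → ℂ) : ℝ≥0∞ := ∑' p, ‖a p‖ₑ ^ 2

/-- The discrete convolution. -/
def conv (a b : (Fin d → ℤ) → ℂ) (k : Fin d → ℤ) : ℂ := ∑' p, a p * b (k - p)

lemma _root_.ENNReal.sq_rpow_half (x : ℝ≥0∞) : (x ^ (1 / 2 : ℝ)) ^ 2 = x := by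
  rw [← ENNReal.rpow_natCast, ← ENNReal.rpow_mul]
  norm_num

lemma sq_tsum_mul_le {ι : Type*} [Countable ι] (f g : ι → ℝ≥0∞) :
    (∑' p, f p * g p) ^ 2 ≤ (∑' p, f p ^ 2) * ∑' p, g p ^ 2 := by
  let _ : MeasurableSpace ι := ⊤
  have h := ENNReal.lintegral_mul_le_Lp_mul_Lq (Measure.count : Measure ι)
    (Real.HolderConjugate.two_two) (f := f) (g := g) measurable_from_top.aemeasurable
    measurable_from_top.aemeasurable
  simp only [lintegral_count, Pi.mul_apply, ENNReal.rpow_ofNat] at h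
  have h2 := pow_le_pow_left' h 2
  rwa [mul_pow, ENNReal.sq_rpow_half, ENNReal.sq_rpow_half] at h2

lemma tsum_sub_left (f : (Fin d → ℤ) → ℝ≥0∞) (k : Fin d → ℤ) : ∑' p, f (k - p) = ∑' p, f p :=
  (Equiv.subLeft k).tsum_eq f

lemma enorm_conv_sq_le (a b : (Fin d → ℤ) → ℂ) (k : Fin d → ℤ) :
    ‖conv a b k‖ₑ ^ 2 ≤ normTwoSq a * normTwoSq b := by
  refine (pow_le_pow_left' (enorm_tsum_le_tsum_enorm) 2).trans ?_
  simp only [enorm_mul]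
  refine (sq_tsum_mul_le _ _).trans (le_of_eq ?_)
  rw [normTwoSq, normTwoSq, tsum_sub_left (fun p => ‖b p‖ₑ ^ 2) k]

/-- **Young's inequality** for discrete convolutions, on the level of nonnegative families. -/
lemma tsum_sq_conv_le (f g : (Fin d → ℤ) → ℝ≥0∞) :
    ∑' k, (∑' p, f p * g (k - p)) ^ 2 ≤ (∑' p, f p) ^ 2 * ∑' p, g p ^ 2 := by
  have h : ∀ k, (∑' p, f p * g (k - p)) ^ 2 ≤ (∑' p, f p) * ∑' p, f p * g (k - p) ^ 2 := by
    intro k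
    -- Cauchy-Schwarz with respect to the weight `f`, written as a product of two square roots.
    have h1 := sq_tsum_mul_le (fun p => f p ^ (1 / 2 : ℝ)) (fun p => f p ^ (1 / 2 : ℝ) * g (k - p))
    simp only [mul_pow, ← mul_assoc, ENNReal.sq_rpow_half, ← sq] at h1
    exact h1
  refine (ENNReal.tsum_le_tsum h).trans (le_of_eq ?_)
  rw [ENNReal.tsum_mul_left, ENNReal.tsum_comm]
  have h2 : ∀ p, ∑' k, f p * g (k - p) ^ 2 = f p * ∑' q, g q ^ 2 := fun p => by
    rw [ENNReal.tsum_mul_left]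
    congr 1
    exact (Equiv.subRight p).tsum_eq fun q => g q ^ 2
  simp only [h2]
  rw [ENNReal.tsum_mul_right, sq, mul_assoc]

lemma normTwoSq_conv_le (a b : (Fin d → ℤ) → ℂ) :
    normTwoSq (conv a b) ≤ normOne a ^ 2 * normTwoSq b := by
  refine le_trans (ENNReal.tsum_le_tsum fun k => ?_)
    (tsum_sq_conv_le (fun p => ‖a p‖ₑ) (fun p => ‖b p‖ₑ))
  refine pow_le_pow_left' ?_ 2
  refine enorm_tsum_le_tsum_enorm.trans (le_of_eq ?_)
  simp only [enorm_mul]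

lemma conv_comm (a b : (Fin d → ℤ) → ℂ) : conv a b = conv b a := by
  funext k
  rw [conv, conv, ← (Equiv.subLeft k).tsum_eq]
  refine tsum_congr fun p => ?_
  simp only [Equiv.subLeft_apply, sub_sub_cancel]
  ring

lemma summable_of_normTwoSq {a b : (Fin d → ℤ) → ℂ} (ha : normTwoSq a ≠ ⊤) (hb : normTwoSq b ≠ ⊤)
    (k : Fin d → ℤ) : Summable fun p => a p * b (k - p) := by
  refine Summable.of_enorm ?_
  have h := sq_tsum_mul_le (fun p => ‖a p‖ₑ) (fun p => ‖b (k - p)‖ₑ)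
  rw [tsum_sub_left (fun p => ‖b p‖ₑ ^ 2) k] at h
  simp only [enorm_mul]
  intro h0
  rw [h0] at h
  have h1 : normTwoSq a * normTwoSq b < ⊤ := ENNReal.mul_lt_top ha.lt_top hb.lt_top
  exact absurd (h.trans_lt h1) (by simp)

lemma normTwoSq_add_le (a b : (Fin d → ℤ) → ℂ) :
    normTwoSq (a + b) ≤ 2 * normTwoSq a + 2 * normTwoSq b := by
  rw [normTwoSq, normTwoSq, normTwoSq, ← ENNReal.tsum_mul_left, ← ENNReal.tsum_mul_left,
    ← ENNReal.tsum_add]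
  refine ENNReal.tsum_le_tsum fun p => ?_
  have h1 : ‖(a + b) p‖ₑ ≤ ‖a p‖ₑ + ‖b p‖ₑ := enorm_add_le _ _
  refine (pow_le_pow_left' h1 2).trans ?_
  have := ENNReal.rpow_add_le_mul_rpow_add_rpow ‖a p‖ₑ ‖b p‖ₑ one_le_two
  norm_num at this
  rwa [mul_add] at this

lemma normTwoSq_neg (a : (Fin d → ℤ) → ℂ) : normTwoSq (-a) = normTwoSq a := by
  simp [normTwoSq]

lemma normTwoSq_sub_le (a b : (Fin d → ℤ) → ℂ) :
    normTwoSq (a - b) ≤ 2 * normTwoSq a + 2 * normTwoSq b := by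
  rw [sub_eq_add_neg, ← normTwoSq_neg b]
  exact normTwoSq_add_le a (-b)

lemma normTwoSq_eq_ofReal {a : (Fin d → ℤ) → ℂ} (h : Summable fun k => ‖a k‖ ^ 2) :
    normTwoSq a = ENNReal.ofReal (∑' k, ‖a k‖ ^ 2) := by
  rw [ENNReal.ofReal_tsum_of_nonneg (fun k => sq_nonneg _) h]
  refine tsum_congr fun k => ?_
  rw [ENNReal.ofReal_pow (norm_nonneg _), ofReal_norm]

lemma summable_of_normTwoSq_ne_top {a : (Fin d → ℤ) → ℂ} (h : normTwoSq a ≠ ⊤) :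
    Summable fun k => ‖a k‖ ^ 2 := by
  refine (ENNReal.summable_toReal h).congr fun k => ?_
  simp

/-- Bilinearity. Finiteness of the norms is what makes the series summable; otherwise `tsum` takes
its default value and is not additive. -/
lemma conv_sub_conv {a a' b b' : (Fin d → ℤ) → ℂ} (ha : normTwoSq a ≠ ⊤) (hb : normTwoSq b ≠ ⊤)
    (ha' : normTwoSq a' ≠ ⊤) (hb' : normTwoSq b' ≠ ⊤) :
    conv a b - conv a' b' = conv (a - a') b + conv a' (b - b') := by
  funext k
  have h1 := summable_of_normTwoSq ha hb k
  have h2 := summable_of_normTwoSq ha' hb k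
  have h3 := summable_of_normTwoSq ha' hb' k
  simp only [Pi.sub_apply, Pi.add_apply, conv, sub_mul, mul_sub]
  rw [h1.tsum_sub h2, h2.tsum_sub h3]
  ring

lemma aemeasurable_conv {α : Type*} [MeasurableSpace α] {μ : Measure α}
    {a b : α → (Fin d → ℤ) → ℂ} (ha : ∀ k, AEMeasurable (fun t => a t k) μ)
    (hb : ∀ k, AEMeasurable (fun t => b t k) μ) (k : Fin d → ℤ) :
    AEMeasurable (fun t => conv (a t) (b t) k) μ :=
  AEMeasurable.tsum fun p => (ha p).mul (hb (k - p))

end Sequences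

/-! ### A Grönwall inequality for extended nonnegative functions. -/

section Gronwall

variable {T : ℝ}

lemma lintegral_Ioc_add {f : ℝ → ℝ≥0∞} {s t : ℝ} (h0 : 0 ≤ s) (hst : s ≤ t) :
    ∫⁻ r in Ioc 0 t, f r = (∫⁻ r in Ioc 0 s, f r) + ∫⁻ r in Ioc s t, f r := by
  rw [← Ioc_union_Ioc_eq_Ioc h0 hst, lintegral_union measurableSet_Ioc (Ioc_disjoint_Ioc_of_le le_rfl)]

/-- **Grönwall's inequality** for an integrable coefficient. -/
lemma gronwall_lintegral {g Φ : ℝ → ℝ≥0∞} {A M : ℝ≥0∞} {n : ℕ}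
    (hg : AEMeasurable g (volume.restrict (Ioc 0 T))) (hA : A ≠ ⊤) (hM : M ≠ ⊤)
    (hΦM : ∀ t ∈ Icc 0 T, Φ t ≤ M) (hG : ∫⁻ s in Ioc 0 T, g s ≤ n / 2)
    (hΦ : ∀ t ∈ Icc 0 T, Φ t ≤ A + ∫⁻ s in Ioc 0 t, g s * Φ s) :
    ∀ t ∈ Icc 0 T, Φ t ≤ 2 ^ n * A := by
  set G : ℝ → ℝ≥0∞ := fun t => ∫⁻ s in Ioc 0 t, g s with hGdef
  set Ψ : ℝ → ℝ≥0∞ := fun t => A + ∫⁻ s in Ioc 0 t, g s * Φ s with hΨdef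
  have hGfin : ∫⁻ s in Ioc 0 T, g s ≠ ⊤ :=
    ne_top_of_le_ne_top (ENNReal.div_ne_top (ENNReal.natCast_ne_top n) two_ne_zero) hG
  have hmono : ∀ {s t : ℝ}, s ≤ t → G s ≤ G t := fun h =>
    lintegral_mono_set (Ioc_subset_Ioc_right h)
  have hGt : ∀ t ∈ Icc 0 T, G t ≠ ⊤ := fun t ht => ne_top_of_le_ne_top hGfin (hmono ht.2)
  -- The crude bound `M` is used for finiteness, which allows half of Ψ to be absorbed below, and to
  -- start the induction; it does not enter the conclusion.
  have hΨt : ∀ t ∈ Icc 0 T, Ψ t ≠ ⊤ := by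
    intro t ht
    refine ENNReal.add_ne_top.2 ⟨hA, ne_top_of_le_ne_top (ENNReal.mul_ne_top (hGt t ht) hM) ?_⟩
    rw [hGdef]
    simp only
    rw [← lintegral_mul_const' _ _ hM]
    refine setLIntegral_mono' measurableSet_Ioc fun s hs => ?_
    gcongr
    exact hΦM s ⟨hs.1.le, hs.2.trans ht.2⟩
  have hcont : ContinuousOn (fun t => (G t).toReal) (Icc 0 T) := by
    have hae : ∀ᵐ s ∂(volume.restrict (Ioc 0 T)), g s < ⊤ := ae_lt_top' hg hGfin
    have hint : IntegrableOn (fun s => (g s).toReal) (Ioc 0 T) :=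
      integrable_toReal_of_lintegral_ne_top hg hGfin
    have h1 := intervalIntegral.continuousOn_primitive (μ := volume) (a := 0) (b := T)
      (f := fun s => (g s).toReal) (by rwa [integrableOn_Icc_iff_integrableOn_Ioc])
    refine h1.congr fun t ht => ?_
    have hsub : Ioc 0 t ⊆ Ioc 0 T := Ioc_subset_Ioc_right ht.2
    exact (integral_toReal (hg.mono_measure (Measure.restrict_mono_set _ hsub))
      (ae_restrict_of_ae_restrict_of_subset hsub hae)).symm
  -- Where the coefficient has integral at most 1/2, monotonicity of Ψ gives Ψ(t) ≤ Ψ(s) + Ψ(t)/2,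
  -- so Ψ at most doubles.
  have hstep : ∀ s t, 0 ≤ s → s ≤ t → t ≤ T → (G t).toReal ≤ (G s).toReal + 1 / 2 →
      Ψ t ≤ 2 * Ψ s := by
    intro s t hs hst ht hle
    have htT : t ∈ Icc 0 T := ⟨hs.trans hst, ht⟩
    have hsT : s ∈ Icc 0 T := ⟨hs, hst.trans ht⟩
    have hadd : G t = G s + ∫⁻ r in Ioc s t, g r := lintegral_Ioc_add hs hst
    have hIf : ∫⁻ r in Ioc s t, g r ≠ ⊤ := ne_top_of_le_ne_top (hGt t htT) (by rw [hadd]; exact le_add_self)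
    have hI : ∫⁻ r in Ioc s t, g r ≤ 1 / 2 := by
      rw [hadd, ENNReal.toReal_add (hGt s hsT) hIf] at hle
      have h1 : (∫⁻ r in Ioc s t, g r).toReal ≤ (1 / 2 : ℝ≥0∞).toReal := by
        simp only [ENNReal.toReal_div, ENNReal.toReal_one, ENNReal.toReal_ofNat]
        linarith
      exact (ENNReal.toReal_le_toReal hIf (by simp)).1 h1
    have h2 : Ψ t ≤ Ψ s + Ψ t * (1 / 2) := by
      calc Ψ t = Ψ s + ∫⁻ r in Ioc s t, g r * Φ r := by
            rw [hΨdef]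
            simp only
            rw [lintegral_Ioc_add hs hst, add_assoc]
        _ ≤ Ψ s + ∫⁻ r in Ioc s t, Ψ t * g r := by
            refine add_le_add le_rfl (setLIntegral_mono' measurableSet_Ioc fun r hr => ?_)
            rw [mul_comm]
            gcongr
            refine (hΦ r ⟨hs.trans hr.1.le, hr.2.trans ht⟩).trans ?_
            exact add_le_add le_rfl (lintegral_mono_set (Ioc_subset_Ioc_right hr.2))
        _ ≤ _ := by
            rw [lintegral_const_mul' _ _ (hΨt t htT)]
            gcongr
    have h3 := hΨt t htT
    have h4 := hΨt s hsT
    have h5 : (Ψ t).toReal ≤ (Ψ s).toReal + (Ψ t).toReal * (1 / 2) := by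
      have := ENNReal.toReal_mono (ENNReal.add_ne_top.2 ⟨h4, ENNReal.mul_ne_top h3 (by simp)⟩) h2
      rw [ENNReal.toReal_add h4 (ENNReal.mul_ne_top h3 (by simp)), ENNReal.toReal_mul] at this
      simpa using this
    rw [← ENNReal.toReal_le_toReal h3 (ENNReal.mul_ne_top (by simp) h4), ENNReal.toReal_mul]
    simp only [ENNReal.toReal_ofNat]
    linarith
  -- Induction on the number of half units accumulated by the continuous function `G`: the
  -- intermediate value theorem supplies a time where `G` equals m/2, and one doubling leads from
  -- there to `t`.
  have hind : ∀ m : ℕ, ∀ t ∈ Icc 0 T, (G t).toReal ≤ m / 2 → Ψ t ≤ 2 ^ m * A := by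
    intro m
    induction m with
    | zero =>
      intro t ht h
      have h0 : G t = 0 := by
        have : (G t).toReal = 0 := le_antisymm (by simpa using h) ENNReal.toReal_nonneg
        rcases (ENNReal.toReal_eq_zero_iff _).1 this with h1 | h1
        · exact h1
        · exact absurd h1 (hGt t ht)
      have h1 : ∫⁻ s in Ioc 0 t, g s * Φ s ≤ G t * M := by
        rw [hGdef]
        simp only
        rw [← lintegral_mul_const' _ _ hM]
        refine setLIntegral_mono' measurableSet_Ioc fun s hs => ?_
        gcongr
        exact hΦM s ⟨hs.1.le, hs.2.trans ht.2⟩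
      rw [h0, zero_mul] at h1
      rw [hΨdef]
      simp only [pow_zero, one_mul]
      calc A + ∫⁻ s in Ioc 0 t, g s * Φ s ≤ A + 0 := add_le_add le_rfl h1
        _ = A := add_zero A
    | succ m ih =>
      intro t ht h
      by_cases hm : (G t).toReal ≤ m / 2
      · refine (ih t ht hm).trans ?_
        rw [pow_succ, mul_assoc]
        gcongr
        calc A = 1 * A := (one_mul A).symm
          _ ≤ 2 * A := by gcongr; exact one_le_two
      · push Not at hm
        have h0 : (G 0).toReal = 0 := by simp [hGdef]
        obtain ⟨s, hs, hsm⟩ := intermediate_value_Icc ht.1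
          (hcont.mono (Icc_subset_Icc_right ht.2)) (show (m / 2 : ℝ) ∈ Icc (G 0).toReal (G t).toReal
            from ⟨by rw [h0]; positivity, hm.le⟩)
        simp only at hsm
        refine (hstep s t hs.1 hs.2 ht.2 (by rw [hsm]; push_cast at h; linarith)).trans ?_
        rw [pow_succ', mul_assoc]
        gcongr
        exact ih s ⟨hs.1, hs.2.trans ht.2⟩ hsm.le
  intro t ht
  refine (hΦ t ht).trans (hind n t ht ?_)
  have h1 : G t ≤ n / 2 := (hmono ht.2).trans hG
  have h2 := ENNReal.toReal_mono (ENNReal.div_ne_top (ENNReal.natCast_ne_top n) two_ne_zero) h1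
  simpa using h2

end Gronwall

/-! ### The energy identity for a single coefficient. -/

section Energy

variable {T : ℝ}

/-- Integration by parts for absolutely continuous functions: `f'` is merely integrable, so `f` is
differentiable only almost everywhere. -/
lemma sq_eq_of_eq_add_integral {f f' : ℝ → ℝ} (hf' : IntervalIntegrable f' volume 0 T)
    (h : ∀ t ∈ Icc 0 T, f t = f 0 + ∫ s in (0 : ℝ)..t, f' s) {t : ℝ} (ht : t ∈ Icc 0 T) :
    IntervalIntegrable (fun s => f' s * f s) volume 0 t ∧
    f t ^ 2 = f 0 ^ 2 + 2 * ∫ s in (0 : ℝ)..t, f' s * f s := by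
  have hi : IntervalIntegrable f' volume 0 t := hf'.mono_set (by
    rw [uIcc_of_le ht.1, uIcc_of_le (ht.1.trans ht.2)]
    exact Icc_subset_Icc_right ht.2)
  have hcont : ContinuousOn f (uIcc 0 t) := by
    rw [uIcc_of_le ht.1]
    exact (continuousOn_of_eq_add_intervalIntegral (ht.1.trans ht.2) hf' h).mono
      (Icc_subset_Icc_right ht.2)
  refine ⟨hi.mul_continuousOn hcont, ?_⟩
  have hF : AbsolutelyContinuousOnInterval (fun s => f 0 + ∫ r in (0 : ℝ)..s, f' r) 0 t := by
    have h1 := hi.absolutelyContinuousOnInterval_intervalIntegral (c := 0) left_mem_uIcc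
    have h2 : AbsolutelyContinuousOnInterval (fun _ : ℝ => f 0) 0 t :=
      (contDiff_const.contDiffOn (n := 1)).absolutelyContinuousOnInterval
    exact h2.add h1
  have h1 := hF.integral_deriv_mul_eq_sub hF
  have h2 : ∫ s in (0 : ℝ)..t, (deriv (fun s => f 0 + ∫ r in (0 : ℝ)..s, f' r) s *
      (f 0 + ∫ r in (0 : ℝ)..s, f' r) + (f 0 + ∫ r in (0 : ℝ)..s, f' r) *
      deriv (fun s => f 0 + ∫ r in (0 : ℝ)..s, f' r) s) = ∫ s in (0 : ℝ)..t, 2 * (f' s * f s) := by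
    refine intervalIntegral.integral_congr_ae ?_
    filter_upwards [hi.ae_hasDerivAt_integral] with s hs hs'
    have h3 := (hs (uIoc_subset_uIcc hs') 0 left_mem_uIcc).const_add (f 0)
    rw [uIoc_of_le ht.1] at hs'
    rw [h3.deriv, ← h s ⟨hs'.1.le, hs'.2.trans ht.2⟩]
    ring
  rw [h2, intervalIntegral.integral_const_mul, ← h t ht] at h1
  simp only [intervalIntegral.integral_same, add_zero] at h1
  linarith

lemma norm_sq_eq_of_eq_add_integral {f f' : ℝ → ℂ} (hf' : IntervalIntegrable f' volume 0 T)
    (h : ∀ t ∈ Icc 0 T, f t = f 0 + ∫ s in (0 : ℝ)..t, f' s) {t : ℝ} (ht : t ∈ Icc 0 T) :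
    IntervalIntegrable (fun s => (f' s * (starRingEnd ℂ) (f s)).re) volume 0 t ∧
    ‖f t‖ ^ 2 = ‖f 0‖ ^ 2 + 2 * ∫ s in (0 : ℝ)..t, (f' s * (starRingEnd ℂ) (f s)).re := by
  have hit : ∀ t ∈ Icc 0 T, IntervalIntegrable f' volume 0 t := fun t ht => hf'.mono_set (by
    rw [uIcc_of_le ht.1, uIcc_of_le (ht.1.trans ht.2)]
    exact Icc_subset_Icc_right ht.2)
  have hre : ∀ t ∈ Icc 0 T, (f t).re = (f 0).re + ∫ s in (0 : ℝ)..t, (f' s).re := fun t ht => by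
    rw [h t ht, Complex.add_re]
    congr 1
    exact (Complex.reCLM.intervalIntegral_comp_comm (hit t ht)).symm
  have him : ∀ t ∈ Icc 0 T, (f t).im = (f 0).im + ∫ s in (0 : ℝ)..t, (f' s).im := fun t ht => by
    rw [h t ht, Complex.add_im]
    congr 1
    exact (Complex.imCLM.intervalIntegral_comp_comm (hit t ht)).symm
  obtain ⟨i1, e1⟩ := sq_eq_of_eq_add_integral (f := fun t => (f t).re) (f' := fun t => (f' t).re)
    ⟨hf'.1.re, hf'.2.re⟩ hre ht
  obtain ⟨i2, e2⟩ := sq_eq_of_eq_add_integral (f := fun t => (f t).im) (f' := fun t => (f' t).im)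
    ⟨hf'.1.im, hf'.2.im⟩ him ht
  have heq : ∀ s, (f' s * (starRingEnd ℂ) (f s)).re =
      (f' s).re * (f s).re + (f' s).im * (f s).im := fun s => by simp
  simp only [heq]
  refine ⟨i1.add i2, ?_⟩
  rw [intervalIntegral.integral_add i1 i2, ← Complex.normSq_eq_norm_sq, ← Complex.normSq_eq_norm_sq,
    Complex.normSq_apply, Complex.normSq_apply]
  linarith

end Energy

/-! ### L² stability of the Navier-Stokes equations in Fourier variables. -/

section Stability

variable {T : ℝ}

/-- The nonlinearity `div (v ⊗ v)` on the level of Fourier coefficients. -/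
def nonlinearity (v : Fin 2 → (Fin 2 → ℤ) → ℂ) (i : Fin 2) (k : Fin 2 → ℤ) : ℂ :=
  ∑ j, Complex.I * Real.pi * k j * conv (v j) (v i) k

/-- `v` is a family of Fourier coefficients which solves the Navier-Stokes equations, with the
nonlinearity restricted to the modes in `S`. -/
structure IsFourierSolution (T : ℝ) (S : Set (Fin 2 → ℤ)) (v : ℝ → Fin 2 → (Fin 2 → ℤ) → ℂ) :
    Prop where
  bound : ∃ M : ℝ≥0∞, M ≠ ⊤ ∧ ∀ t ∈ Icc 0 T, ∀ i, normTwoSq (v t i) ≤ M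
  equation : ∃ (v' : ℝ → Fin 2 → (Fin 2 → ℤ) → ℂ) (q : ℝ → (Fin 2 → ℤ) → ℂ),
    (∀ i k, IntervalIntegrable (fun t => v' t i k) volume 0 T) ∧
    (∀ i k, ∀ t ∈ Icc 0 T, v t i k = v 0 i k + ∫ s in (0 : ℝ)..t, v' s i k) ∧
    ∀ᵐ t ∂(volume.restrict (Ioc 0 T)), ∀ k, ∑ i, (k i : ℂ) * v t i k = 0 ∧
      ∀ i, v' t i k = -((Real.pi ^ 2 * ∑ j, (k j : ℝ) ^ 2 : ℝ) : ℂ) * v t i k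
        - S.indicator (nonlinearity (v t) i) k - Complex.I * Real.pi * k i * q t k

/-- Young's inequality, with the coefficient of ‖b‖² tuned to be exactly the dissipation available
at frequency `x`. -/
lemma re_mul_conj_le (x : ℝ) (a b : ℂ) :
    (-(Complex.I * x * a) * (starRingEnd ℂ) b).re ≤ x ^ 2 * ‖b‖ ^ 2 + 1 / 4 * ‖a‖ ^ 2 := by
  have h : (-(Complex.I * x * a) * (starRingEnd ℂ) b).re ≤ |x| * ‖a‖ * ‖b‖ := by
    refine (Complex.re_le_norm _).trans (le_of_eq ?_)
    simp
  have h2 : x ^ 2 = |x| ^ 2 := (sq_abs x).symm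
  rw [h2]
  nlinarith [sq_nonneg (|x| * ‖b‖ - 1 / 2 * ‖a‖)]

/-- The pressure is orthogonal to a divergence free vector, and the derivative on `D` is absorbed by
the dissipation, so only undifferentiated products survive. -/
lemma re_sum_mul_conj_le {k : Fin 2 → ℤ} {w w' : Fin 2 → ℂ} {D : Fin 2 → Fin 2 → ℂ} {q : ℂ}
    (hdiv : ∑ i, (k i : ℂ) * w i = 0)
    (h : ∀ i, w' i = -((Real.pi ^ 2 * ∑ j, (k j : ℝ) ^ 2 : ℝ) : ℂ) * w i
      - (∑ j, Complex.I * Real.pi * k j * D j i) - Complex.I * Real.pi * k i * q) :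
    2 * ∑ i, (w' i * (starRingEnd ℂ) (w i)).re ≤ 1 / 2 * ∑ i, ∑ j, ‖D j i‖ ^ 2 := by
  have hp : ∑ i, Complex.I * Real.pi * k i * q * (starRingEnd ℂ) (w i) = 0 := by
    have h1 := congrArg (starRingEnd ℂ) hdiv
    simp only [map_sum, map_mul, map_zero, map_intCast] at h1
    have h2 : ∑ i, Complex.I * Real.pi * k i * q * (starRingEnd ℂ) (w i) =
        Complex.I * Real.pi * q * ∑ i, (k i : ℂ) * (starRingEnd ℂ) (w i) := by
      rw [Finset.mul_sum]
      exact Finset.sum_congr rfl fun i _ => by ring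
    rw [h2, h1, mul_zero]
  have he : ∑ i, w' i * (starRingEnd ℂ) (w i) =
      ∑ i, (-((Real.pi ^ 2 * ∑ j, (k j : ℝ) ^ 2 * ‖w i‖ ^ 2 : ℝ) : ℂ)
        + ∑ j, -(Complex.I * ((Real.pi * k j : ℝ) : ℂ) * D j i) * (starRingEnd ℂ) (w i)) := by
    rw [← sub_eq_zero, ← Finset.sum_sub_distrib]
    rw [← neg_eq_zero, ← hp, ← Finset.sum_neg_distrib]
    refine Finset.sum_congr rfl fun i _ => ?_
    rw [h i]
    have hn : ((‖w i‖ ^ 2 : ℝ) : ℂ) = w i * (starRingEnd ℂ) (w i) := by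
      rw [Complex.mul_conj, Complex.normSq_eq_norm_sq]
    simp only [Fin.sum_univ_two, ← add_mul]
    push_cast at hn ⊢
    rw [hn]
    ring
  have he2 : ∑ i, (w' i * (starRingEnd ℂ) (w i)).re =
      ∑ i, ∑ j, (-(Real.pi * k j) ^ 2 * ‖w i‖ ^ 2
        + (-(Complex.I * ((Real.pi * k j : ℝ) : ℂ) * D j i) * (starRingEnd ℂ) (w i)).re) := by
    rw [← Complex.re_sum, he, Complex.re_sum]
    refine Finset.sum_congr rfl fun i _ => ?_
    rw [Complex.add_re, Complex.re_sum, Complex.neg_re, Complex.ofReal_re, Finset.sum_add_distrib,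
      Finset.mul_sum, ← Finset.sum_neg_distrib]
    congr 1
    exact Finset.sum_congr rfl fun j _ => by ring
  rw [he2, Finset.mul_sum, Finset.mul_sum]
  refine Finset.sum_le_sum fun i _ => ?_
  rw [Finset.mul_sum, Finset.mul_sum]
  refine Finset.sum_le_sum fun j _ => ?_
  have := re_mul_conj_le (Real.pi * k j) (D j i) (w i)
  linarith

/-- No integrability is needed: the Bochner integral of a nonintegrable function is zero by
convention. -/
lemma ofReal_integral_le_lintegral {α : Type*} [MeasurableSpace α] {μ : Measure α} {f : α → ℝ} :
    ENNReal.ofReal (∫ x, f x ∂μ) ≤ ∫⁻ x, ENNReal.ofReal (f x) ∂μ := by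
  by_cases hf : Integrable f μ
  · have h1 : ∫ x, f x ∂μ ≤ ∫ x, max (f x) 0 ∂μ :=
      integral_mono hf hf.pos_part fun x => le_max_left _ _
    refine (ENNReal.ofReal_le_ofReal h1).trans (le_of_eq ?_)
    rw [ofReal_integral_eq_lintegral_ofReal hf.pos_part (ae_of_all _ fun x => le_max_right _ _)]
    exact lintegral_congr fun x => by simp [ENNReal.ofReal_max]
  · rw [integral_undef hf]
    simp

lemma IsFourierSolution.continuousOn {S : Set (Fin 2 → ℤ)} {v : ℝ → Fin 2 → (Fin 2 → ℤ) → ℂ}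
    (hT : 0 ≤ T) (h : IsFourierSolution T S v) (i : Fin 2) (k : Fin 2 → ℤ) :
    ContinuousOn (fun t => v t i k) (Icc 0 T) := by
  obtain ⟨v', q, hi, he, -⟩ := h.equation
  exact continuousOn_of_eq_add_intervalIntegral hT (hi i k) (he i k)

lemma IsFourierSolution.aemeasurable {S : Set (Fin 2 → ℤ)} {v : ℝ → Fin 2 → (Fin 2 → ℤ) → ℂ}
    (hT : 0 ≤ T) (h : IsFourierSolution T S v) (i : Fin 2) (k : Fin 2 → ℤ) :
    AEMeasurable (fun t => v t i k) (volume.restrict (Ioc 0 T)) :=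
  ((h.continuousOn hT i k).mono Ioc_subset_Icc_self).aemeasurable measurableSet_Ioc

lemma enorm_sub_sq_le (a b : ℂ) : ‖a - b‖ₑ ^ 2 ≤ 2 * ‖a‖ₑ ^ 2 + 2 * ‖b‖ₑ ^ 2 := by
  refine (pow_le_pow_left' enorm_sub_le 2).trans ?_
  have := ENNReal.rpow_add_le_mul_rpow_add_rpow ‖a‖ₑ ‖b‖ₑ one_le_two
  norm_num at this
  rwa [mul_add] at this

/-- The energy inequality for a single Fourier coefficient of the difference of two solutions. -/
lemma IsFourierSolution.energy_coeff {S₁ S₂ : Set (Fin 2 → ℤ)}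
    {v₁ v₂ : ℝ → Fin 2 → (Fin 2 → ℤ) → ℂ}
    (h₁ : IsFourierSolution T S₁ v₁) (h₂ : IsFourierSolution T S₂ v₂) (hS : S₁ ⊆ S₂)
    {t : ℝ} (ht : t ∈ Icc 0 T) (k : Fin 2 → ℤ) :
    ∑ i, ‖v₁ t i k - v₂ t i k‖ₑ ^ 2 ≤ ∑ i, ‖v₁ 0 i k - v₂ 0 i k‖ₑ ^ 2
      + ∫⁻ s in Ioc 0 t, ∑ i, ∑ j,
        (‖conv (v₁ s j) (v₁ s i) k - conv (v₂ s j) (v₂ s i) k‖ₑ ^ 2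
          + S₁ᶜ.indicator (fun k => ‖conv (v₁ s j) (v₁ s i) k‖ₑ ^ 2) k) := by
  obtain ⟨v₁', q₁, hi₁, he₁, hq₁⟩ := h₁.equation
  obtain ⟨v₂', q₂, hi₂, he₂, hq₂⟩ := h₂.equation
  set w : ℝ → Fin 2 → ℂ := fun t i => v₁ t i k - v₂ t i k with hw
  set w' : ℝ → Fin 2 → ℂ := fun t i => v₁' t i k - v₂' t i k with hw'
  have hsub : ∀ t ∈ Icc 0 T, ∀ {f : ℝ → ℂ}, IntervalIntegrable f volume 0 T →
      IntervalIntegrable f volume 0 t := fun t ht f hf => hf.mono_set (by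
    rw [uIcc_of_le ht.1, uIcc_of_le (ht.1.trans ht.2)]
    exact Icc_subset_Icc_right ht.2)
  have hwi : ∀ i, ∀ t ∈ Icc 0 T, w t i = w 0 i + ∫ s in (0 : ℝ)..t, w' s i := fun i t ht => by
    simp only [hw, hw']
    rw [intervalIntegral.integral_sub (hsub t ht (hi₁ i k)) (hsub t ht (hi₂ i k)), he₁ i k t ht,
      he₂ i k t ht]
    ring
  have hen := fun i => norm_sq_eq_of_eq_add_integral ((hi₁ i k).sub (hi₂ i k)) (hwi i) ht
  have hsum : ∑ i, ‖w t i‖ ^ 2 = ∑ i, ‖w 0 i‖ ^ 2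
      + ∫ s in Ioc 0 t, 2 * ∑ i, (w' s i * (starRingEnd ℂ) (w s i)).re := by
    rw [Finset.sum_congr rfl fun i _ => (hen i).2, Finset.sum_add_distrib, ← Finset.mul_sum,
      ← intervalIntegral.integral_finsetSum fun i _ => (hen i).1,
      ← intervalIntegral.integral_const_mul, intervalIntegral.integral_of_le ht.1]
  have hof : ∀ x : Fin 2 → ℂ, ∑ i, ‖x i‖ₑ ^ 2 = ENNReal.ofReal (∑ i, ‖x i‖ ^ 2) := fun x => by
    rw [ENNReal.ofReal_sum_of_nonneg fun i _ => sq_nonneg _]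
    exact Finset.sum_congr rfl fun i _ => by rw [ENNReal.ofReal_pow (norm_nonneg _), ofReal_norm]
  have hgoal := congrArg ENNReal.ofReal hsum
  change ∑ i, ‖w t i‖ₑ ^ 2 ≤ ∑ i, ‖w 0 i‖ₑ ^ 2 + _
  rw [hof (w t), hof (w 0), hgoal]
  refine ENNReal.ofReal_add_le.trans (add_le_add le_rfl ?_)
  refine ofReal_integral_le_lintegral.trans (lintegral_mono_ae ?_)
  have hTt : Ioc 0 t ⊆ Ioc 0 T := Ioc_subset_Ioc_right ht.2
  filter_upwards [ae_restrict_of_ae_restrict_of_subset hTt hq₁,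
    ae_restrict_of_ae_restrict_of_subset hTt hq₂] with s hs₁ hs₂
  obtain ⟨d₁, e₁⟩ := hs₁ k
  obtain ⟨d₂, e₂⟩ := hs₂ k
  -- The three cases below: on `S₁` this is a difference of products, outside `S₂` it is zero, and
  -- in between it is a product for `v₂` alone, rewritten as a difference minus a product for `v₁`.
  -- Hence the truncation error involves `v₁` only.
  set D : Fin 2 → Fin 2 → ℂ := fun j i => S₁.indicator (conv (v₁ s j) (v₁ s i)) k
    - S₂.indicator (conv (v₂ s j) (v₂ s i)) k with hD
  have hdiv : ∑ i, (k i : ℂ) * w s i = 0 := by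
    simp only [hw, mul_sub, Finset.sum_sub_distrib, d₁, d₂, sub_zero]
  have hind : ∀ (S : Set (Fin 2 → ℤ)) (v : Fin 2 → (Fin 2 → ℤ) → ℂ) i,
      S.indicator (nonlinearity v i) k =
        ∑ j, Complex.I * Real.pi * k j * S.indicator (conv (v j) (v i)) k := fun S v i => by
    by_cases hk : k ∈ S <;> simp [hk, nonlinearity]
  have hweq : ∀ i, w' s i = -((Real.pi ^ 2 * ∑ j, (k j : ℝ) ^ 2 : ℝ) : ℂ) * w s i
      - (∑ j, Complex.I * Real.pi * k j * D j i)
      - Complex.I * Real.pi * k i * (q₁ s k - q₂ s k) := fun i => by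
    simp only [hw, hw', hD, e₁ i, e₂ i, hind, mul_sub, Finset.sum_sub_distrib]
    ring
  refine (ENNReal.ofReal_le_ofReal (re_sum_mul_conj_le hdiv hweq)).trans ?_
  rw [ENNReal.ofReal_mul (by norm_num), ENNReal.ofReal_sum_of_nonneg
    (fun i _ => Finset.sum_nonneg fun j _ => sq_nonneg _), Finset.mul_sum]
  refine Finset.sum_le_sum fun i _ => ?_
  rw [ENNReal.ofReal_sum_of_nonneg fun j _ => sq_nonneg _, Finset.mul_sum]
  refine Finset.sum_le_sum fun j _ => ?_
  rw [ENNReal.ofReal_pow (norm_nonneg _), ofReal_norm]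
  have h2 : ∀ x : ℝ≥0∞, ENNReal.ofReal (1 / 2) * (2 * x) = x := fun x => by
    rw [← mul_assoc, ← ENNReal.ofReal_ofNat 2, ← ENNReal.ofReal_mul (by norm_num)]
    norm_num
  have h3 : ∀ x : ℝ≥0∞, ENNReal.ofReal (1 / 2) * x ≤ x := fun x => by
    refine mul_le_of_le_one_left' ?_
    rw [← ENNReal.ofReal_one]
    exact ENNReal.ofReal_le_ofReal (by norm_num)
  simp only [hD]
  by_cases hk₁ : k ∈ S₁
  · simp only [hk₁, hS hk₁, indicator_of_mem, mem_compl_iff, not_true_eq_false, not_false_eq_true,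
      indicator_of_notMem, add_zero]
    exact h3 _
  · by_cases hk₂ : k ∈ S₂
    · simp only [hk₁, hk₂, indicator_of_mem, mem_compl_iff, not_false_eq_true,
        indicator_of_notMem, zero_sub]
      have h4 := enorm_sub_sq_le (conv (v₁ s j) (v₁ s i) k - conv (v₂ s j) (v₂ s i) k)
        (conv (v₁ s j) (v₁ s i) k)
      rw [sub_sub_cancel_left] at h4
      calc _ ≤ ENNReal.ofReal (1 / 2) * _ := mul_le_mul_right h4 _
        _ = _ := by rw [mul_add, h2, h2]
    · simp [hk₁, hk₂]

/-- Each product difference is linear in `v₁ - v₂`. Young's inequality puts that difference in ℓ²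
and the other factor in ℓ¹, which yields the Grönwall coefficient. -/
lemma sum_normTwoSq_conv_sub_le {v₁ v₂ : Fin 2 → (Fin 2 → ℤ) → ℂ}
    (h₁ : ∀ i, normTwoSq (v₁ i) ≠ ⊤) (h₂ : ∀ i, normTwoSq (v₂ i) ≠ ⊤) :
    ∑ i, ∑ j, normTwoSq (conv (v₁ j) (v₁ i) - conv (v₂ j) (v₂ i)) ≤
      2 * (∑ i, normOne (v₁ i) ^ 2 + ∑ i, normOne (v₂ i) ^ 2) *
        ∑ i, normTwoSq (v₁ i - v₂ i) := by
  have h : ∀ i j, normTwoSq (conv (v₁ j) (v₁ i) - conv (v₂ j) (v₂ i)) ≤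
      2 * (normOne (v₁ i) ^ 2 * normTwoSq (v₁ j - v₂ j))
        + 2 * (normOne (v₂ j) ^ 2 * normTwoSq (v₁ i - v₂ i)) := fun i j => by
    rw [conv_sub_conv (h₁ j) (h₁ i) (h₂ j) (h₂ i), conv_comm _ (v₁ i)]
    refine (normTwoSq_add_le _ _).trans ?_
    gcongr <;> exact normTwoSq_conv_le _ _
  refine (Finset.sum_le_sum fun i _ => Finset.sum_le_sum fun j _ => h i j).trans (le_of_eq ?_)
  simp only [Fin.sum_univ_two]
  ring

/-- Stability of solutions under perturbations of the initial value and of the set of modes. -/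
theorem IsFourierSolution.stability {S₁ S₂ : Set (Fin 2 → ℤ)}
    {v₁ v₂ : ℝ → Fin 2 → (Fin 2 → ℤ) → ℂ} (hT : 0 ≤ T)
    (h₁ : IsFourierSolution T S₁ v₁) (h₂ : IsFourierSolution T S₂ v₂) (hS : S₁ ⊆ S₂) {n : ℕ}
    (hG : ∫⁻ s in Ioc 0 T, 2 * (∑ i, normOne (v₁ s i) ^ 2 + ∑ i, normOne (v₂ s i) ^ 2) ≤ n / 2)
    {A : ℝ≥0∞} (hA : A ≠ ⊤)
    (hA' : ∑ i, normTwoSq (v₁ 0 i - v₂ 0 i) + ∫⁻ s in Ioc 0 T, ∑ i, ∑ j,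
      ∑' k, S₁ᶜ.indicator (fun k => ‖conv (v₁ s j) (v₁ s i) k‖ₑ ^ 2) k ≤ A) :
    ∀ t ∈ Icc 0 T, ∑ i, normTwoSq (v₁ t i - v₂ t i) ≤ 2 ^ n * A := by
  obtain ⟨M₁, hM₁, hb₁⟩ := h₁.bound
  obtain ⟨M₂, hM₂, hb₂⟩ := h₂.bound
  have hm₁ := h₁.aemeasurable hT
  have hm₂ := h₂.aemeasurable hT
  have hc₁ : ∀ i j k, AEMeasurable (fun s => conv (v₁ s j) (v₁ s i) k)
      (volume.restrict (Ioc 0 T)) := fun i j k => aemeasurable_conv (hm₁ j) (hm₁ i) k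
  have hc₂ : ∀ i j k, AEMeasurable (fun s => conv (v₂ s j) (v₂ s i) k)
      (volume.restrict (Ioc 0 T)) := fun i j k => aemeasurable_conv (hm₂ j) (hm₂ i) k
  have hcm : ∀ i j k, AEMeasurable (fun s => S₁ᶜ.indicator
      (fun k => ‖conv (v₁ s j) (v₁ s i) k‖ₑ ^ 2) k) (volume.restrict (Ioc 0 T)) := by
    intro i j k
    by_cases hk : k ∈ S₁ᶜ
    · simpa only [hk, indicator_of_mem] using (hc₁ i j k).enorm.pow_const 2
    · simp only [hk, not_false_eq_true, indicator_of_notMem]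
      exact aemeasurable_const
  have hg : AEMeasurable (fun s => 2 * (∑ i, normOne (v₁ s i) ^ 2 + ∑ i, normOne (v₂ s i) ^ 2))
      (volume.restrict (Ioc 0 T)) := by
    refine AEMeasurable.const_mul (AEMeasurable.add ?_ ?_) 2
    · exact Finset.aemeasurable_fun_sum _ fun i _ =>
        (AEMeasurable.tsum fun k => (hm₁ i k).enorm).pow_const 2
    · exact Finset.aemeasurable_fun_sum _ fun i _ =>
        (AEMeasurable.tsum fun k => (hm₂ i k).enorm).pow_const 2
  refine gronwall_lintegral (M := ∑ i : Fin 2, (2 * M₁ + 2 * M₂)) hg hA ?_ ?_ hG ?_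
  · simp [ENNReal.mul_eq_top, hM₁, hM₂]
  · intro t ht
    refine Finset.sum_le_sum fun i _ => (normTwoSq_sub_le _ _).trans ?_
    gcongr
    · exact hb₁ t ht i
    · exact hb₂ t ht i
  · intro t ht
    have hTt : Ioc 0 t ⊆ Ioc 0 T := Ioc_subset_Ioc_right ht.2
    have hle := Measure.restrict_mono_set volume hTt
    have hmi : ∀ k, AEMeasurable (fun s => ∑ i, ∑ j,
        (‖conv (v₁ s j) (v₁ s i) k - conv (v₂ s j) (v₂ s i) k‖ₑ ^ 2
          + S₁ᶜ.indicator (fun k => ‖conv (v₁ s j) (v₁ s i) k‖ₑ ^ 2) k))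
        (volume.restrict (Ioc 0 t)) := fun k =>
      Finset.aemeasurable_fun_sum _ fun i _ => Finset.aemeasurable_fun_sum _ fun j _ =>
        ((((hc₁ i j k).sub (hc₂ i j k)).enorm.pow_const 2).add (hcm i j k)).mono_measure hle
    -- The inequalities for single modes are summed over all frequencies by Tonelli, so the energy
    -- identity is never needed for the full L² curve.
    calc ∑ i, normTwoSq (v₁ t i - v₂ t i) = ∑' k, ∑ i, ‖v₁ t i k - v₂ t i k‖ₑ ^ 2 :=
          (Summable.tsum_finsetSum fun i _ => ENNReal.summable).symm
      _ ≤ ∑' k, (∑ i, ‖v₁ 0 i k - v₂ 0 i k‖ₑ ^ 2 + ∫⁻ s in Ioc 0 t, ∑ i, ∑ j,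
            (‖conv (v₁ s j) (v₁ s i) k - conv (v₂ s j) (v₂ s i) k‖ₑ ^ 2
            + S₁ᶜ.indicator (fun k => ‖conv (v₁ s j) (v₁ s i) k‖ₑ ^ 2) k)) :=
          ENNReal.tsum_le_tsum fun k => h₁.energy_coeff h₂ hS ht k
      _ = ∑ i, normTwoSq (v₁ 0 i - v₂ 0 i) + ∫⁻ s in Ioc 0 t,
            ((∑ i, ∑ j, ∑' k, S₁ᶜ.indicator (fun k => ‖conv (v₁ s j) (v₁ s i) k‖ₑ ^ 2) k)
            + ∑ i, ∑ j, normTwoSq (conv (v₁ s j) (v₁ s i) - conv (v₂ s j) (v₂ s i))) := by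
          rw [ENNReal.tsum_add, ← lintegral_tsum hmi,
            Summable.tsum_finsetSum fun i _ => ENNReal.summable]
          congr 1
          refine lintegral_congr fun s => ?_
          rw [Summable.tsum_finsetSum fun i _ => ENNReal.summable, ← Finset.sum_add_distrib]
          refine Finset.sum_congr rfl fun i _ => ?_
          rw [Summable.tsum_finsetSum fun i _ => ENNReal.summable, ← Finset.sum_add_distrib]
          refine Finset.sum_congr rfl fun j _ => ?_
          rw [ENNReal.tsum_add, add_comm]
          rfl
      _ = (∑ i, normTwoSq (v₁ 0 i - v₂ 0 i) + ∫⁻ s in Ioc 0 t,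
            (∑ i, ∑ j, ∑' k, S₁ᶜ.indicator (fun k => ‖conv (v₁ s j) (v₁ s i) k‖ₑ ^ 2) k))
            + ∫⁻ s in Ioc 0 t,
            ∑ i, ∑ j, normTwoSq (conv (v₁ s j) (v₁ s i) - conv (v₂ s j) (v₂ s i)) := by
          rw [lintegral_add_left', add_assoc]
          exact Finset.aemeasurable_fun_sum _ fun i _ => Finset.aemeasurable_fun_sum _ fun j _ =>
            (AEMeasurable.tsum fun k => hcm i j k).mono_measure hle
      _ ≤ _ := by
          refine add_le_add ?_ ?_
          · exact (add_le_add le_rfl (lintegral_mono_set hTt)).trans hA'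
          · refine setLIntegral_mono' measurableSet_Ioc fun s hs => ?_
            have hs' : s ∈ Icc 0 T := ⟨hs.1.le, hs.2.trans ht.2⟩
            exact sum_normTwoSq_conv_sub_le (fun i => ne_top_of_le_ne_top hM₁ (hb₁ s hs' i))
              (fun i => ne_top_of_le_ne_top hM₂ (hb₂ s hs' i))

end Stability

/-! ### Biot-Savart law and the truncated vorticity equation. -/

section Vorticity

/-- The velocity with mean `m` and vorticity `ζ` (the Biot-Savart law). -/
def velocity (m : Fin 2 → ℂ) (ζ : (Fin 2 → ℤ) → ℂ) (i : Fin 2) (k : Fin 2 → ℤ) : ℂ :=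
  if k = 0 then m i else
    ![Complex.I * k 1, -(Complex.I * k 0)] i / (Real.pi * ((k 0 : ℂ) ^ 2 + (k 1 : ℂ) ^ 2)) * ζ k

/-- The transport term `v · ∇ζ` on the level of Fourier coefficients supported in `S`. -/
def advection (S : Finset (Fin 2 → ℤ)) (v : Fin 2 → (Fin 2 → ℤ) → ℂ) (ζ : (Fin 2 → ℤ) → ℂ)
    (k : Fin 2 → ℤ) : ℂ :=
  ∑ p ∈ S, Complex.I * Real.pi * (∑ j, ((k - p) j : ℂ) * v j p) * ζ (k - p)

variable {S : Finset (Fin 2 → ℤ)} {m : Fin 2 → ℂ} {ζ : (Fin 2 → ℤ) → ℂ} {k : Fin 2 → ℤ}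

lemma real_sq_add_sq_pos (hk : k ≠ 0) : 0 < (k 0 : ℝ) ^ 2 + (k 1 : ℝ) ^ 2 := by
  by_contra h
  push Not at h
  have h0 : (k 0 : ℝ) = 0 := by nlinarith [sq_nonneg (k 0 : ℝ), sq_nonneg (k 1 : ℝ)]
  have h1 : (k 1 : ℝ) = 0 := by nlinarith [sq_nonneg (k 0 : ℝ), sq_nonneg (k 1 : ℝ)]
  refine hk (funext fun i => ?_)
  fin_cases i
  · exact_mod_cast h0
  · exact_mod_cast h1

lemma complex_sq_add_sq_ne_zero (hk : k ≠ 0) : (k 0 : ℂ) ^ 2 + (k 1 : ℂ) ^ 2 ≠ 0 := by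
  have h := (real_sq_add_sq_pos hk).ne'
  exact_mod_cast h

lemma pi_ne_zero' : (Real.pi : ℂ) ≠ 0 := by exact_mod_cast Real.pi_ne_zero

lemma sum_mul_velocity (m : Fin 2 → ℂ) (ζ : (Fin 2 → ℤ) → ℂ) (k : Fin 2 → ℤ) :
    ∑ i, (k i : ℂ) * velocity m ζ i k = 0 := by
  by_cases hk : k = 0
  · simp [hk]
  · simp only [velocity, hk, if_false, Fin.sum_univ_two, Matrix.cons_val_zero, Matrix.cons_val_one]
    ring

lemma velocity_neg (hm : ∀ i, (starRingEnd ℂ) (m i) = m i)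
    (hζ : ∀ k, ζ (-k) = (starRingEnd ℂ) (ζ k)) (i : Fin 2) (k : Fin 2 → ℤ) :
    velocity m ζ i (-k) = (starRingEnd ℂ) (velocity m ζ i k) := by
  by_cases hk : k = 0
  · simp [hk, velocity, hm]
  · simp only [velocity, hk, neg_eq_zero, if_false, map_mul, map_div₀, ← hζ k]
    fin_cases i <;> simp

lemma curl_velocity (hk : k ≠ 0) :
    Complex.I * Real.pi * (k 0 * velocity m ζ 1 k - k 1 * velocity m ζ 0 k) = ζ k := by
  simp only [velocity, hk, if_false, Matrix.cons_val_zero, Matrix.cons_val_one]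
  have h1 := complex_sq_add_sq_ne_zero hk
  have h2 := pi_ne_zero'
  field_simp
  linear_combination (-(ζ k * ((k 0 : ℂ) ^ 2 + (k 1 : ℂ) ^ 2))) * Complex.I_sq

/-- The velocity mode is ζ(k) times a vector orthogonal to `k` of length 1/(π|k|). Thus bounds on
the vorticity are bounds on the velocity with one more derivative. -/
lemma norm_sq_velocity (hk : k ≠ 0) :
    Real.pi ^ 2 * (∑ j, (k j : ℝ) ^ 2) * ∑ i, ‖velocity m ζ i k‖ ^ 2 = ‖ζ k‖ ^ 2 := by
  have h1 := real_sq_add_sq_pos hk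
  have h2 := Real.pi_ne_zero
  have h3 : ‖(k 0 : ℂ) ^ 2 + (k 1 : ℂ) ^ 2‖ = (k 0 : ℝ) ^ 2 + (k 1 : ℝ) ^ 2 := by
    have : (k 0 : ℂ) ^ 2 + (k 1 : ℂ) ^ 2 = (((k 0 : ℝ) ^ 2 + (k 1 : ℝ) ^ 2 : ℝ) : ℂ) := by
      push_cast
      rfl
    rw [this, Complex.norm_real, Real.norm_of_nonneg h1.le]
  simp only [velocity, hk, if_false, Fin.sum_univ_two, Matrix.cons_val_zero, Matrix.cons_val_one,
    norm_mul, norm_div, norm_neg, Complex.norm_I, one_mul, h3, Complex.norm_real,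
    Complex.norm_intCast, Real.norm_eq_abs, mul_pow, div_pow, sq_abs]
  field_simp
  ring

lemma velocity_of_notMem (h0 : 0 ∈ S) (hζ : ∀ k ∉ S, ζ k = 0) (i : Fin 2) (hk : k ∉ S) :
    velocity m ζ i k = 0 := by
  have h : k ≠ 0 := fun h => hk (h ▸ h0)
  simp [velocity, h, hζ k hk]

/-- In the plane, a vector orthogonal to a nonzero `k` is determined by its cross product with `k`;
the zero mode is carried separately by the mean. -/
lemma velocity_curl {a : Fin 2 → (Fin 2 → ℤ) → ℂ} (hm : ∀ i, m i = a i 0)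
    (hdiv : ∑ i, (k i : ℂ) * a i k = 0)
    (hζ : ζ k = Complex.I * Real.pi * (k 0 * a 1 k - k 1 * a 0 k)) (i : Fin 2) :
    velocity m ζ i k = a i k := by
  by_cases hk : k = 0
  · simp [velocity, hk, hm]
  · have h1 := complex_sq_add_sq_ne_zero hk
    have h2 := pi_ne_zero'
    rw [Fin.sum_univ_two] at hdiv
    simp only [velocity, hk, if_false, hζ]
    fin_cases i
    · simp only [Fin.zero_eta, Matrix.cons_val_zero]
      field_simp
      linear_combination (k 1 * (k 0 * a 1 k - k 1 * a 0 k)) * Complex.I_sq - k 0 * hdiv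
    · simp only [Fin.mk_one, Matrix.cons_val_one, Matrix.cons_val_fin_one]
      field_simp
      linear_combination (-(k 0 * (k 0 * a 1 k - k 1 * a 0 k))) * Complex.I_sq - k 1 * hdiv

lemma advection_neg (hS : ∀ k, -k ∈ S ↔ k ∈ S) {v : Fin 2 → (Fin 2 → ℤ) → ℂ}
    (hv : ∀ i k, v i (-k) = (starRingEnd ℂ) (v i k))
    (hζ : ∀ k, ζ (-k) = (starRingEnd ℂ) (ζ k)) (k : Fin 2 → ℤ) :
    advection S v ζ (-k) = (starRingEnd ℂ) (advection S v ζ k) := by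
  rw [advection, advection, map_sum]
  refine Finset.sum_equiv (Equiv.neg _) (fun p => (hS p).symm) fun p _ => ?_
  have h1 : -k - p = -(k - -p) := by abel
  simp only [Equiv.neg_apply, map_mul, map_sum, ← hζ, ← hv, neg_neg, ← h1]
  simp
  ring

/-- Discrete form of the orthogonality of v·∇ζ and ζ. For each fixed velocity mode `p`, the
substitution k ↦ p - k changes the sign of the summand, because the vorticity is Hermitian and `p`
is orthogonal to v(p). Since ζ vanishes off `S`, the sum over `S` is a sum over all frequencies,
where the substitution is allowed; so the cancellation survives truncation. -/
lemma sum_advection_mul_conj (hζ : ∀ k, ζ (-k) = (starRingEnd ℂ) (ζ k)) (hζ0 : ∀ k ∉ S, ζ k = 0)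
    {v : Fin 2 → (Fin 2 → ℤ) → ℂ} (hv : ∀ k, ∑ i, (k i : ℂ) * v i k = 0) :
    ∑ k ∈ S, advection S v ζ k * (starRingEnd ℂ) (ζ k) = 0 := by
  simp only [advection, Finset.sum_mul]
  rw [Finset.sum_comm]
  refine Finset.sum_eq_zero fun p _ => ?_
  set X : (Fin 2 → ℤ) → ℂ := fun k => Complex.I * Real.pi * (∑ j, ((k - p) j : ℂ) * v j p) *
    ζ (k - p) * (starRingEnd ℂ) (ζ k) with hX
  have h1 : ∑ k ∈ S, X k = ∑' k, X k := by
    refine (tsum_eq_sum fun k hk => ?_).symm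
    simp [hX, hζ0 k hk]
  have h2 : ∀ k, X (p - k) = -X k := fun k => by
    have hp := hv p
    have e1 : p - k - p = -k := by abel
    have e2 : p - k = -(k - p) := by abel
    simp only [hX, e1]
    rw [e2, hζ k, hζ (k - p), Complex.conj_conj]
    simp only [Fin.sum_univ_two, Pi.sub_apply, Pi.neg_apply, Int.cast_sub, Int.cast_neg] at hp ⊢
    linear_combination (Complex.I * Real.pi * (starRingEnd ℂ) (ζ k) * ζ (k - p)) * (-hp)
  have h3 : ∑' k, X k = -∑' k, X k := by
    rw [← tsum_neg, ← (Equiv.subLeft p).tsum_eq]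
    exact tsum_congr h2
  change ∑ k ∈ S, X k = 0
  rw [h1]
  exact self_eq_neg.1 h3

lemma conv_eq_sum {a b : (Fin 2 → ℤ) → ℂ} (ha : ∀ k ∉ S, a k = 0) (k : Fin 2 → ℤ) :
    conv a b k = ∑ p ∈ S, a p * b (k - p) :=
  tsum_eq_sum fun p hp => by rw [ha p hp, zero_mul]

/-- The curl of the nonlinearity is the transport of the vorticity. -/
lemma curl_nonlinearity (h0 : 0 ∈ S) (hζ0 : ∀ k ∉ S, ζ k = 0) (k : Fin 2 → ℤ) :
    Complex.I * Real.pi * (k 0 * nonlinearity (velocity m ζ) 1 k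
      - k 1 * nonlinearity (velocity m ζ) 0 k) = advection S (velocity m ζ) ζ k := by
  set v := velocity m ζ with hv
  have hv0 : ∀ i, ∀ k ∉ S, v i k = 0 := fun i k hk => velocity_of_notMem h0 hζ0 i hk
  have hdiv := sum_mul_velocity m ζ
  -- The discrepancy between curling the nonlinearity and transporting the vorticity: the outer
  -- frequency `k` replaced by k - p in the curl leaves this remainder.
  set X : (Fin 2 → ℤ) → ℂ := fun p => (∑ j, ((k - p) j : ℂ) * v j p) *
    (p 0 * v 1 (k - p) - p 1 * v 0 (k - p)) with hX
  have hX0 : ∑ p ∈ S, X p = 0 := by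
    have h1 : ∑ p ∈ S, X p = ∑' p, X p := by
      refine (tsum_eq_sum fun p hp => ?_).symm
      simp [hX, hv0 _ p hp]
    -- With q = k - p and both velocities orthogonal to their frequencies, one factor is
    -- proportional to a cross product of `p` and `q`, the other to their inner product; exchanging
    -- `p` and `q` flips the sign. Both sides vanish if `p` or `q` is zero.
    have h2 : ∀ p, X (k - p) = -X p := fun p => by
      simp only [hX, sub_sub_cancel]
      obtain ⟨q, hq⟩ : ∃ q, q = k - p := ⟨_, rfl⟩
      rw [← hq]
      have hqd := hdiv q
      have hpd := hdiv p
      by_cases hp0 : p = 0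
      · simp [hp0]
      · by_cases hq0 : q = 0
        · simp [hq0]
        · simp only [hv, velocity, hp0, hq0, if_false, Fin.sum_univ_two, Matrix.cons_val_zero,
            Matrix.cons_val_one]
          ring
    have h3 : ∑' p, X p = -∑' p, X p := by
      rw [← tsum_neg, ← (Equiv.subLeft k).tsum_eq]
      exact tsum_congr h2
    rw [h1]
    exact self_eq_neg.1 h3
  have hterm : ∀ p, Complex.I * Real.pi * (∑ j, ((k - p) j : ℂ) * v j p) * ζ (k - p) =
      (Complex.I * Real.pi) ^ 2 * ((∑ j, (k j : ℂ) * v j p) *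
        (k 0 * v 1 (k - p) - k 1 * v 0 (k - p))) - (Complex.I * Real.pi) ^ 2 * X p := fun p => by
    have hpd := hdiv p
    -- At the zero frequency ζ is not the curl of the velocity, but it is multiplied by k - p = 0.
    by_cases hq : k - p = 0
    · obtain rfl : k = p := sub_eq_zero.1 hq
      simp only [Fin.sum_univ_two] at hpd
      simp only [hX, sub_self, Pi.zero_apply, Int.cast_zero, zero_mul, Finset.sum_const_zero,
        mul_zero, Fin.sum_univ_two, ← hv] at hpd ⊢
      rw [hpd]
      ring
    · have hc := curl_velocity (m := m) (ζ := ζ) hq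
      rw [← hv] at hc hpd
      rw [← hc]
      simp only [hX, Fin.sum_univ_two, Pi.sub_apply, Int.cast_sub] at hpd ⊢
      linear_combination (Complex.I * Real.pi) ^ 2 *
        (k 0 * v 1 (k - p) - k 1 * v 0 (k - p)) * (-hpd)
  rw [advection, Finset.sum_congr rfl fun p _ => hterm p, Finset.sum_sub_distrib, ← Finset.mul_sum,
    ← Finset.mul_sum, hX0, mul_zero, sub_zero]
  simp only [nonlinearity, Fin.sum_univ_two, conv_eq_sum (hv0 _)]
  have : ∀ p, ((k 0 : ℂ) * v 0 p + k 1 * v 1 p) * (k 0 * v 1 (k - p) - k 1 * v 0 (k - p)) =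
      k 0 * k 0 * (v 0 p * v 1 (k - p)) + k 0 * k 1 * (v 1 p * v 1 (k - p))
      - k 1 * k 0 * (v 0 p * v 0 (k - p)) - k 1 * k 1 * (v 1 p * v 0 (k - p)) := fun p => by ring
  simp only [this, Finset.sum_sub_distrib, Finset.sum_add_distrib, ← Finset.mul_sum]
  ring

/-- The right hand side of the vorticity equation on the modes in `S`. -/
def vorticityField (S : Finset (Fin 2 → ℤ)) (m : Fin 2 → ℂ) (ζ : (Fin 2 → ℤ) → ℂ)
    (k : Fin 2 → ℤ) : ℂ :=
  if k ∈ S then -((Real.pi ^ 2 * ∑ j, (k j : ℝ) ^ 2 : ℝ) : ℂ) * ζ k - advection S (velocity m ζ) ζ k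
  else 0

lemma vorticityField_neg (hS : ∀ k, -k ∈ S ↔ k ∈ S) (hm : ∀ i, (starRingEnd ℂ) (m i) = m i)
    (hζ : ∀ k, ζ (-k) = (starRingEnd ℂ) (ζ k)) (k : Fin 2 → ℤ) :
    vorticityField S m ζ (-k) = (starRingEnd ℂ) (vorticityField S m ζ k) := by
  by_cases hk : k ∈ S
  · simp only [vorticityField, hk, hS k, if_true, map_sub, map_mul, map_neg, ← hζ,
      Complex.conj_ofReal, Pi.neg_apply, Int.cast_neg, neg_sq,
      advection_neg hS (velocity_neg hm hζ) hζ]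
  · simp [vorticityField, hk, hS k]

/-- The pressure determined by the nonlinearity, on the level of Fourier coefficients. -/
def pressureCoeff (v : Fin 2 → (Fin 2 → ℤ) → ℂ) (k : Fin 2 → ℤ) : ℂ :=
  Complex.I * (k 0 * nonlinearity v 0 k + k 1 * nonlinearity v 1 k) /
    (Real.pi * ((k 0 : ℂ) ^ 2 + (k 1 : ℂ) ^ 2))

/-- The right hand side of the Navier-Stokes equations on the level of Fourier coefficients, with
the nonlinearity restricted to the modes in `S`. -/
def fourierField (S : Set (Fin 2 → ℤ)) (v : Fin 2 → (Fin 2 → ℤ) → ℂ) (i : Fin 2)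
    (k : Fin 2 → ℤ) : ℂ :=
  -((Real.pi ^ 2 * ∑ j, (k j : ℝ) ^ 2 : ℝ) : ℂ) * v i k - S.indicator (nonlinearity v i) k
    - Complex.I * Real.pi * k i * S.indicator (pressureCoeff v) k

/-- The velocity form of the vorticity equation. -/
lemma velocity_vorticityField (h0 : 0 ∈ S) (hζ0 : ∀ k ∉ S, ζ k = 0) (i : Fin 2)
    (k : Fin 2 → ℤ) :
    velocity 0 (vorticityField S m ζ) i k = fourierField S (velocity m ζ) i k := by
  by_cases hk : k ∈ S
  · by_cases hk0 : k = 0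
    · simp [velocity, fourierField, hk0, h0, nonlinearity]
    · have h1 := complex_sq_add_sq_ne_zero hk0
      have h2 := pi_ne_zero'
      -- Recovering a velocity from the curl of the nonlinearity is the Helmholtz projection: it
      -- removes exactly the gradient expressed by `pressureCoeff`.
      have hc := curl_nonlinearity (m := m) h0 hζ0 k
      rw [fourierField, indicator_of_mem (by exact_mod_cast hk),
        indicator_of_mem (by exact_mod_cast hk), pressureCoeff]
      set N := nonlinearity (velocity m ζ) with hN
      simp only [velocity, hk0, if_false, vorticityField, hk, if_true, ← hc]
      fin_cases i
      · simp only [Fin.zero_eta, Matrix.cons_val_zero]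
        field_simp
        linear_combination Real.pi * (k 0 * k 1 * N 1 k * (-1) + k 1 ^ 2 * N 0 k +
          (k 0 * (k 0 * N 0 k + k 1 * N 1 k))) * Complex.I_sq
      · simp only [Fin.mk_one, Matrix.cons_val_one, Matrix.cons_val_fin_one]
        field_simp
        linear_combination Real.pi * (k 0 ^ 2 * N 1 k - k 1 * k 0 * N 0 k +
          (k 1 * (k 0 * N 0 k + k 1 * N 1 k))) * Complex.I_sq
  · have h : k ≠ 0 := fun h => hk (h ▸ h0)
    rw [fourierField, indicator_of_notMem (by exact_mod_cast hk),
      indicator_of_notMem (by exact_mod_cast hk)]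
    simp [velocity, h, vorticityField, hk, hζ0 k hk]

end Vorticity

/-! ### Global solvability of the finite-dimensional vorticity equation. -/

section Galerkin

variable {T : ℝ}

/-- Bounded Lipschitz vector fields have global integral curves. -/
lemma exists_integralCurve {E : Type*} [NormedAddCommGroup E] [NormedSpace ℝ E] [CompleteSpace E]
    {f : E → E} {K L : NNReal} (hT : 0 ≤ T) (hK : LipschitzWith K f) (hL : ∀ x, ‖f x‖ ≤ L)
    (x₀ : E) :
    ∃ z : ℝ → E, Continuous z ∧ ∀ t ∈ Icc 0 T, z t = x₀ + ∫ s in (0 : ℝ)..t, f (z s) := by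
  -- A curve of speed at most `L` stays within distance LT, so this radius makes the local theorem
  -- cover all of [0,T].
  have hf : IsPicardLindelof (fun _ => f) (⟨0, left_mem_Icc.2 hT⟩ : Icc 0 T) x₀
      (L * ⟨T, hT⟩) 0 L K := by
    refine IsPicardLindelof.of_time_independent (fun x _ => hL x) hK.lipschitzOnWith ?_
    have h : max (T - 0) ((0 : ℝ) - 0) = T := by simp [hT]
    change (L : ℝ) * max (T - 0) ((0 : ℝ) - 0) ≤ L * T - 0
    rw [h, sub_zero]
  have hx : x₀ ∈ Metric.closedBall x₀ ((0 : NNReal) : ℝ) := by simp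
  obtain ⟨α, hα⟩ := ODE.FunSpace.exists_isFixedPt_next hf hx
  refine ⟨(ODE.FunSpace.next hf hx α).compProj, ODE.FunSpace.continuous_compProj _,
    fun t ht => ?_⟩
  rw [ODE.FunSpace.compProj_apply, ODE.FunSpace.next_apply, hα, projIcc_of_mem _ ht]
  rfl

variable {S : Finset (Fin 2 → ℤ)} {m : Fin 2 → ℂ}

/-- A value of the extension by zero of a family on `S`. -/
def extendZero (S : Finset (Fin 2 → ℤ)) (k : Fin 2 → ℤ) : (S → ℂ) →L[ℝ] ℂ :=
  if h : k ∈ S then ContinuousLinearMap.proj ⟨k, h⟩ else 0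

/-- A Fourier coefficient of the real part of the function with Fourier coefficients `z`. -/
def hermitianPart (S : Finset (Fin 2 → ℤ)) (k : Fin 2 → ℤ) : (S → ℂ) →L[ℝ] ℂ :=
  (1 / 2 : ℝ) • (extendZero S k +
    (Complex.conjCLE : ℂ →L[ℝ] ℂ).comp (extendZero S (-k)))

lemma extendZero_of_mem {k : Fin 2 → ℤ} (h : k ∈ S) (z : S → ℂ) :
    extendZero S k z = z ⟨k, h⟩ := by
  simp [extendZero, h]

lemma extendZero_of_notMem {k : Fin 2 → ℤ} (h : k ∉ S) (z : S → ℂ) : extendZero S k z = 0 := by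
  simp [extendZero, h]

lemma hermitianPart_apply (k : Fin 2 → ℤ) (z : S → ℂ) : hermitianPart S k z =
    (1 / 2 : ℂ) * (extendZero S k z + (starRingEnd ℂ) (extendZero S (-k) z)) := by
  simp [hermitianPart, mul_add]

lemma hermitianPart_neg (k : Fin 2 → ℤ) (z : S → ℂ) :
    hermitianPart S (-k) z = (starRingEnd ℂ) (hermitianPart S k z) := by
  simp only [hermitianPart_apply, neg_neg, map_mul, map_add, Complex.conj_conj, map_div₀, map_one,
    map_ofNat]
  ring

lemma hermitianPart_of_notMem (hS : ∀ k, -k ∈ S ↔ k ∈ S) {k : Fin 2 → ℤ} (h : k ∉ S)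
    (z : S → ℂ) : hermitianPart S k z = 0 := by
  rw [hermitianPart_apply, extendZero_of_notMem h, extendZero_of_notMem (by rwa [hS])]
  simp

lemma hermitianPart_eq (hS : ∀ k, -k ∈ S ↔ k ∈ S) {a : (Fin 2 → ℤ) → ℂ}
    (ha : ∀ k, a (-k) = (starRingEnd ℂ) (a k)) {k : Fin 2 → ℤ} (h : k ∈ S) :
    hermitianPart S k (fun p : S => a p) = a k := by
  rw [hermitianPart_apply, extendZero_of_mem h, extendZero_of_mem ((hS k).2 h), ha,
    Complex.conj_conj]
  ring

/-- Transport does not contribute, so only dissipation changes the enstrophy. The scalar χ admits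
the cut-off equation too; with χ ≥ 0 the enstrophy cannot exceed its initial value. -/
lemma enstrophy_identity {ζ : ℝ → (Fin 2 → ℤ) → ℂ} {χ : ℝ → ℝ} (hχ : Continuous χ)
    (h0 : ∀ t, ∀ k ∉ S, ζ t k = 0)
    (hneg : ∀ t k, ζ t (-k) = (starRingEnd ℂ) (ζ t k))
    (heq : ∀ k, ∀ t ∈ Icc 0 T, ζ t k = ζ 0 k +
      ∫ s in (0 : ℝ)..t, (χ s : ℂ) * vorticityField S m (ζ s) k)
    (hcF : ∀ k, Continuous fun t => vorticityField S m (ζ t) k) {t : ℝ} (ht : t ∈ Icc 0 T) :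
    ∑ k ∈ S, ‖ζ t k‖ ^ 2 + 2 * ∫ s in (0 : ℝ)..t, χ s *
      ∑ k ∈ S, Real.pi ^ 2 * (∑ j, (k j : ℝ) ^ 2) * ‖ζ s k‖ ^ 2 = ∑ k ∈ S, ‖ζ 0 k‖ ^ 2 := by
  have hen := fun k => norm_sq_eq_of_eq_add_integral (T := T) (f := fun t => ζ t k)
    (f' := fun s => (χ s : ℂ) * vorticityField S m (ζ s) k)
    (((Complex.continuous_ofReal.comp hχ).mul (hcF k)).intervalIntegrable 0 T) (heq k) ht
  have hpt : ∀ s, ∑ k ∈ S, ((χ s : ℂ) * vorticityField S m (ζ s) k *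
      (starRingEnd ℂ) (ζ s k)).re =
      -(χ s * ∑ k ∈ S, Real.pi ^ 2 * (∑ j, (k j : ℝ) ^ 2) * ‖ζ s k‖ ^ 2) := by
    intro s
    have h1 := sum_advection_mul_conj (hneg s) (h0 s) (sum_mul_velocity m (ζ s))
    rw [← Complex.re_sum]
    have h2 : ∑ k ∈ S, (χ s : ℂ) * vorticityField S m (ζ s) k * (starRingEnd ℂ) (ζ s k) =
        -((χ s * ∑ k ∈ S, Real.pi ^ 2 * (∑ j, (k j : ℝ) ^ 2) * ‖ζ s k‖ ^ 2 : ℝ) : ℂ) -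
        χ s * ∑ k ∈ S, advection S (velocity m (ζ s)) (ζ s) k * (starRingEnd ℂ) (ζ s k) := by
      rw [Complex.ofReal_mul, ← mul_neg, ← mul_sub, Complex.ofReal_sum, ← Finset.sum_neg_distrib,
        ← Finset.sum_sub_distrib, Finset.mul_sum]
      refine Finset.sum_congr rfl fun k hk => ?_
      have hn : ((‖ζ s k‖ ^ 2 : ℝ) : ℂ) = ζ s k * (starRingEnd ℂ) (ζ s k) := by
        rw [Complex.mul_conj, Complex.normSq_eq_norm_sq]
      rw [vorticityField, if_pos hk, Complex.ofReal_mul _ (‖ζ s k‖ ^ 2), hn]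
      ring
    rw [h2, h1, mul_zero, sub_zero, Complex.neg_re, Complex.ofReal_re]
  have hsum : ∑ k ∈ S, ‖ζ t k‖ ^ 2 = ∑ k ∈ S, ‖ζ 0 k‖ ^ 2 + 2 * ∫ s in (0 : ℝ)..t,
      ∑ k ∈ S, ((χ s : ℂ) * vorticityField S m (ζ s) k * (starRingEnd ℂ) (ζ s k)).re := by
    rw [Finset.sum_congr rfl fun k _ => (hen k).2, Finset.sum_add_distrib, ← Finset.mul_sum,
      ← intervalIntegral.integral_finsetSum fun k _ => (hen k).1]
  rw [hsum]
  simp only [hpt, intervalIntegral.integral_neg]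
  ring

lemma continuous_velocity {α : Type*} [TopologicalSpace α] {ζ : α → (Fin 2 → ℤ) → ℂ}
    (hc : ∀ k, Continuous fun t => ζ t k) (i : Fin 2) (k : Fin 2 → ℤ) :
    Continuous fun t => velocity m (ζ t) i k := by
  unfold velocity
  split_ifs
  · exact continuous_const
  · exact continuous_const.mul (hc k)

lemma continuous_vorticityField {α : Type*} [TopologicalSpace α] {ζ : α → (Fin 2 → ℤ) → ℂ}
    (hc : ∀ k, Continuous fun t => ζ t k) (k : Fin 2 → ℤ) :
    Continuous fun t => vorticityField S m (ζ t) k := by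
  unfold vorticityField
  split_ifs
  · refine (continuous_const.mul (hc k)).sub ?_
    unfold advection
    refine continuous_finsetSum _ fun p _ => Continuous.mul (continuous_const.mul ?_) (hc _)
    exact continuous_finsetSum _ fun j _ => continuous_const.mul (continuous_velocity hc j p)
  · exact continuous_const

lemma contDiff_vorticityField (k : Fin 2 → ℤ) :
    ContDiff ℝ 1 fun z : S → ℂ => vorticityField S m (fun k => extendZero S k z) k := by
  have hc : ∀ k, ContDiff ℝ 1 fun z : S → ℂ => extendZero S k z := fun k =>
    (extendZero S k).contDiff
  unfold vorticityField
  split_ifs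
  · refine (contDiff_const.mul (hc k)).sub ?_
    unfold advection
    refine ContDiff.sum fun p _ => ContDiff.mul (contDiff_const.mul ?_) (hc _)
    refine ContDiff.sum fun j _ => contDiff_const.mul ?_
    unfold velocity
    split_ifs
    · exact contDiff_const
    · exact contDiff_const.mul (hc _)
  · exact contDiff_const

/-- The vorticity equation on a finite symmetric set of modes has a global solution. -/
theorem exists_vorticity (hT : 0 ≤ T) (hS : ∀ k, -k ∈ S ↔ k ∈ S)
    (hm : ∀ i, (starRingEnd ℂ) (m i) = m i) {ζ₀ : (Fin 2 → ℤ) → ℂ}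
    (hζ₀ : ∀ k, ζ₀ (-k) = (starRingEnd ℂ) (ζ₀ k)) :
    ∃ ζ : ℝ → (Fin 2 → ℤ) → ℂ, (∀ k, Continuous fun t => ζ t k) ∧
      (∀ t, ∀ k ∉ S, ζ t k = 0) ∧ (∀ t k, ζ t (-k) = (starRingEnd ℂ) (ζ t k)) ∧
      (∀ k ∈ S, ζ 0 k = ζ₀ k) ∧
      (∀ k, ∀ t ∈ Icc 0 T, ζ t k = ζ 0 k + ∫ s in (0 : ℝ)..t, vorticityField S m (ζ s) k) ∧
      ∀ t ∈ Icc 0 T, ∑ k ∈ S, ‖ζ t k‖ ^ 2 + 2 * ∫ s in (0 : ℝ)..t,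
        ∑ k ∈ S, Real.pi ^ 2 * (∑ j, (k j : ℝ) ^ 2) * ‖ζ s k‖ ^ 2 = ∑ k ∈ S, ‖ζ₀ k‖ ^ 2 := by
  set R : ℝ := ∑ k ∈ S, ‖ζ₀ k‖ ^ 2 with hR
  -- The quadratic field is only locally Lipschitz. This cutoff makes it compactly supported, yet
  -- equals 1 where the enstrophy is at most the initial value `R`, so it is inactive along the
  -- solution.
  set χ : (S → ℂ) → ℝ := fun w => Real.smoothTransition (R + 1 - ∑ p, ‖w p‖ ^ 2) with hχ
  set g : (S → ℂ) → S → ℂ := fun w k =>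
    (χ w : ℂ) * vorticityField S m (fun k => extendZero S k w) k with hg
  have hχd : ContDiff ℝ 1 χ := by
    refine (Real.smoothTransition.contDiff (n := 1)).comp (contDiff_const.sub ?_)
    exact ContDiff.sum fun p _ => (contDiff_apply ℝ ℂ p).norm_sq ℝ
  have hgd : ContDiff ℝ 1 g := by
    refine contDiff_pi.2 fun k => ?_
    exact (Complex.ofRealCLM.contDiff.comp hχd).mul (contDiff_vorticityField _)
  have hgs : HasCompactSupport g := by
    refine HasCompactSupport.intro (isCompact_closedBall 0 (Real.sqrt (R + 1))) fun w hw => ?_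
    have h1 : R + 1 ≤ ∑ p, ‖w p‖ ^ 2 := by
      by_contra h
      push Not at h
      refine hw (mem_closedBall_zero_iff.2 ((pi_norm_le_iff_of_nonneg (Real.sqrt_nonneg _)).2
        fun p => Real.le_sqrt_of_sq_le (le_trans ?_ h.le)))
      exact Finset.single_le_sum (f := fun p => ‖w p‖ ^ 2) (fun p _ => sq_nonneg _)
        (Finset.mem_univ p)
    have h2 : χ w = 0 := Real.smoothTransition.zero_of_nonpos (by linarith)
    funext k
    simp [hg, h2]
  obtain ⟨K, hK⟩ := hgd.lipschitzWith_of_hasCompactSupport hgs one_ne_zero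
  obtain ⟨L, hL⟩ := hgs.exists_bound_of_continuous hgd.continuous
  -- The field is composed with the projection onto Hermitian families, so the projected curve is
  -- Hermitian by construction and solves the equation because the field preserves this symmetry.
  set P : (S → ℂ) →L[ℝ] (S → ℂ) := ContinuousLinearMap.pi fun k : S => hermitianPart S k with hP
  obtain ⟨z, hz, hze⟩ := exists_integralCurve (L := L.toNNReal) hT (hK.comp P.lipschitz)
    (fun x => (hL (P x)).trans (Real.le_coe_toNNReal L)) fun k : S => ζ₀ k
  set ζ : ℝ → (Fin 2 → ℤ) → ℂ := fun t k => hermitianPart S k (z t) with hζ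
  have hζc : ∀ k, Continuous fun t => ζ t k := fun k => (hermitianPart S k).continuous.comp hz
  have hζ0 : ∀ t, ∀ k ∉ S, ζ t k = 0 := fun t k hk => hermitianPart_of_notMem hS hk (z t)
  have hζn : ∀ t k, ζ t (-k) = (starRingEnd ℂ) (ζ t k) := fun t k => hermitianPart_neg k (z t)
  have hext : ∀ t, (fun k => extendZero S k (P (z t))) = ζ t := by
    intro t
    funext k
    by_cases hk : k ∈ S
    · rw [extendZero_of_mem hk]
      rfl
    · rw [extendZero_of_notMem hk, hζ0 t k hk]
  have hfield : ∀ s k, hermitianPart S k (g (P (z s))) =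
      (χ (P (z s)) : ℂ) * vorticityField S m (ζ s) k := by
    intro s k
    have h1 : g (P (z s)) = fun k : S => (χ (P (z s)) : ℂ) * vorticityField S m (ζ s) k := by
      funext k
      simp only [hg, hext]
    by_cases hk : k ∈ S
    · rw [h1, hermitianPart_eq hS (a := fun k => (χ (P (z s)) : ℂ) * vorticityField S m (ζ s) k)
        (fun k => ?_) hk]
      simp only [vorticityField_neg hS hm (hζn s), map_mul, Complex.conj_ofReal]
    · rw [hermitianPart_of_notMem hS hk, vorticityField, if_neg hk, mul_zero]
  have hz0 : z 0 = fun k : S => ζ₀ k := by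
    rw [hze 0 (left_mem_Icc.2 hT), intervalIntegral.integral_same, add_zero]
  have hinit : ∀ k ∈ S, ζ 0 k = ζ₀ k := fun k hk => by
    simp only [hζ, hz0]
    exact hermitianPart_eq hS hζ₀ hk
  have heq : ∀ k, ∀ t ∈ Icc 0 T, ζ t k = ζ 0 k +
      ∫ s in (0 : ℝ)..t, (χ (P (z s)) : ℂ) * vorticityField S m (ζ s) k := by
    intro k t ht
    simp only [← hfield]
    have hci : IntervalIntegrable (fun s => g (P (z s))) volume 0 t :=
      (hgd.continuous.comp (P.continuous.comp hz)).intervalIntegrable 0 t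
    simp only [hζ]
    rw [(hermitianPart S k).intervalIntegral_comp_comm hci, ← map_add, hz0, hze t ht]
    rfl
  have hχc : Continuous fun s => χ (P (z s)) := hχd.continuous.comp (P.continuous.comp hz)
  have hcF : ∀ k, Continuous fun t => vorticityField S m (ζ t) k :=
    continuous_vorticityField hζc
  have hR0 : ∑ k ∈ S, ‖ζ 0 k‖ ^ 2 = R := Finset.sum_congr rfl fun k hk => by rw [hinit k hk]
  -- The enstrophy identity holds with the cutoff in place and keeps the enstrophy at most `R`,
  -- where the cutoff equals 1.
  have hone : ∀ t ∈ Icc 0 T, χ (P (z t)) = 1 := by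
    intro t ht
    have h1 := enstrophy_identity hχc hζ0 hζn heq hcF ht
    have h2 : 0 ≤ ∫ s in (0 : ℝ)..t, χ (P (z s)) *
        ∑ k ∈ S, Real.pi ^ 2 * (∑ j, (k j : ℝ) ^ 2) * ‖ζ s k‖ ^ 2 := by
      refine intervalIntegral.integral_nonneg ht.1 fun s _ => mul_nonneg
        (Real.smoothTransition.nonneg _) (Finset.sum_nonneg fun k _ => by positivity)
    have h3 : ∑ p, ‖P (z t) p‖ ^ 2 = ∑ k ∈ S, ‖ζ t k‖ ^ 2 :=
      Finset.sum_coe_sort S fun k => ‖ζ t k‖ ^ 2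
    refine Real.smoothTransition.one_of_one_le ?_
    rw [h3]
    linarith
  have heq' : ∀ k, ∀ t ∈ Icc 0 T, ζ t k = ζ 0 k +
      ∫ s in (0 : ℝ)..t, vorticityField S m (ζ s) k := by
    intro k t ht
    rw [heq k t ht]
    congr 1
    refine intervalIntegral.integral_congr fun s hs => ?_
    rw [uIcc_of_le ht.1] at hs
    simp only [hone s ⟨hs.1, hs.2.trans ht.2⟩, Complex.ofReal_one, one_mul]
  refine ⟨ζ, hζc, hζ0, hζn, hinit, heq', fun t ht => ?_⟩
  have h1 := enstrophy_identity (χ := fun _ => 1) (m := m) continuous_const hζ0 hζn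
    (by simpa using heq') hcF ht
  simp only [one_mul] at h1
  rw [h1, hR0]

end Galerkin

/-! ### Sobolev weights on families of coefficients. -/

section Weights

variable {d : ℕ}

/-- The square of the weighted `ℓ²`-norm corresponding to the norm of `H^n_per`. -/
def weightSq (n : ℕ) (a : (Fin d → ℤ) → ℂ) : ℝ≥0∞ :=
  ∑' k, ENNReal.ofReal (bessel k ^ n) * ‖a k‖ₑ ^ 2

lemma one_le_ofReal_bessel_pow (n : ℕ) (k : Fin d → ℤ) : 1 ≤ ENNReal.ofReal (bessel k ^ n) := by
  rw [← ENNReal.ofReal_one]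
  exact ENNReal.ofReal_le_ofReal (one_le_pow₀ (one_le_bessel k))

lemma normTwoSq_le_weightSq (n : ℕ) (a : (Fin d → ℤ) → ℂ) : normTwoSq a ≤ weightSq n a :=
  ENNReal.tsum_le_tsum fun k => le_mul_of_one_le_left' (one_le_ofReal_bessel_pow n k)

lemma ofReal_sum_bessel {ι : Type*} [Fintype ι] (n : ℕ) (S : Finset (Fin d → ℤ))
    (v : ι → (Fin d → ℤ) → ℂ) :
    ENNReal.ofReal (∑ k ∈ S, bessel k ^ n * ∑ i, ‖v i k‖ ^ 2) =
      ∑ i, ∑ k ∈ S, ENNReal.ofReal (bessel k ^ n) * ‖v i k‖ₑ ^ 2 := by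
  have h : ∀ k : Fin d → ℤ, 0 ≤ bessel k ^ n := fun k => pow_nonneg (bessel_pos k).le n
  rw [Finset.sum_comm, ENNReal.ofReal_sum_of_nonneg
    fun k _ => mul_nonneg (h k) (Finset.sum_nonneg fun i _ => sq_nonneg _)]
  refine Finset.sum_congr rfl fun k _ => ?_
  rw [ENNReal.ofReal_mul (h k), ENNReal.ofReal_sum_of_nonneg fun i _ => sq_nonneg _,
    Finset.mul_sum]
  exact Finset.sum_congr rfl fun i _ => by rw [ENNReal.ofReal_pow (norm_nonneg _), ofReal_norm]

lemma ofReal_sum_bessel_le {ι : Type*} [Fintype ι] (n : ℕ) (S : Finset (Fin d → ℤ))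
    (v : ι → (Fin d → ℤ) → ℂ) :
    ENNReal.ofReal (∑ k ∈ S, bessel k ^ n * ∑ i, ‖v i k‖ ^ 2) ≤ ∑ i, weightSq n (v i) := by
  rw [ofReal_sum_bessel]
  exact Finset.sum_le_sum fun i _ => ENNReal.sum_le_tsum S

lemma sum_weightSq_eq {ι : Type*} [Fintype ι] (n : ℕ) {S : Finset (Fin d → ℤ)}
    {v : ι → (Fin d → ℤ) → ℂ} (h : ∀ i, ∀ k ∉ S, v i k = 0) :
    ∑ i, weightSq n (v i) = ENNReal.ofReal (∑ k ∈ S, bessel k ^ n * ∑ i, ‖v i k‖ ^ 2) := by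
  rw [ofReal_sum_bessel]
  refine Finset.sum_congr rfl fun i _ => tsum_eq_sum fun k hk => ?_
  simp [h i k hk]

end Weights

/-! ### Velocity form of the Galerkin approximations and uniform bounds. -/

section Galerkin

variable {T : ℝ} {S : Finset (Fin 2 → ℤ)}

lemma bessel_zero {d : ℕ} : bessel (0 : Fin d → ℤ) = 1 := by simp [bessel]

lemma one_le_pi_sq_mul {k : Fin 2 → ℤ} (hk : k ≠ 0) : 1 ≤ Real.pi ^ 2 * ∑ j, (k j : ℝ) ^ 2 := by
  have h1 := real_sq_add_sq_pos hk
  have h2 : (1 : ℝ) ≤ (k 0 : ℝ) ^ 2 + (k 1 : ℝ) ^ 2 := by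
    have h3 : (0 : ℤ) < k 0 ^ 2 + k 1 ^ 2 := by exact_mod_cast h1
    have h4 : (1 : ℤ) ≤ k 0 ^ 2 + k 1 ^ 2 := h3
    exact_mod_cast h4
  rw [Fin.sum_univ_two]
  have h5 : (1 : ℝ) ≤ Real.pi ^ 2 := one_le_pow₀ (by linarith [Real.pi_gt_three])
  nlinarith

/-- For k ≠ 0 one has π²|k|² ≥ 1, so `bessel k` is at most 2π²|k|² and one power of it is spent on
passing from velocity to vorticity. The zero mode is the constant mean. -/
lemma bessel_pow_mul_norm_sq_velocity_le (n : ℕ) (m : Fin 2 → ℂ) (ζ : (Fin 2 → ℤ) → ℂ)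
    (k : Fin 2 → ℤ) : bessel k ^ (n + 1) * ∑ i, ‖velocity m ζ i k‖ ^ 2 ≤
      (if k = 0 then ∑ i, ‖m i‖ ^ 2 else 0)
        + 2 ^ (n + 1) * ((Real.pi ^ 2 * ∑ j, (k j : ℝ) ^ 2) ^ n * ‖ζ k‖ ^ 2) := by
  by_cases hk : k = 0
  · simp only [hk, bessel_zero, one_pow, one_mul, velocity, if_true]
    have : 0 ≤ (2 : ℝ) ^ (n + 1) * ((Real.pi ^ 2 * ∑ j, (((0 : Fin 2 → ℤ) j : ℤ) : ℝ) ^ 2) ^ n *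
      ‖ζ 0‖ ^ 2) := by positivity
    linarith
  · rw [if_neg hk, zero_add, ← norm_sq_velocity (m := m) hk, ← mul_assoc (_ ^ n), ← pow_succ,
      ← mul_assoc, ← mul_pow]
    refine mul_le_mul_of_nonneg_right (pow_le_pow_left₀ (bessel_pos k).le ?_ _)
      (Finset.sum_nonneg fun i _ => sq_nonneg _)
    have := one_le_pi_sq_mul hk
    rw [bessel]
    linarith

lemma velocity_add_sub (m : Fin 2 → ℂ) (ζ ζ' : (Fin 2 → ℤ) → ℂ) (i : Fin 2) (k : Fin 2 → ℤ) :
    velocity m (ζ + ζ') i k = velocity m ζ i k + velocity 0 ζ' i k := by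
  by_cases hk : k = 0
  · simp [velocity, hk]
  · simp only [velocity, hk, if_false, Pi.add_apply]
    ring

lemma velocity_intervalIntegral (ζ : ℝ → (Fin 2 → ℤ) → ℂ) (t : ℝ) (i : Fin 2) (k : Fin 2 → ℤ) :
    velocity 0 (fun k => ∫ s in (0 : ℝ)..t, ζ s k) i k =
      ∫ s in (0 : ℝ)..t, velocity 0 (ζ s) i k := by
  by_cases hk : k = 0
  · simp [velocity, hk]
  · simp only [velocity, hk, if_false]
    rw [intervalIntegral.integral_const_mul]

/-- The Galerkin approximations of the Navier-Stokes equations, with uniform bounds. -/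
theorem exists_galerkin (hT : 0 ≤ T) (hS : ∀ k, -k ∈ S ↔ k ∈ S) (h0 : 0 ∈ S)
    {a : Fin 2 → (Fin 2 → ℤ) → ℂ} (ha : ∀ i k, a i (-k) = (starRingEnd ℂ) (a i k))
    (hdiv : ∀ k, ∑ i, (k i : ℂ) * a i k = 0) (ha1 : ∀ i, weightSq 1 (a i) ≠ ⊤) :
    ∃ v : ℝ → Fin 2 → (Fin 2 → ℤ) → ℂ, IsFourierSolution T S v ∧
      (∀ i, ∀ k ∈ S, v 0 i k = a i k) ∧ (∀ t i, ∀ k ∉ S, v t i k = 0) ∧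
      (∀ t i k, v t i (-k) = (starRingEnd ℂ) (v t i k)) ∧
      (∀ i k, ∀ t ∈ Icc 0 T, v t i k = v 0 i k + ∫ s in (0 : ℝ)..t, fourierField S (v s) i k) ∧
      (∀ t k, ∑ i, (k i : ℂ) * v t i k = 0) ∧
      (∀ t ∈ Icc 0 T, ∑ i, weightSq 1 (v t i) ≤ 2 * ∑ i, weightSq 1 (a i)) ∧
      ∫⁻ s in Ioc 0 T, ∑ i, weightSq 2 (v s i) ≤ ENNReal.ofReal (T + 2) * ∑ i, weightSq 1 (a i) := by
  set m : Fin 2 → ℂ := fun i => a i 0 with hm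
  set ζ₀ : (Fin 2 → ℤ) → ℂ := fun k => Complex.I * Real.pi * (k 0 * a 1 k - k 1 * a 0 k) with hζ₀
  set Z : (Fin 2 → ℤ) → ℝ := fun k => Real.pi ^ 2 * ∑ j, (k j : ℝ) ^ 2 with hZ
  have hZ0 : ∀ k, 0 ≤ Z k := fun k => by positivity
  have hmr : ∀ i, (starRingEnd ℂ) (m i) = m i := fun i => by
    have := ha i 0
    rw [neg_zero] at this
    exact this.symm
  have hζn : ∀ k, ζ₀ (-k) = (starRingEnd ℂ) (ζ₀ k) := fun k => by
    simp only [hζ₀, ha, map_mul, map_sub, Complex.conj_I, Complex.conj_ofReal, Pi.neg_apply,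
      Int.cast_neg, map_intCast]
    ring
  have hva : ∀ i k, velocity m ζ₀ i k = a i k := fun i k =>
    velocity_curl (fun i => rfl) (hdiv k) rfl i
  have hZa : ∀ k, ‖ζ₀ k‖ ^ 2 = Z k * ∑ i, ‖a i k‖ ^ 2 := fun k => by
    by_cases hk : k = 0
    · simp [hζ₀, hZ, hk]
    · rw [← norm_sq_velocity (m := m) hk]
      simp only [hva, hZ]
  obtain ⟨ζ, hc, hζ0, hneg, hinit, heq, hens⟩ := exists_vorticity (m := m) hT hS hmr hζn
  have hv0 : ∀ t i, ∀ k ∉ S, velocity m (ζ t) i k = 0 := fun t i k hk =>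
    velocity_of_notMem h0 (hζ0 t) i hk
  set A : ℝ := ∑ k ∈ S, bessel k ^ 1 * ∑ i, ‖a i k‖ ^ 2 with hA
  have hAle : ENNReal.ofReal A ≤ ∑ i, weightSq 1 (a i) := ofReal_sum_bessel_le 1 S a
  have hm0 : ∑ k ∈ S, (if k = 0 then ∑ i, ‖m i‖ ^ 2 else 0) = ∑ i, ‖m i‖ ^ 2 := by
    rw [Finset.sum_ite_eq' S 0 fun _ => ∑ i, ‖m i‖ ^ 2, if_pos h0]
  have hmA : ∑ i, ‖m i‖ ^ 2 + ∑ k ∈ S, ‖ζ₀ k‖ ^ 2 ≤ A := by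
    rw [← hm0, ← Finset.sum_add_distrib]
    refine Finset.sum_le_sum fun k _ => ?_
    rw [hZa, bessel, pow_one]
    split_ifs with hk
    · simp [hk, hZ, hm]
    · have : 0 ≤ ∑ i, ‖a i k‖ ^ 2 := Finset.sum_nonneg fun i _ => sq_nonneg _
      simp only [hZ]
      nlinarith
  have hmn : 0 ≤ ∑ i, ‖m i‖ ^ 2 := Finset.sum_nonneg fun i _ => sq_nonneg _
  have hζp : ∀ t, 0 ≤ ∑ k ∈ S, ‖ζ t k‖ ^ 2 := fun t => Finset.sum_nonneg fun i _ => sq_nonneg _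
  have hwn : ∀ s, 0 ≤ ∑ k ∈ S, Z k * ‖ζ s k‖ ^ 2 := fun s =>
    Finset.sum_nonneg fun k _ => mul_nonneg (hZ0 k) (sq_nonneg _)
  have hW1 : ∀ t ∈ Icc 0 T, ∑ i, weightSq 1 (velocity m (ζ t) i) ≤ 2 * ∑ i, weightSq 1 (a i) := by
    intro t ht
    rw [sum_weightSq_eq 1 (hv0 t)]
    refine le_trans ?_ (mul_le_mul_right hAle 2)
    rw [← ENNReal.ofReal_ofNat, ← ENNReal.ofReal_mul zero_le_two]
    refine ENNReal.ofReal_le_ofReal ?_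
    refine (Finset.sum_le_sum fun k _ => bessel_pow_mul_norm_sq_velocity_le 0 m (ζ t) k).trans ?_
    have h1 := hens t ht
    have h2 : 0 ≤ ∫ s in (0 : ℝ)..t, ∑ k ∈ S, Z k * ‖ζ s k‖ ^ 2 :=
      intervalIntegral.integral_nonneg ht.1 fun s _ => hwn s
    simp only [pow_zero, one_mul, zero_add, pow_one]
    rw [Finset.sum_add_distrib, hm0, ← Finset.mul_sum]
    linarith
  -- The mean contributes `T` times its square. The vorticity contributes four times the
  -- dissipation, which the enstrophy identity bounds by half the initial enstrophy; hence T + 2.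
  have hW2 : ∫⁻ s in Ioc 0 T, ∑ i, weightSq 2 (velocity m (ζ s) i) ≤
      ENNReal.ofReal (T + 2) * ∑ i, weightSq 1 (a i) := by
    refine le_trans ?_ (mul_le_mul_right hAle _)
    have hcw : Continuous fun s => ∑ i, ‖m i‖ ^ 2 + 4 * ∑ k ∈ S, Z k * ‖ζ s k‖ ^ 2 :=
      continuous_const.add (continuous_const.mul (continuous_finsetSum _ fun k _ =>
        continuous_const.mul ((hc k).norm.pow 2)))
    calc ∫⁻ s in Ioc 0 T, ∑ i, weightSq 2 (velocity m (ζ s) i)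
        ≤ ∫⁻ s in Ioc 0 T, ENNReal.ofReal
            (∑ i, ‖m i‖ ^ 2 + 4 * ∑ k ∈ S, Z k * ‖ζ s k‖ ^ 2) := by
          refine lintegral_mono fun s => ?_
          rw [sum_weightSq_eq 2 (hv0 s)]
          refine ENNReal.ofReal_le_ofReal ?_
          refine (Finset.sum_le_sum fun k _ =>
            bessel_pow_mul_norm_sq_velocity_le 1 m (ζ s) k).trans (le_of_eq ?_)
          rw [Finset.sum_add_distrib, hm0, ← Finset.mul_sum]
          simp only [pow_one, hZ]
          norm_num
      _ = ENNReal.ofReal (∫ s in (0 : ℝ)..T,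
            (∑ i, ‖m i‖ ^ 2 + 4 * ∑ k ∈ S, Z k * ‖ζ s k‖ ^ 2)) := by
          rw [intervalIntegral.integral_of_le hT, ofReal_integral_eq_lintegral_ofReal
            (hcw.integrableOn_Ioc) (ae_of_all _ fun s => by have := hwn s; positivity)]
      _ ≤ ENNReal.ofReal (T + 2) * ENNReal.ofReal A := by
          rw [← ENNReal.ofReal_mul (by linarith)]
          refine ENNReal.ofReal_le_ofReal ?_
          have hci : Continuous fun s => ∑ k ∈ S, Z k * ‖ζ s k‖ ^ 2 :=
            continuous_finsetSum _ fun k _ => continuous_const.mul ((hc k).norm.pow 2)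
          have hci4 : Continuous fun s => 4 * ∑ k ∈ S, Z k * ‖ζ s k‖ ^ 2 := continuous_const.mul hci
          rw [intervalIntegral.integral_add intervalIntegrable_const (hci4.intervalIntegrable _ _),
            intervalIntegral.integral_const_mul, intervalIntegral.integral_const, smul_eq_mul,
            sub_zero]
          have h1 := hens T ⟨hT, le_rfl⟩
          have h2 := hζp T
          have h3 : T * ∑ i, ‖m i‖ ^ 2 ≤ T * A := by
            refine mul_le_mul_of_nonneg_left ?_ hT
            have : 0 ≤ ∑ k ∈ S, ‖ζ₀ k‖ ^ 2 := Finset.sum_nonneg fun i _ => sq_nonneg _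
            linarith
          simp only [hZ] at h1 ⊢
          nlinarith
  have heqv : ∀ i k, ∀ t ∈ Icc 0 T, velocity m (ζ t) i k = velocity m (ζ 0) i k +
      ∫ s in (0 : ℝ)..t, fourierField S (velocity m (ζ s)) i k := by
    intro i k t ht
    simp only [← velocity_vorticityField h0 (hζ0 _)]
    rw [← velocity_intervalIntegral, ← velocity_add_sub]
    congr 1
    funext k
    exact heq k t ht
  refine ⟨fun t => velocity m (ζ t), ⟨⟨2 * ∑ i, weightSq 1 (a i), ?_, fun t ht i => ?_⟩, ?_⟩,
    fun i k hk => ?_, hv0, fun t i k => velocity_neg hmr (hneg t) i k, heqv,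
    fun t => sum_mul_velocity m (ζ t), hW1, hW2⟩
  · exact ENNReal.mul_ne_top (by simp) (by simpa using ha1)
  · refine (normTwoSq_le_weightSq 1 _).trans (le_trans ?_ (hW1 t ht))
    exact Finset.single_le_sum (f := fun i => weightSq 1 (velocity m (ζ t) i))
      (fun i _ => zero_le) (Finset.mem_univ i)
  · refine ⟨fun t => fourierField S (velocity m (ζ t)),
      fun t => (S : Set (Fin 2 → ℤ)).indicator (pressureCoeff (velocity m (ζ t))), fun i k => ?_,
      heqv, ae_of_all _ fun t k => ⟨sum_mul_velocity m (ζ t) k, fun i => rfl⟩⟩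
    simp only [← velocity_vorticityField h0 (hζ0 _)]
    exact (continuous_velocity (continuous_vorticityField hc) i k).intervalIntegrable 0 T
  · rw [← hva i k]
    by_cases hk0 : k = 0
    · simp [velocity, hk0]
    · simp only [velocity, hk0, if_false, hinit k hk]

end Galerkin

/-! ### Embeddings, product estimates and tail estimates for frequency cutoffs. -/

section WeightedEstimates

/-- The constant in the embedding of `H²` into the functions with summable Fourier coefficients. -/
def embeddingConst : ℝ≥0∞ := ∑' k : Fin 2 → ℤ, ENNReal.ofReal ((bessel k)⁻¹) ^ 2

/-- Comparison with the lattice sum of |k|⁻⁴, convergent in two dimensions; the added term covers k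
= 0. -/
lemma embeddingConst_ne_top : embeddingConst ≠ ⊤ := by
  have hs : Summable fun k : Fin 2 → ℤ => ((bessel k)⁻¹) ^ 2 := by
    have h0 : Summable fun k : Fin 2 → ℤ => ‖k‖ ^ (-(4 : ℝ)) :=
      EisensteinSeries.summable_one_div_norm_rpow (by norm_num)
    have h1 : Summable fun k : Fin 2 → ℤ => ‖k‖ ^ (-(4 : ℝ)) + if k = 0 then (1 : ℝ) else 0 :=
      h0.add (hasSum_ite_eq (0 : Fin 2 → ℤ) (1 : ℝ)).summable
    refine Summable.of_nonneg_of_le (fun k => sq_nonneg _) (fun k => ?_) h1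
    by_cases hk : k = 0
    · simp [hk, bessel_zero]
    · have hn : 0 < ‖k‖ := norm_pos_iff.2 hk
      have hle : ‖k‖ ^ 2 ≤ bessel k := by
        have h2 : ‖k‖ ≤ Real.sqrt (bessel k) := by
          refine (pi_norm_le_iff_of_nonneg (Real.sqrt_nonneg _)).2 fun j => ?_
          refine Real.le_sqrt_of_sq_le (le_trans ?_ (sq_le_bessel k j))
          rw [Int.norm_eq_abs, sq_abs, mul_pow]
          have : (1 : ℝ) ≤ Real.pi ^ 2 := one_le_pow₀ (by linarith [Real.pi_gt_three])
          nlinarith [sq_nonneg (k j : ℝ)]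
        calc ‖k‖ ^ 2 ≤ Real.sqrt (bessel k) ^ 2 := by gcongr
          _ = bessel k := Real.sq_sqrt (bessel_pos k).le
      rw [if_neg hk, add_zero, Real.rpow_neg (norm_nonneg k), inv_pow]
      refine inv_anti₀ (by positivity) ?_
      have h3 : ‖k‖ ^ (4 : ℝ) = (‖k‖ ^ 2) ^ 2 := by
        rw [← pow_mul]
        exact_mod_cast Real.rpow_natCast ‖k‖ 4
      rw [h3]
      exact pow_le_pow_left₀ (sq_nonneg _) hle 2
  have h := hs.tsum_ofReal_ne_top
  rw [embeddingConst]
  convert h using 4 with k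
  rw [ENNReal.ofReal_pow (inv_nonneg.2 (bessel_pos k).le)]

/-- Cauchy-Schwarz after inserting the weight and its inverse: H² embeds into the Wiener algebra. -/
lemma normOne_sq_le (a : (Fin 2 → ℤ) → ℂ) :
    normOne a ^ 2 ≤ embeddingConst * weightSq 2 a := by
  have h := sq_tsum_mul_le (fun k : Fin 2 → ℤ => ENNReal.ofReal ((bessel k)⁻¹))
    (fun k => ENNReal.ofReal (bessel k) * ‖a k‖ₑ)
  have h1 : ∀ k : Fin 2 → ℤ, ENNReal.ofReal ((bessel k)⁻¹) * (ENNReal.ofReal (bessel k) * ‖a k‖ₑ)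
      = ‖a k‖ₑ := fun k => by
    rw [← mul_assoc, ← ENNReal.ofReal_mul (inv_nonneg.2 (bessel_pos k).le),
      inv_mul_cancel₀ (bessel_pos k).ne', ENNReal.ofReal_one, one_mul]
  simp only [h1, mul_pow, ← ENNReal.ofReal_pow (bessel_pos _).le] at h
  exact h

variable {d : ℕ}

lemma bessel_le_add (k p : Fin d → ℤ) : bessel k ≤ 2 * (bessel p + bessel (k - p)) := by
  have h : ∑ i, (k i : ℝ) ^ 2 ≤ 2 * (∑ i, (p i : ℝ) ^ 2 + ∑ i, ((k - p) i : ℝ) ^ 2) := by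
    rw [← Finset.sum_add_distrib, Finset.mul_sum]
    refine Finset.sum_le_sum fun i _ => ?_
    rw [Pi.sub_apply, Int.cast_sub]
    nlinarith [sq_nonneg ((k i : ℝ) - 2 * p i)]
  have h2 := mul_le_mul_of_nonneg_left h (sq_nonneg Real.pi)
  unfold bessel
  linarith

lemma ofReal_sqrt_bessel_le (k p : Fin d → ℤ) : ENNReal.ofReal (Real.sqrt (bessel k)) ≤
    2 * (ENNReal.ofReal (Real.sqrt (bessel p)) + ENNReal.ofReal (Real.sqrt (bessel (k - p)))) := by
  rw [← ENNReal.ofReal_add (Real.sqrt_nonneg _) (Real.sqrt_nonneg _), ← ENNReal.ofReal_ofNat,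
    ← ENNReal.ofReal_mul zero_le_two]
  refine ENNReal.ofReal_le_ofReal (Real.sqrt_le_iff.2 ⟨by positivity, ?_⟩)
  have h1 := Real.sq_sqrt (bessel_pos p).le
  have h2 := Real.sq_sqrt (bessel_pos (k - p)).le
  have h3 := bessel_le_add k p
  have h4 := bessel_pos p
  have h5 := bessel_pos (k - p)
  have h6 : 0 ≤ Real.sqrt (bessel p) * Real.sqrt (bessel (k - p)) := by positivity
  nlinarith

lemma weightSq_one_eq (a : (Fin d → ℤ) → ℂ) :
    weightSq 1 a = ∑' k, (ENNReal.ofReal (Real.sqrt (bessel k)) * ‖a k‖ₑ) ^ 2 := by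
  refine tsum_congr fun k => ?_
  rw [mul_pow, ← ENNReal.ofReal_pow (Real.sqrt_nonneg _), Real.sq_sqrt (bessel_pos k).le, pow_one]

lemma add_sq_le_ennreal (x y : ℝ≥0∞) : (x + y) ^ 2 ≤ 2 * (x ^ 2 + y ^ 2) := by
  have := ENNReal.rpow_add_le_mul_rpow_add_rpow x y one_le_two
  norm_num at this
  exact this

/-- A fractional product rule: the square root of the weight is subadditive up to a factor 2, so it
falls on one factor of the convolution, and Young's inequality puts the other in ℓ¹. -/
lemma weightSq_conv_le (a b : (Fin d → ℤ) → ℂ) : weightSq 1 (conv a b) ≤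
    8 * (normOne b ^ 2 * weightSq 1 a + normOne a ^ 2 * weightSq 1 b) := by
  set β : (Fin d → ℤ) → ℝ≥0∞ := fun k => ENNReal.ofReal (Real.sqrt (bessel k)) with hβ
  have hpt : ∀ k, (β k * ‖conv a b k‖ₑ) ^ 2 ≤
      8 * ((∑' p, ‖b p‖ₑ * (β (k - p) * ‖a (k - p)‖ₑ)) ^ 2
        + (∑' p, ‖a p‖ₑ * (β (k - p) * ‖b (k - p)‖ₑ)) ^ 2) := by
    intro k
    have h1 : ‖conv a b k‖ₑ ≤ ∑' p, ‖a p‖ₑ * ‖b (k - p)‖ₑ := by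
      refine enorm_tsum_le_tsum_enorm.trans (le_of_eq ?_)
      simp only [enorm_mul]
    have h2 : β k * ‖conv a b k‖ₑ ≤ 2 * ((∑' p, ‖b p‖ₑ * (β (k - p) * ‖a (k - p)‖ₑ))
        + ∑' p, ‖a p‖ₑ * (β (k - p) * ‖b (k - p)‖ₑ)) := by
      refine (mul_le_mul_right h1 _).trans ?_
      rw [← (Equiv.subLeft k).tsum_eq fun p => ‖b p‖ₑ * (β (k - p) * ‖a (k - p)‖ₑ),
        ← ENNReal.tsum_mul_left, ← ENNReal.tsum_add, ← ENNReal.tsum_mul_left]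
      refine ENNReal.tsum_le_tsum fun p => ?_
      simp only [Equiv.subLeft_apply, sub_sub_cancel]
      refine (mul_le_mul_left (ofReal_sqrt_bessel_le k p) _).trans (le_of_eq ?_)
      simp only [hβ]
      ring
    refine (pow_le_pow_left' h2 2).trans ?_
    rw [mul_pow]
    refine (mul_le_mul_right (add_sq_le_ennreal _ _) _).trans (le_of_eq ?_)
    ring
  rw [weightSq_one_eq, weightSq_one_eq a, weightSq_one_eq b]
  refine (ENNReal.tsum_le_tsum hpt).trans ?_
  rw [ENNReal.tsum_mul_left, ENNReal.tsum_add]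
  refine mul_le_mul_right (add_le_add ?_ ?_) _
  · exact tsum_sq_conv_le (fun p => ‖b p‖ₑ) fun p => β p * ‖a p‖ₑ
  · exact tsum_sq_conv_le (fun p => ‖a p‖ₑ) fun p => β p * ‖b p‖ₑ

/-- The frequencies all of whose components are at most `N` in absolute value. -/
def lowFreq (N : ℕ) : Finset (Fin d → ℤ) := Finset.Icc (fun _ => -(N : ℤ)) fun _ => (N : ℤ)

lemma mem_lowFreq {N : ℕ} {k : Fin d → ℤ} : k ∈ lowFreq N ↔ ∀ i, |k i| ≤ N := by
  simp only [lowFreq, Finset.mem_Icc, Pi.le_def, abs_le, forall_and]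

lemma neg_mem_lowFreq {N : ℕ} (k : Fin d → ℤ) : -k ∈ lowFreq N ↔ k ∈ lowFreq N := by
  simp [mem_lowFreq]

lemma zero_mem_lowFreq (N : ℕ) : (0 : Fin d → ℤ) ∈ lowFreq N := by simp [mem_lowFreq]

lemma lowFreq_mono {N M : ℕ} (h : N ≤ M) : (lowFreq N : Finset (Fin d → ℤ)) ⊆ lowFreq M :=
  fun k hk => mem_lowFreq.2 fun i => (mem_lowFreq.1 hk i).trans (by exact_mod_cast h)

lemma eventually_mem_lowFreq (k : Fin d → ℤ) : ∀ᶠ N in Filter.atTop, k ∈ lowFreq N := by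
  filter_upwards [Filter.eventually_ge_atTop (∑ i, (k i).natAbs)] with N hN
  refine mem_lowFreq.2 fun i => ?_
  have h1 : (k i).natAbs ≤ N :=
    (Finset.single_le_sum (f := fun i => (k i).natAbs) (fun i _ => Nat.zero_le _)
      (Finset.mem_univ i)).trans hN
  rw [Int.abs_eq_natAbs]
  exact_mod_cast h1

lemma one_le_of_notMem_lowFreq {N : ℕ} {k : Fin d → ℤ} (h : k ∉ lowFreq N) :
    1 ≤ ENNReal.ofReal (1 / (N + 1)) * ENNReal.ofReal (bessel k ^ 1) := by
  rw [mem_lowFreq] at h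
  push Not at h
  obtain ⟨i, hi⟩ := h
  have h1 : (N : ℝ) + 1 ≤ |(k i : ℝ)| := by
    have h2 : (N : ℤ) + 1 ≤ |k i| := hi
    exact_mod_cast h2
  have h2 : (N : ℝ) + 1 ≤ bessel k := by
    refine le_trans ?_ (sq_le_bessel k i)
    rw [mul_pow, ← sq_abs (k i : ℝ)]
    have h3 : (1 : ℝ) ≤ Real.pi ^ 2 := one_le_pow₀ (by linarith [Real.pi_gt_three])
    have h4 : (0 : ℝ) ≤ N := Nat.cast_nonneg N
    nlinarith
  rw [← ENNReal.ofReal_mul (by positivity), ← ENNReal.ofReal_one, pow_one]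
  refine ENNReal.ofReal_le_ofReal ?_
  rw [one_div, inv_mul_eq_div, le_div_iff₀ (by positivity)]
  linarith

/-- Outside the cutoff the weight is at least N + 1, so an H¹ bound gives a rate of convergence in
L². -/
lemma tsum_indicator_lowFreq_le (N : ℕ) (a : (Fin d → ℤ) → ℂ) :
    ∑' k, ((lowFreq N : Finset (Fin d → ℤ)) : Set (Fin d → ℤ))ᶜ.indicator
      (fun k => ‖a k‖ₑ ^ 2) k ≤ ENNReal.ofReal (1 / (N + 1)) * weightSq 1 a := by
  rw [weightSq, ← ENNReal.tsum_mul_left]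
  refine ENNReal.tsum_le_tsum fun k => ?_
  by_cases hk : k ∈ lowFreq N
  · simp [hk]
  · rw [indicator_of_mem (by simpa using hk), ← mul_assoc]
    exact le_mul_of_one_le_left' (one_le_of_notMem_lowFreq hk)

/-- Fatou's lemma for counting measure; it carries the uniform bounds over to the limit. -/
lemma tsum_le_liminf {ι : Type*} {F : ℕ → ι → ℝ≥0∞} {f : ι → ℝ≥0∞}
    (h : ∀ i, Filter.Tendsto (fun n => F n i) Filter.atTop (nhds (f i))) :
    ∑' i, f i ≤ Filter.liminf (fun n => ∑' i, F n i) Filter.atTop := by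
  rw [ENNReal.tsum_eq_iSup_sum]
  refine iSup_le fun s => ?_
  rw [← (tendsto_finsetSum s fun i _ => h i).liminf_eq]
  exact Filter.liminf_le_liminf (Filter.Eventually.of_forall fun n => ENNReal.sum_le_tsum s)

lemma sum_weightSq_le_liminf {n : ℕ} {v : ℕ → Fin 2 → (Fin d → ℤ) → ℂ}
    {w : Fin 2 → (Fin d → ℤ) → ℂ}
    (h : ∀ i k, Filter.Tendsto (fun N => v N i k) Filter.atTop (nhds (w i k))) :
    ∑ i, weightSq n (w i) ≤ Filter.liminf (fun N => ∑ i, weightSq n (v N i)) Filter.atTop := by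
  have hx : ∀ u : Fin 2 → (Fin d → ℤ) → ℂ, ∑ i, weightSq n (u i) =
      ∑' x : Fin 2 × (Fin d → ℤ), ENNReal.ofReal (bessel x.2 ^ n) * ‖u x.1 x.2‖ₑ ^ 2 := fun u => by
    rw [ENNReal.tsum_prod', tsum_fintype]
    rfl
  simp only [hx]
  refine tsum_le_liminf fun x => ?_
  exact ENNReal.Tendsto.const_mul (ENNReal.Tendsto.pow (h x.1 x.2).enorm) (Or.inr ENNReal.ofReal_ne_top)

lemma tendsto_conv {a b : ℕ → (Fin d → ℤ) → ℂ} {a' b' : (Fin d → ℤ) → ℂ} {M : ℝ≥0∞} (hM : M ≠ ⊤)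
    (ha : Filter.Tendsto (fun n => normTwoSq (a n - a')) Filter.atTop (nhds 0))
    (hb : Filter.Tendsto (fun n => normTwoSq (b n - b')) Filter.atTop (nhds 0))
    (hbM : ∀ n, normTwoSq (b n) ≤ M) (haM : ∀ n, normTwoSq (a n) ≤ M)
    (haM' : normTwoSq a' ≤ M) (hbM' : normTwoSq b' ≤ M) (k : Fin d → ℤ) :
    Filter.Tendsto (fun n => conv (a n) (b n) k) Filter.atTop (nhds (conv a' b' k)) := by
  rw [tendsto_iff_edist_tendsto_0]
  have h1 : ∀ n, edist (conv (a n) (b n) k) (conv a' b' k) ^ 2 ≤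
      2 * (normTwoSq (a n - a') * M) + 2 * (M * normTwoSq (b n - b')) := by
    intro n
    rw [edist_eq_enorm_sub, ← Pi.sub_apply, conv_sub_conv (ne_top_of_le_ne_top hM (haM n))
      (ne_top_of_le_ne_top hM (hbM n)) (ne_top_of_le_ne_top hM haM')
      (ne_top_of_le_ne_top hM hbM')]
    have h2 := enorm_sub_sq_le (conv (a n - a') (b n) k) (-conv a' (b n - b') k)
    rw [sub_neg_eq_add, enorm_neg] at h2
    refine h2.trans ?_
    gcongr
    · exact (enorm_conv_sq_le _ _ k).trans (mul_le_mul_right (hbM n) _)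
    · exact (enorm_conv_sq_le _ _ k).trans (mul_le_mul_left haM' _)
  have h2 : Filter.Tendsto (fun n => 2 * (normTwoSq (a n - a') * M)
      + 2 * (M * normTwoSq (b n - b'))) Filter.atTop (nhds 0) := by
    have e1 := ENNReal.Tendsto.const_mul (a := 2) (ENNReal.Tendsto.mul_const (b := M) ha
      (Or.inr hM)) (Or.inr ENNReal.ofNat_ne_top)
    have e2 := ENNReal.Tendsto.const_mul (a := 2) (ENNReal.Tendsto.const_mul (a := M) hb
      (Or.inr hM)) (Or.inr ENNReal.ofNat_ne_top)
    simpa using e1.add e2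
  have h3 : Filter.Tendsto (fun n => edist (conv (a n) (b n) k) (conv a' b' k) ^ 2)
      Filter.atTop (nhds 0) :=
    tendsto_of_tendsto_of_tendsto_of_le_of_le tendsto_const_nhds h2 (fun _ => zero_le) h1
  have h4 := ((ENNReal.continuous_rpow_const (y := 1 / 2)).tendsto 0).comp h3
  rw [ENNReal.zero_rpow_of_pos (by norm_num)] at h4
  refine h4.congr fun n => ?_
  simp only [Function.comp_apply]
  rw [← ENNReal.rpow_natCast, ← ENNReal.rpow_mul]
  norm_num

end WeightedEstimates

/-! ### Convergence of the Galerkin approximations. -/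

section Limit

variable {T : ℝ}

lemma weightSq_zero {d : ℕ} (a : (Fin d → ℤ) → ℂ) : weightSq 0 a = normTwoSq a := by
  simp [weightSq, normTwoSq]

lemma norm_le_sqrt_of_enorm_sq_le {z : ℂ} {M : ℝ≥0∞} (hM : M ≠ ⊤) (h : ‖z‖ₑ ^ 2 ≤ M) :
    ‖z‖ ≤ Real.sqrt M.toReal := by
  refine Real.le_sqrt_of_sq_le ?_
  have h1 := ENNReal.toReal_mono hM h
  simpa using h1

lemma enorm_sq_le_normTwoSq {d : ℕ} (a : (Fin d → ℤ) → ℂ) (k : Fin d → ℤ) :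
    ‖a k‖ₑ ^ 2 ≤ normTwoSq a := ENNReal.le_tsum k

lemma sum_weightSq_conv_le (v : Fin 2 → (Fin 2 → ℤ) → ℂ) :
    ∑ i, ∑ j, weightSq 1 (conv (v j) (v i)) ≤
      16 * (∑ i, weightSq 1 (v i)) * ∑ i, normOne (v i) ^ 2 := by
  refine (Finset.sum_le_sum fun i _ => Finset.sum_le_sum fun j _ =>
    weightSq_conv_le (v j) (v i)).trans (le_of_eq ?_)
  simp only [Fin.sum_univ_two]
  ring

lemma sum_normOne_sq_le (v : Fin 2 → (Fin 2 → ℤ) → ℂ) :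
    ∑ i, normOne (v i) ^ 2 ≤ embeddingConst * ∑ i, weightSq 2 (v i) := by
  rw [Finset.mul_sum]
  exact Finset.sum_le_sum fun i _ => normOne_sq_le (v i)

/-- For a fixed mode the derivatives are just numbers, so an L² bound suffices. The constant does
not depend on `S`, so it dominates all approximations at once. -/
lemma exists_bound_fourierField {M : ℝ≥0∞} (hM : M ≠ ⊤) (k : Fin 2 → ℤ) :
    ∃ C : ℝ, ∀ (S : Set (Fin 2 → ℤ)) (v : Fin 2 → (Fin 2 → ℤ) → ℂ), (∀ i, normTwoSq (v i) ≤ M) →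
      ∀ i, ‖fourierField S v i k‖ ≤ C := by
  set c : ℝ := Real.sqrt (M * M).toReal with hc
  set n : ℝ := ∑ j, Real.pi * |(k j : ℝ)| * c with hn
  set z : ℝ := ‖(Real.pi * ((k 0 : ℂ) ^ 2 + (k 1 : ℂ) ^ 2) : ℂ)‖ with hz
  have hc0 : 0 ≤ c := Real.sqrt_nonneg _
  have hn0 : 0 ≤ n := Finset.sum_nonneg fun j _ => by positivity
  refine ⟨‖(-((Real.pi ^ 2 * ∑ j, (k j : ℝ) ^ 2 : ℝ) : ℂ))‖ * Real.sqrt M.toReal + n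
    + ∑ i, Real.pi * |(k i : ℝ)| * ((|(k 0 : ℝ)| * n + |(k 1 : ℝ)| * n) / z), fun S v hv i => ?_⟩
  have hnl : ∀ i, ‖nonlinearity v i k‖ ≤ n := fun i => by
    refine (norm_sum_le _ _).trans (Finset.sum_le_sum fun j _ => ?_)
    have h1 : ‖conv (v j) (v i) k‖ ≤ c := norm_le_sqrt_of_enorm_sq_le (ENNReal.mul_ne_top hM hM)
      ((enorm_conv_sq_le _ _ k).trans (mul_le_mul' (hv j) (hv i)))
    simp only [norm_mul, Complex.norm_I, one_mul, Complex.norm_real, Complex.norm_intCast,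
      Real.norm_of_nonneg Real.pi_nonneg]
    gcongr
  have hp : ‖pressureCoeff v k‖ ≤ (|(k 0 : ℝ)| * n + |(k 1 : ℝ)| * n) / z := by
    rw [pressureCoeff, norm_div, norm_mul, Complex.norm_I, one_mul]
    gcongr
    refine (norm_add_le _ _).trans ?_
    simp only [norm_mul, Complex.norm_intCast]
    gcongr <;> exact hnl _
  have hi : Real.pi * |(k i : ℝ)| * ((|(k 0 : ℝ)| * n + |(k 1 : ℝ)| * n) / z) ≤
      ∑ i, Real.pi * |(k i : ℝ)| * ((|(k 0 : ℝ)| * n + |(k 1 : ℝ)| * n) / z) :=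
    Finset.single_le_sum
      (f := fun i => Real.pi * |(k i : ℝ)| * ((|(k 0 : ℝ)| * n + |(k 1 : ℝ)| * n) / z))
      (fun i _ => by positivity) (Finset.mem_univ i)
  refine norm_sub_le_of_le (norm_sub_le_of_le ?_ ?_) (le_trans ?_ hi)
  · rw [norm_mul]
    gcongr
    exact norm_le_sqrt_of_enorm_sq_le hM ((enorm_sq_le_normTwoSq (v i) k).trans (hv i))
  · exact (norm_indicator_le_norm_self _ k).trans (hnl i)
  · simp only [norm_mul, Complex.norm_I, one_mul, Complex.norm_real, Complex.norm_intCast,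
      Real.norm_of_nonneg Real.pi_nonneg]
    gcongr
    exact (norm_indicator_le_norm_self _ k).trans hp

lemma aemeasurable_nonlinearity {α : Type*} [MeasurableSpace α] {μ : Measure α}
    {v : α → Fin 2 → (Fin 2 → ℤ) → ℂ} (hv : ∀ i k, AEMeasurable (fun s => v s i k) μ) (i : Fin 2)
    (k : Fin 2 → ℤ) : AEMeasurable (fun s => nonlinearity (v s) i k) μ :=
  Finset.aemeasurable_fun_sum _ fun j _ => (aemeasurable_conv (hv j) (hv i) k).const_mul _

lemma aemeasurable_pressureCoeff {α : Type*} [MeasurableSpace α] {μ : Measure α}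
    {v : α → Fin 2 → (Fin 2 → ℤ) → ℂ} (hv : ∀ i k, AEMeasurable (fun s => v s i k) μ)
    (k : Fin 2 → ℤ) : AEMeasurable (fun s => pressureCoeff (v s) k) μ :=
  ((((aemeasurable_nonlinearity hv 0 k).const_mul _).add
    ((aemeasurable_nonlinearity hv 1 k).const_mul _)).const_mul _).div_const _

lemma aemeasurable_fourierField {α : Type*} [MeasurableSpace α] {μ : Measure α}
    {S : Set (Fin 2 → ℤ)} {v : α → Fin 2 → (Fin 2 → ℤ) → ℂ}
    (hv : ∀ i k, AEMeasurable (fun s => v s i k) μ) (i : Fin 2) (k : Fin 2 → ℤ) :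
    AEMeasurable (fun s => fourierField S (v s) i k) μ := by
  have h1 : AEMeasurable (fun s => S.indicator (nonlinearity (v s) i) k) μ := by
    by_cases hk : k ∈ S
    · simpa only [indicator_of_mem hk] using aemeasurable_nonlinearity hv i k
    · simp only [indicator_of_notMem hk]
      exact aemeasurable_const
  have h2 : AEMeasurable (fun s => S.indicator (pressureCoeff (v s)) k) μ := by
    by_cases hk : k ∈ S
    · simpa only [indicator_of_mem hk] using aemeasurable_pressureCoeff hv k
    · simp only [indicator_of_notMem hk]
      exact aemeasurable_const
  exact (((hv i k).const_mul _).sub h1).sub (h2.const_mul _)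

/-- Global existence for the Navier-Stokes equations on the level of Fourier coefficients. -/
theorem exists_fourier_limit (hT : 0 ≤ T) {a : Fin 2 → (Fin 2 → ℤ) → ℂ}
    (ha : ∀ i k, a i (-k) = (starRingEnd ℂ) (a i k))
    (hdiv : ∀ k, ∑ i, (k i : ℂ) * a i k = 0) (ha1 : ∀ i, weightSq 1 (a i) ≠ ⊤) :
    ∃ v : ℝ → Fin 2 → (Fin 2 → ℤ) → ℂ, (∀ i k, v 0 i k = a i k) ∧
      (∀ t ∈ Icc 0 T, ∀ i k, v t i (-k) = (starRingEnd ℂ) (v t i k)) ∧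
      (∀ t ∈ Icc 0 T, ∀ k, ∑ i, (k i : ℂ) * v t i k = 0) ∧
      (∀ t ∈ Icc 0 T, ∑ i, weightSq 1 (v t i) ≤ 2 * ∑ i, weightSq 1 (a i)) ∧
      ∫⁻ s in Ioc 0 T, ∑ i, weightSq 2 (v s i) ≤ ENNReal.ofReal (T + 2) * ∑ i, weightSq 1 (a i) ∧
      (∀ i k, IntervalIntegrable (fun s => fourierField univ (v s) i k) volume 0 T) ∧
      (∀ i k, ∀ t ∈ Icc 0 T, v t i k = v 0 i k + ∫ s in (0 : ℝ)..t, fourierField univ (v s) i k) ∧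
      ∀ i k, AEMeasurable (fun s => v s i k) (volume.restrict (Ioc 0 T)) := by
  choose v hsol hinit hsupp hneg heq hdv hW1 hW2 using fun N : ℕ =>
    exists_galerkin (T := T) hT (neg_mem_lowFreq (N := N)) (zero_mem_lowFreq N) ha hdiv ha1
  set B : ℝ≥0∞ := ∑ i, weightSq 1 (a i) with hB
  have hBtop : B ≠ ⊤ := by simpa [hB] using ha1
  have h2B : 2 * B ≠ ⊤ := ENNReal.mul_ne_top (by simp) hBtop
  set Q : ℝ≥0∞ := embeddingConst * (ENNReal.ofReal (T + 2) * B) with hQ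
  have hQtop : Q ≠ ⊤ := ENNReal.mul_ne_top embeddingConst_ne_top
    (ENNReal.mul_ne_top ENNReal.ofReal_ne_top hBtop)
  have hm := fun N => (hsol N).aemeasurable hT
  have hmN : ∀ N, AEMeasurable (fun s => ∑ i, normOne (v N s i) ^ 2)
      (volume.restrict (Ioc 0 T)) := fun N => Finset.aemeasurable_fun_sum _ fun i _ =>
        (AEMeasurable.tsum fun k => (hm N i k).enorm).pow_const 2
  have hN1 : ∀ N, ∫⁻ s in Ioc 0 T, ∑ i, normOne (v N s i) ^ 2 ≤ Q := fun N => by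
    refine (lintegral_mono fun s => sum_normOne_sq_le (v N s)).trans ?_
    rw [lintegral_const_mul' _ _ embeddingConst_ne_top]
    exact mul_le_mul_right (hW2 N) _
  -- One number of Grönwall steps serves all pairs of approximations, thanks to the uniform L²(H²)
  -- bound.
  obtain ⟨n, hn⟩ := ENNReal.exists_nat_gt (ENNReal.mul_ne_top
    (ENNReal.mul_ne_top ENNReal.ofNat_ne_top (ENNReal.add_ne_top.2 ⟨hQtop, hQtop⟩))
    ENNReal.ofNat_ne_top : 2 * (Q + Q) * 2 ≠ ⊤)
  have hG : ∀ N M, ∫⁻ s in Ioc 0 T, 2 * (∑ i, normOne (v N s i) ^ 2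
      + ∑ i, normOne (v M s i) ^ 2) ≤ n / 2 := fun N M => by
    rw [lintegral_const_mul' _ _ ENNReal.ofNat_ne_top, lintegral_add_left' (hmN N)]
    refine le_trans (mul_le_mul_right (add_le_add (hN1 N) (hN1 M)) _) ?_
    rw [ENNReal.le_div_iff_mul_le (by simp) (by simp)]
    exact hn.le
  set C₀ : ℝ≥0∞ := B + 16 * (2 * B) * Q with hC₀
  have hC₀top : C₀ ≠ ⊤ := ENNReal.add_ne_top.2 ⟨hBtop, ENNReal.mul_ne_top
    (ENNReal.mul_ne_top ENNReal.ofNat_ne_top h2B) hQtop⟩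
  set ε : ℕ → ℝ≥0∞ := fun N => 2 ^ n * (ENNReal.ofReal (1 / (N + 1)) * C₀) with hε
  have hε0 : Filter.Tendsto ε Filter.atTop (nhds 0) := by
    have h1 := ENNReal.tendsto_ofReal (tendsto_one_div_add_atTop_nhds_zero_nat (𝕜 := ℝ))
    have h2 := ENNReal.Tendsto.const_mul (a := 2 ^ n) (ENNReal.Tendsto.mul_const (b := C₀) h1
      (Or.inr hC₀top)) (Or.inr (by simp))
    simpa [hε] using h2
  have hεtop : ∀ N, ε N ≠ ⊤ := fun N => ENNReal.mul_ne_top (by simp)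
    (ENNReal.mul_ne_top ENNReal.ofReal_ne_top hC₀top)
  -- Both sources of error, the truncated datum and the discarded modes of the quadratic term, are
  -- tails of families bounded in H¹ (for the products, after integration in time), hence of order
  -- 1/(N + 1).
  have hstab : ∀ N M, N ≤ M → ∀ t ∈ Icc 0 T, ∑ i, normTwoSq (v N t i - v M t i) ≤ ε N := by
    intro N M hNM
    refine (hsol N).stability hT (hsol M) (by exact_mod_cast lowFreq_mono hNM) (hG N M)
      (ENNReal.mul_ne_top ENNReal.ofReal_ne_top hC₀top) ?_
    rw [hC₀, mul_add]
    refine add_le_add ?_ ?_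
    · rw [hB, Finset.mul_sum]
      refine Finset.sum_le_sum fun i _ => le_trans ?_ (tsum_indicator_lowFreq_le N (a i))
      refine ENNReal.tsum_le_tsum fun k => ?_
      by_cases hk : k ∈ lowFreq N
      · rw [Pi.sub_apply, hinit N i k hk, hinit M i k (lowFreq_mono hNM hk), sub_self]
        simp
      · rw [Pi.sub_apply, hsupp N 0 i k hk, zero_sub, enorm_neg,
          indicator_of_mem (by simpa using hk)]
        by_cases hk' : k ∈ lowFreq M
        · rw [hinit M i k hk']
        · rw [hsupp M 0 i k hk']
          simp
    · calc ∫⁻ s in Ioc 0 T, ∑ i, ∑ j, ∑' k, _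
          ≤ ∫⁻ s in Ioc 0 T, ENNReal.ofReal (1 / (N + 1)) *
            (16 * (2 * B) * ∑ i, normOne (v N s i) ^ 2) := by
            refine setLIntegral_mono' measurableSet_Ioc fun s hs => ?_
            refine (Finset.sum_le_sum fun i _ => Finset.sum_le_sum fun j _ =>
              tsum_indicator_lowFreq_le N (conv (v N s j) (v N s i))).trans ?_
            simp only [← Finset.mul_sum]
            refine mul_le_mul_right ((sum_weightSq_conv_le (v N s)).trans ?_) _
            gcongr
            exact hW1 N s ⟨hs.1.le, hs.2⟩
        _ ≤ _ := by
            rw [lintegral_const_mul' _ _ ENNReal.ofReal_ne_top, lintegral_const_mul' _ _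
              (ENNReal.mul_ne_top ENNReal.ofNat_ne_top h2B)]
            gcongr
            exact hN1 N
  -- The guard on `t` sits inside the existential so that the chosen limit is a function on all of
  -- ℝ.
  have hlim : ∀ t i k, ∃ l, t ∈ Icc 0 T →
      Filter.Tendsto (fun N => v N t i k) Filter.atTop (nhds l) := by
    intro t i k
    by_cases ht : t ∈ Icc 0 T
    · have hc : CauchySeq fun N => v N t i k := by
        refine cauchySeq_of_le_tendsto_0' (fun N => Real.sqrt (ε N).toReal) (fun N M hNM => ?_) ?_
        · rw [dist_eq_norm]
          refine norm_le_sqrt_of_enorm_sq_le (hεtop N) (le_trans ?_ (hstab N M hNM t ht))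
          refine (enorm_sq_le_normTwoSq (v N t i - v M t i) k).trans ?_
          exact Finset.single_le_sum (f := fun i => normTwoSq (v N t i - v M t i))
            (fun i _ => zero_le) (Finset.mem_univ i)
        · have h1 := (Real.continuous_sqrt.tendsto _).comp
            ((ENNReal.tendsto_toReal ENNReal.zero_ne_top).comp hε0)
          simpa [Function.comp_def] using h1
      obtain ⟨l, hl⟩ := cauchySeq_tendsto_of_complete hc
      exact ⟨l, fun _ => hl⟩
    · exact ⟨0, fun h => absurd h ht⟩
  choose w hw using hlim
  have h0T : (0 : ℝ) ∈ Icc 0 T := left_mem_Icc.2 hT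
  have hw1 : ∀ t ∈ Icc 0 T, ∑ i, weightSq 1 (w t i) ≤ 2 * B := fun t ht => by
    refine (sum_weightSq_le_liminf fun i k => hw t i k ht).trans ?_
    refine (Filter.liminf_le_liminf (Filter.Eventually.of_forall fun N => hW1 N t ht)).trans ?_
    rw [Filter.liminf_const]
  have hwdiff : ∀ N, ∀ t ∈ Icc 0 T, ∑ i, normTwoSq (v N t i - w t i) ≤ ε N := fun N t ht => by
    have h1 := sum_weightSq_le_liminf (n := 0) (v := fun M i => v N t i - v M t i)
      (w := fun i => v N t i - w t i) fun i k => (hw t i k ht).const_sub (v N t i k)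
    simp only [weightSq_zero] at h1
    refine h1.trans ((Filter.liminf_le_liminf ((Filter.eventually_ge_atTop N).mono
      fun M hM => hstab N M hM t ht)).trans ?_)
    rw [Filter.liminf_const]
  have hwdiff0 : ∀ t ∈ Icc 0 T, ∀ i, Filter.Tendsto (fun N => normTwoSq (v N t i - w t i))
      Filter.atTop (nhds 0) := fun t ht i => by
    refine tendsto_of_tendsto_of_tendsto_of_le_of_le tendsto_const_nhds hε0 (fun _ => zero_le)
      fun N => le_trans ?_ (hwdiff N t ht)
    exact Finset.single_le_sum (f := fun i => normTwoSq (v N t i - w t i))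
      (fun i _ => zero_le) (Finset.mem_univ i)
  have hb : ∀ {u : Fin 2 → (Fin 2 → ℤ) → ℂ}, ∑ i, weightSq 1 (u i) ≤ 2 * B →
      ∀ i, normTwoSq (u i) ≤ 2 * B := fun {u} hu i => by
    refine (normTwoSq_le_weightSq 1 _).trans (le_trans ?_ hu)
    exact Finset.single_le_sum (f := fun i => weightSq 1 (u i))
      (fun i _ => zero_le) (Finset.mem_univ i)
  -- Strong ℓ² convergence at each time is enough: each coefficient of a product is a continuous
  -- bilinear form on ℓ².
  have hnl : ∀ t ∈ Icc 0 T, ∀ i k, Filter.Tendsto (fun N => nonlinearity (v N t) i k)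
      Filter.atTop (nhds (nonlinearity (w t) i k)) := fun t ht i k =>
    tendsto_finsetSum _ fun j _ => (tendsto_conv h2B (hwdiff0 t ht j) (hwdiff0 t ht i)
      (fun N => hb (hW1 N t ht) i) (fun N => hb (hW1 N t ht) j) (hb (hw1 t ht) j)
      (hb (hw1 t ht) i) k).const_mul _
  have hfield : ∀ t ∈ Icc 0 T, ∀ i k, Filter.Tendsto
      (fun N => fourierField (lowFreq N : Finset (Fin 2 → ℤ)) (v N t) i k)
      Filter.atTop (nhds (fourierField univ (w t) i k)) := by
    intro t ht i k
    have hp : Filter.Tendsto (fun N => pressureCoeff (v N t) k) Filter.atTop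
        (nhds (pressureCoeff (w t) k)) :=
      ((((hnl t ht 0 k).const_mul _).add ((hnl t ht 1 k).const_mul _)).const_mul _).div_const _
    have h1 := (((hw t i k ht).const_mul (-((Real.pi ^ 2 * ∑ j, (k j : ℝ) ^ 2 : ℝ) : ℂ))).sub
      (hnl t ht i k)).sub (hp.const_mul (Complex.I * Real.pi * k i))
    rw [fourierField, indicator_of_mem (mem_univ k), indicator_of_mem (mem_univ k)]
    refine h1.congr' ?_
    filter_upwards [eventually_mem_lowFreq k] with N hN
    rw [fourierField, indicator_of_mem (by exact_mod_cast hN),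
      indicator_of_mem (by exact_mod_cast hN)]
  have hwm : ∀ i k, AEMeasurable (fun s => w s i k) (volume.restrict (Ioc 0 T)) := fun i k =>
    aemeasurable_of_tendsto_metrizable_ae Filter.atTop (fun N => hm N i k)
      (ae_restrict_of_forall_mem measurableSet_Ioc fun s hs => hw s i k ⟨hs.1.le, hs.2⟩)
  refine ⟨w, fun i k => ?_, fun t ht i k => ?_, fun t ht k => ?_, hw1, ?_, fun i k => ?_,
    fun i k t ht => ?_, hwm⟩
  · refine tendsto_nhds_unique (hw 0 i k h0T) (tendsto_const_nhds.congr' ?_)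
    filter_upwards [eventually_mem_lowFreq k] with N hN
    exact (hinit N i k hN).symm
  · refine tendsto_nhds_unique (hw t i (-k) ht) ?_
    refine ((Complex.continuous_conj.tendsto _).comp (hw t i k ht)).congr fun N => ?_
    exact (hneg N t i k).symm
  · refine tendsto_nhds_unique (tendsto_finsetSum _ fun i _ =>
      (hw t i k ht).const_mul (k i : ℂ)) ?_
    simp only [hdv]
    exact tendsto_const_nhds
  · calc ∫⁻ s in Ioc 0 T, ∑ i, weightSq 2 (w s i)
        ≤ ∫⁻ s in Ioc 0 T, Filter.liminf (fun N => ∑ i, weightSq 2 (v N s i)) Filter.atTop :=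
          setLIntegral_mono' measurableSet_Ioc fun s hs =>
            sum_weightSq_le_liminf fun i k => hw s i k ⟨hs.1.le, hs.2⟩
      _ ≤ Filter.liminf (fun N => ∫⁻ s in Ioc 0 T, ∑ i, weightSq 2 (v N s i)) Filter.atTop := by
          refine lintegral_liminf_le' fun N => Finset.aemeasurable_fun_sum _ fun i _ => ?_
          exact AEMeasurable.tsum fun k => ((hm N i k).enorm.pow_const 2).const_mul _
      _ ≤ _ := by
          refine (Filter.liminf_le_liminf (Filter.Eventually.of_forall hW2)).trans ?_
          rw [Filter.liminf_const]
  · obtain ⟨C, hC⟩ := exists_bound_fourierField h2B k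
    rw [intervalIntegrable_iff_integrableOn_Ioc_of_le hT]
    refine IntegrableOn.of_bound (by simp) (aemeasurable_fourierField hwm i k).aestronglyMeasurable
      C (ae_restrict_of_forall_mem measurableSet_Ioc fun s hs => ?_)
    exact hC univ (w s) (hb (hw1 s ⟨hs.1.le, hs.2⟩)) i
  · obtain ⟨C, hC⟩ := exists_bound_fourierField h2B k
    have hsub : Ioc 0 t ⊆ Ioc 0 T := Ioc_subset_Ioc_right ht.2
    have hint : Filter.Tendsto (fun N => ∫ s in (0 : ℝ)..t,
        fourierField (lowFreq N : Finset (Fin 2 → ℤ)) (v N s) i k) Filter.atTop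
        (nhds (∫ s in (0 : ℝ)..t, fourierField univ (w s) i k)) := by
      refine intervalIntegral.tendsto_integral_filter_of_dominated_convergence (fun _ => C)
        (Filter.Eventually.of_forall fun N => ?_) (Filter.Eventually.of_forall fun N =>
          ae_of_all _ fun s hs => ?_) intervalIntegrable_const (ae_of_all _ fun s hs => ?_)
      · rw [uIoc_of_le ht.1]
        exact ((aemeasurable_fourierField (hm N) i k).mono_measure
          (Measure.restrict_mono_set _ hsub)).aestronglyMeasurable
      · rw [uIoc_of_le ht.1] at hs
        exact hC _ (v N s) (hb (hW1 N s ⟨hs.1.le, hs.2.trans ht.2⟩)) i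
      · rw [uIoc_of_le ht.1] at hs
        exact hfield s ⟨hs.1.le, hs.2.trans ht.2⟩ i k
    refine tendsto_nhds_unique (hw t i k ht) (((hw 0 i k h0T).add hint).congr fun N => ?_)
    exact (heq N i k t ht).symm

end Limit

/-! ### The momentum equation in L² and in Fourier variables. -/

section Transport

variable {d : ℕ} {T : ℝ}

lemma sobolevNorm_sq_eq_weightSq (n : ℕ) (f : L2 d) :
    sobolevNorm n f ^ 2 = 2 ^ d * weightSq n (boxFourierCoeff f) := by
  rw [sobolevNorm_sq, weightSq, ← ENNReal.tsum_mul_left]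
  refine tsum_congr fun k => ?_
  rw [Real.rpow_natCast, mul_assoc, ENNReal.ofReal_mul (by positivity),
    ENNReal.ofReal_mul (pow_nonneg (bessel_pos k).le n), ENNReal.ofReal_pow (norm_nonneg _),
    ofReal_norm, ENNReal.ofReal_pow (by norm_num), ENNReal.ofReal_ofNat]

lemma memH_iff_weightSq {n : ℕ} {f : L2 d} : MemH n f ↔ weightSq n (boxFourierCoeff f) ≠ ⊤ := by
  have h := sobolevNorm_sq_eq_weightSq n f
  rw [MemH, lt_top_iff_ne_top]
  constructor
  · intro h1 h2
    rw [h2, ENNReal.mul_top (by simp)] at h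
    exact h1 (by simpa using h)
  · intro h1 h2
    rw [h2] at h
    have h3 : (2 : ℝ≥0∞) ^ d * weightSq n (boxFourierCoeff f) ≠ ⊤ :=
      ENNReal.mul_ne_top (by simp) h1
    exact h3 (by simpa using h.symm)

lemma normTwoSq_boxFourierCoeff_ne_top (f : L2 d) : normTwoSq (boxFourierCoeff f) ≠ ⊤ := by
  rw [normTwoSq_eq_ofReal (summable_norm_sq_boxFourierCoeff f)]
  exact ENNReal.ofReal_ne_top

lemma MemH.summable_norm_boxFourierCoeff {f : L2 2} (h : MemH 2 f) :
    Summable fun k => ‖boxFourierCoeff f k‖ := by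
  have h1 : weightSq 2 (boxFourierCoeff f) ≠ ⊤ := memH_iff_weightSq.1 (by exact_mod_cast h)
  have h2 : normOne (boxFourierCoeff f) ≠ ⊤ := fun h0 => by
    have h3 := normOne_sq_le (boxFourierCoeff f)
    rw [h0] at h3
    exact absurd (h3.trans_lt (ENNReal.mul_lt_top embeddingConst_ne_top.lt_top h1.lt_top)) (by simp)
  refine (ENNReal.summable_toReal h2).congr fun k => ?_
  simp

/-- The transport term of a divergence free field in `H²` is square integrable, with Fourier
coefficients given by convolutions. -/
lemma exists_transport {u : Fin 2 → L2 2} (hu : ∀ i, MemH 2 (u i))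
    (hdiv : ∀ k : Fin 2 → ℤ, ∑ i, (k i : ℂ) * boxFourierCoeff (u i) k = 0) (i : Fin 2) :
    ∃ g : L2 2, (∀ᵐ x ∂(volume.restrict (box 2)),
      g x = ∑ j, u j x * weakDeriv j (u i) x) ∧
      ∀ k, boxFourierCoeff g k = nonlinearity (fun i => boxFourierCoeff (u i)) i k := by
  -- Fields in H² have summable coefficients in two dimensions and are therefore bounded.
  have hmem : ∀ j, MemLp (fun x => u j x * weakDeriv j (u i) x) 2 (volume.restrict (box 2)) :=
    fun j => memLp_mul_of_bounded _ (Lp.aestronglyMeasurable (u j))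
      (norm_le_tsum_norm_boxFourierCoeff (u j) (hu j).summable_norm_boxFourierCoeff)
  refine ⟨∑ j, (hmem j).toLp _, ?_, fun k => ?_⟩
  · rw [Fin.sum_univ_two]
    filter_upwards [Lp.coeFn_add ((hmem 0).toLp _) ((hmem 1).toLp _), (hmem 0).coeFn_toLp,
      (hmem 1).coeFn_toLp] with x h h0 h1
    rw [h, Pi.add_apply, h0, h1, Fin.sum_univ_two]
  · have hcoef : ∀ j, HasSum (fun p => boxFourierCoeff (u j) p *
        boxFourierCoeff (weakDeriv j (u i)) (k - p)) (boxFourierCoeff ((hmem j).toLp _) k) := by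
      intro j
      convert hasSum_boxFourierCoeff_conv (u j) (weakDeriv j (u i)) k using 1
      rw [boxFourierCoeff_eq]
      congr 1
      refine integral_congr_ae ?_
      filter_upwards [(hmem j).coeFn_toLp] with x hx
      rw [hx]
    have hconv : ∀ j, HasSum (fun p => Complex.I * Real.pi * k j *
        (boxFourierCoeff (u j) p * boxFourierCoeff (u i) (k - p)))
        (Complex.I * Real.pi * k j * conv (boxFourierCoeff (u j)) (boxFourierCoeff (u i)) k) :=
      fun j => (summable_of_normTwoSq (normTwoSq_boxFourierCoeff_ne_top (u j))
        (normTwoSq_boxFourierCoeff_ne_top (u i)) k).hasSum.mul_left _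
    rw [boxFourierCoeff_sum]
    refine (hasSum_sum fun j _ => hcoef j).unique ?_
    refine (hasSum_sum fun j _ => hconv j).congr_fun ?_
    intro p
    have hp := hdiv p
    simp only [((hu i).mono one_le_two).boxFourierCoeff_weakDeriv, Fin.sum_univ_two, Pi.sub_apply,
      Int.cast_sub] at hp ⊢
    -- Here the divergence constraint replaces k - p by `k`, turning the advective form into the
    -- divergence form.
    linear_combination (-(Complex.I * Real.pi * boxFourierCoeff (u i) (k - p))) * hp

/-- The momentum equation in terms of Fourier coefficients. -/
lemma momentum_iff {u : Fin 2 → L2 2} (hu : ∀ i, MemH 2 (u i))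
    (hdiv : ∀ k : Fin 2 → ℤ, ∑ i, (k i : ℂ) * boxFourierCoeff (u i) k = 0) {p : L2 2}
    (hp : MemH 1 p) (w : L2 2) (i : Fin 2) :
    (∀ᵐ x ∂(volume.restrict (box 2)), w x + ∑ j, u j x * weakDeriv j (u i) x
      - laplacian ![1, 1] (u i) x + weakDeriv i p x = 0) ↔
    ∀ k : Fin 2 → ℤ, boxFourierCoeff w k =
      -((Real.pi ^ 2 * ∑ j, (k j : ℝ) ^ 2 : ℝ) : ℂ) * boxFourierCoeff (u i) k
      - nonlinearity (fun i => boxFourierCoeff (u i)) i k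
      - Complex.I * Real.pi * k i * boxFourierCoeff p k := by
  obtain ⟨g, hg, hgc⟩ := exists_transport hu hdiv i
  have h1 : (∀ᵐ x ∂(volume.restrict (box 2)), w x + ∑ j, u j x * weakDeriv j (u i) x
      - laplacian ![1, 1] (u i) x + weakDeriv i p x = 0) ↔
      w + g - laplacian ![1, 1] (u i) + weakDeriv i p = 0 := by
    rw [Lp.ext_iff]
    refine Filter.eventually_congr ?_
    filter_upwards [hg, Lp.coeFn_add (w + g - laplacian ![1, 1] (u i)) (weakDeriv i p),
      Lp.coeFn_sub (w + g) (laplacian ![1, 1] (u i)), Lp.coeFn_add w g,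
      Lp.coeFn_zero ℝ 2 (volume.restrict (box 2))] with x hx e1 e2 e3 e4
    rw [e1, e4, Pi.add_apply, e2, Pi.sub_apply, e3, Pi.add_apply, hx]
    rfl
  have h2 : ∀ k : Fin 2 → ℤ, boxFourierCoeff (w + g - laplacian ![1, 1] (u i) + weakDeriv i p) k =
      boxFourierCoeff w k - (-((Real.pi ^ 2 * ∑ j, (k j : ℝ) ^ 2 : ℝ) : ℂ) * boxFourierCoeff (u i) k
      - nonlinearity (fun i => boxFourierCoeff (u i)) i k
      - Complex.I * Real.pi * k i * boxFourierCoeff p k) := fun k => by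
    rw [boxFourierCoeff_add, boxFourierCoeff_sub, boxFourierCoeff_add, hgc,
      (hu i).boxFourierCoeff_laplacian, hp.boxFourierCoeff_weakDeriv]
    simp only [Fin.sum_univ_two, Matrix.cons_val_zero, Matrix.cons_val_one, one_mul,
      Matrix.cons_val_fin_one]
    ring
  rw [h1]
  constructor
  · intro h k
    have h3 := h2 k
    rw [h, boxFourierCoeff_zero] at h3
    exact sub_eq_zero.1 h3.symm
  · intro h
    refine eq_of_boxFourierCoeff_eq fun k => ?_
    rw [h2, h k, sub_self, boxFourierCoeff_zero]

end Transport

/-! ### Uniqueness of strong Navier-Stokes solutions. -/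

section Uniqueness

variable {T : ℝ}

lemma IsNavierStokesSolution.isFourierSolution (hT : 0 ≤ T) {v₀ : Fin 2 → L2 2}
    {v : ℝ → Fin 2 → L2 2} (h : IsNavierStokesSolution T v₀ v) :
    IsFourierSolution T univ fun t i => boxFourierCoeff (v t i) := by
  obtain ⟨v', p, hv', hp, heq⟩ := h.equations
  refine ⟨?_, fun t i => boxFourierCoeff (v' t i), fun t => boxFourierCoeff (p t),
    fun i k => (hv' i).intervalIntegrable (right_mem_Icc.2 hT) k,
    fun i k t ht => (hv' i).boxFourierCoeff_eq ht k, ?_⟩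
  · have hc : ∀ i, ∃ C, ∀ t ∈ Icc 0 T, ‖v t i‖ ≤ C := fun i => by
      have h1 : ContinuousOn (fun t => v t i) (Icc 0 T) :=
        continuousOn_of_eq_add_intervalIntegral hT
          (intervalIntegrable_of_memLp (hv' i).memLp (right_mem_Icc.2 hT)) (hv' i).eq_integral
      exact isCompact_Icc.exists_bound_of_continuousOn h1
    choose C hC using hc
    refine ⟨∑ i, ENNReal.ofReal (C i) ^ 2, by simp, fun t ht i => ?_⟩
    refine le_trans ?_ (Finset.single_le_sum (f := fun i => ENNReal.ofReal (C i) ^ 2)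
      (fun i _ => zero_le) (Finset.mem_univ i))
    have h1 : ‖v t i‖ₑ ≤ ENNReal.ofReal (C i) := by
      rw [← ofReal_norm]
      exact ENNReal.ofReal_le_ofReal (hC i t ht)
    refine le_trans ?_ (pow_le_pow_left' h1 2)
    rw [enorm_sq_eq_tsum]
    exact le_mul_of_one_le_left' (one_le_pow₀ one_le_two)
  · rw [← Measure.restrict_congr_set Ioo_ae_eq_Ioc]
    filter_upwards [heq, ae_all_iff.2 fun i => (h.memE1 i).ae_memH hT, hp.ae_memH]
      with t ht hvt hpt
    have hd := (divergence_eq_zero_iff fun i => (hvt i).mono one_le_two).1 ht.2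
    refine fun k => ⟨hd k, fun i => ?_⟩
    rw [indicator_of_mem (mem_univ k)]
    exact (momentum_iff hvt hd hpt (v' t i) i).1 (ht.1 i) k

/-- The L²(0,T;H²) part of the solution class is exactly what makes the Grönwall coefficient
integrable. -/
lemma IsNavierStokesSolution.lintegral_normOne_ne_top {v₀ : Fin 2 → L2 2} {v : ℝ → Fin 2 → L2 2}
    (hT : 0 ≤ T) (h : IsNavierStokesSolution T v₀ v) :
    ∫⁻ s in Ioc 0 T, ∑ i, normOne (boxFourierCoeff (v s i)) ^ 2 ≠ ⊤ := by
  have hm := (h.isFourierSolution hT).aemeasurable hT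
  have hmi : ∀ i ∈ Finset.univ, AEMeasurable (fun s => normOne (boxFourierCoeff (v s i)) ^ 2)
      (volume.restrict (Ioc 0 T)) := fun i _ =>
    (AEMeasurable.tsum fun k => (hm i k).enorm).pow_const 2
  rw [lintegral_finsetSum' _ hmi]
  refine ENNReal.sum_ne_top.2 fun i _ => ?_
  have h1 := (h.memE1 i).memL2H2
  rw [Measure.restrict_congr_set Ioo_ae_eq_Ioc] at h1
  refine ne_top_of_le_ne_top (ENNReal.mul_ne_top embeddingConst_ne_top h1.ne) ?_
  rw [← lintegral_const_mul' _ _ embeddingConst_ne_top]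
  refine lintegral_mono fun s => (normOne_sq_le _).trans (mul_le_mul_right ?_ _)
  have h2 := sobolevNorm_sq_eq_weightSq 2 (v s i)
  rw [Nat.cast_ofNat] at h2
  rw [h2]
  exact le_mul_of_one_le_left' (one_le_pow₀ one_le_two)

/-- Strong solutions of the Navier-Stokes equations are unique. -/
theorem IsNavierStokesSolution.unique (hT : 0 ≤ T) {v₀ : Fin 2 → L2 2} {v₁ v₂ : ℝ → Fin 2 → L2 2}
    (h₁ : IsNavierStokesSolution T v₀ v₁) (h₂ : IsNavierStokesSolution T v₀ v₂) {t : ℝ}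
    (ht : t ∈ Icc 0 T) : v₁ t = v₂ t := by
  have hN₁ := h₁.lintegral_normOne_ne_top hT
  have hN₂ := h₂.lintegral_normOne_ne_top hT
  have hm := (h₁.isFourierSolution hT).aemeasurable hT
  set Q := (∫⁻ s in Ioc 0 T, ∑ i, normOne (boxFourierCoeff (v₁ s i)) ^ 2)
    + ∫⁻ s in Ioc 0 T, ∑ i, normOne (boxFourierCoeff (v₂ s i)) ^ 2 with hQ
  obtain ⟨n, hn⟩ := ENNReal.exists_nat_gt (ENNReal.mul_ne_top
    (ENNReal.mul_ne_top ENNReal.ofNat_ne_top (ENNReal.add_ne_top.2 ⟨hN₁, hN₂⟩))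
    ENNReal.ofNat_ne_top : 2 * Q * 2 ≠ ⊤)
  -- Without truncation and with equal data there is no error term, so A = 0 is allowed.
  have hs := (h₁.isFourierSolution hT).stability hT (h₂.isFourierSolution hT) (subset_refl univ)
    (n := n) (A := 0) ?_ ENNReal.zero_ne_top ?_ t ht
  · funext i
    refine eq_of_boxFourierCoeff_eq fun k => ?_
    rw [mul_zero] at hs
    have h3 : normTwoSq (boxFourierCoeff (v₁ t i) - boxFourierCoeff (v₂ t i)) ≤ 0 :=
      le_trans (Finset.single_le_sum
        (f := fun i => normTwoSq (boxFourierCoeff (v₁ t i) - boxFourierCoeff (v₂ t i)))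
        (fun i _ => zero_le) (Finset.mem_univ i)) hs
    have h4 := (enorm_sq_le_normTwoSq _ k).trans h3
    simpa [sub_eq_zero] using h4
  · rw [lintegral_const_mul' _ _ ENNReal.ofNat_ne_top, lintegral_add_left',
      ENNReal.le_div_iff_mul_le (by simp) (by simp)]
    · exact hn.le
    · exact Finset.aemeasurable_fun_sum _ fun i _ =>
        (AEMeasurable.tsum fun k => (hm i k).enorm).pow_const 2
  · simp [h₁.initial, h₂.initial, normTwoSq]

end Uniqueness

/-! ### Square integrability of nonlinearity, pressure and time derivative. -/

section Estimates

variable {v : Fin 2 → (Fin 2 → ℤ) → ℂ}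

lemma enorm_mul_sq_eq (r : ℝ) (z c : ℂ) (h : ‖c‖ ^ 2 = r) :
    ‖c * z‖ₑ ^ 2 = ENNReal.ofReal r * ‖z‖ₑ ^ 2 := by
  rw [enorm_mul, mul_pow, ← h, ENNReal.ofReal_pow (norm_nonneg _), ofReal_norm]

lemma norm_I_mul_pi_mul_sq (n : ℤ) : ‖Complex.I * Real.pi * (n : ℂ)‖ ^ 2 = (Real.pi * n) ^ 2 := by
  simp [mul_pow]

lemma enorm_I_mul_pi_mul_sq_le (k : Fin 2 → ℤ) (j : Fin 2) (z : ℂ) :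
    ‖Complex.I * Real.pi * k j * z‖ₑ ^ 2 ≤ ENNReal.ofReal (bessel k ^ 1) * ‖z‖ₑ ^ 2 := by
  rw [enorm_mul_sq_eq _ z _ (norm_I_mul_pi_mul_sq (k j)), pow_one]
  gcongr
  exact sq_le_bessel k j

lemma sum_normTwoSq_nonlinearity_le (v : Fin 2 → (Fin 2 → ℤ) → ℂ) :
    ∑ i, normTwoSq (nonlinearity v i) ≤
      32 * (∑ i, weightSq 1 (v i)) * ∑ i, normOne (v i) ^ 2 := by
  have h : ∀ i, normTwoSq (nonlinearity v i) ≤ 2 * ∑ j, weightSq 1 (conv (v j) (v i)) := fun i => by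
    simp only [weightSq]
    rw [← Summable.tsum_finsetSum fun i _ => ENNReal.summable, ← ENNReal.tsum_mul_left]
    refine ENNReal.tsum_le_tsum fun k => ?_
    rw [nonlinearity, Fin.sum_univ_two, Fin.sum_univ_two]
    refine (pow_le_pow_left' (enorm_add_le _ _) 2).trans ((add_sq_le_ennreal _ _).trans ?_)
    gcongr <;> exact enorm_I_mul_pi_mul_sq_le k _ _
  refine (Finset.sum_le_sum fun i _ => h i).trans ?_
  rw [← Finset.mul_sum]
  refine (mul_le_mul_right (sum_weightSq_conv_le v) 2).trans (le_of_eq ?_)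
  ring

/-- Cauchy-Schwarz on k·N(k): the pressure gains one derivative over the nonlinearity. At k = 0 the
pressure coefficient is zero, which also gives the pressure mean zero. -/
lemma bessel_mul_norm_sq_pressureCoeff_le (v : Fin 2 → (Fin 2 → ℤ) → ℂ) (k : Fin 2 → ℤ) :
    bessel k * ‖pressureCoeff v k‖ ^ 2 ≤ 2 * ∑ i, ‖nonlinearity v i k‖ ^ 2 := by
  by_cases hk : k = 0
  · have hs : 0 ≤ 2 * ∑ i, ‖nonlinearity v i k‖ ^ 2 := by positivity
    have hp : pressureCoeff v k = 0 := by simp [hk, pressureCoeff]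
    rw [hp]
    simpa using hs
  · have h1 := real_sq_add_sq_pos hk
    have h2 := one_le_pi_sq_mul hk
    set n : ℝ := (k 0 : ℝ) ^ 2 + (k 1 : ℝ) ^ 2 with hn
    have h3 : ‖(k 0 : ℂ) ^ 2 + (k 1 : ℂ) ^ 2‖ = n := by
      have : (k 0 : ℂ) ^ 2 + (k 1 : ℂ) ^ 2 = ((n : ℝ) : ℂ) := by
        rw [hn]
        push_cast
        rfl
      rw [this, Complex.norm_real, Real.norm_of_nonneg h1.le]
    have h4 : ‖k 0 * nonlinearity v 0 k + k 1 * nonlinearity v 1 k‖ ^ 2 ≤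
        n * ∑ i, ‖nonlinearity v i k‖ ^ 2 := by
      have h5 : ‖k 0 * nonlinearity v 0 k + k 1 * nonlinearity v 1 k‖ ≤
          |(k 0 : ℝ)| * ‖nonlinearity v 0 k‖ + |(k 1 : ℝ)| * ‖nonlinearity v 1 k‖ := by
        refine (norm_add_le _ _).trans ?_
        simp only [norm_mul, Complex.norm_intCast, le_refl]
      refine (pow_le_pow_left₀ (norm_nonneg _) h5 2).trans ?_
      rw [Fin.sum_univ_two, hn, ← sq_abs (k 0 : ℝ), ← sq_abs (k 1 : ℝ)]
      nlinarith [sq_nonneg (|(k 0 : ℝ)| * ‖nonlinearity v 1 k‖ -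
        |(k 1 : ℝ)| * ‖nonlinearity v 0 k‖)]
    have h6 : ‖pressureCoeff v k‖ ^ 2 =
        ‖k 0 * nonlinearity v 0 k + k 1 * nonlinearity v 1 k‖ ^ 2 / (Real.pi ^ 2 * n ^ 2) := by
      rw [pressureCoeff, norm_div, norm_mul, norm_mul, h3, Complex.norm_I, one_mul,
        Complex.norm_real, Real.norm_of_nonneg Real.pi_nonneg, div_pow, mul_pow]
    have h7 : bessel k ≤ 2 * (Real.pi ^ 2 * n) := by
      rw [Fin.sum_univ_two, ← hn] at h2
      rw [bessel, Fin.sum_univ_two, ← hn]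
      linarith
    have hs : 0 ≤ ∑ i, ‖nonlinearity v i k‖ ^ 2 := Finset.sum_nonneg fun i _ => sq_nonneg _
    rw [h6]
    calc bessel k * (‖k 0 * nonlinearity v 0 k + k 1 * nonlinearity v 1 k‖ ^ 2 /
          (Real.pi ^ 2 * n ^ 2))
        ≤ 2 * (Real.pi ^ 2 * n) * (n * (∑ i, ‖nonlinearity v i k‖ ^ 2) /
          (Real.pi ^ 2 * n ^ 2)) := by gcongr
      _ = _ := by
          have := Real.pi_ne_zero
          field_simp

lemma weightSq_pressureCoeff_le (v : Fin 2 → (Fin 2 → ℤ) → ℂ) :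
    weightSq 1 (pressureCoeff v) ≤ 2 * ∑ i, normTwoSq (nonlinearity v i) := by
  simp only [normTwoSq]
  rw [← Summable.tsum_finsetSum fun i _ => ENNReal.summable, ← ENNReal.tsum_mul_left]
  refine ENNReal.tsum_le_tsum fun k => ?_
  have h := ENNReal.ofReal_le_ofReal (bessel_mul_norm_sq_pressureCoeff_le v k)
  rw [ENNReal.ofReal_mul (bessel_pos k).le, ENNReal.ofReal_mul zero_le_two,
    ENNReal.ofReal_sum_of_nonneg fun i _ => sq_nonneg _, ENNReal.ofReal_ofNat] at h
  simpa only [ENNReal.ofReal_pow (norm_nonneg _), ofReal_norm, pow_one] using h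

lemma normTwoSq_fourierField_le (v : Fin 2 → (Fin 2 → ℤ) → ℂ) (i : Fin 2) :
    normTwoSq (fourierField univ v i) ≤ 4 * (weightSq 2 (v i) + normTwoSq (nonlinearity v i)
      + weightSq 1 (pressureCoeff v)) := by
  rw [normTwoSq, normTwoSq, weightSq, weightSq, ← ENNReal.tsum_add, ← ENNReal.tsum_add,
    ← ENNReal.tsum_mul_left]
  refine ENNReal.tsum_le_tsum fun k => ?_
  rw [fourierField, indicator_of_mem (mem_univ k), indicator_of_mem (mem_univ k)]
  set x : ℂ := -((Real.pi ^ 2 * ∑ j, (k j : ℝ) ^ 2 : ℝ) : ℂ) * v i k with hx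
  have h1 : ‖x‖ₑ ^ 2 ≤ ENNReal.ofReal (bessel k ^ 2) * ‖v i k‖ₑ ^ 2 := by
    rw [hx, enorm_mul_sq_eq _ _ _ rfl, norm_neg, Complex.norm_real, Real.norm_eq_abs, sq_abs]
    gcongr
    rw [bessel]
    linarith
  have h2 := enorm_I_mul_pi_mul_sq_le k i (pressureCoeff v k)
  calc _ ≤ 2 * (2 * ‖x‖ₑ ^ 2 + 2 * ‖nonlinearity v i k‖ₑ ^ 2)
        + 2 * ‖Complex.I * Real.pi * k i * pressureCoeff v k‖ₑ ^ 2 :=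
        (enorm_sub_sq_le _ _).trans (by gcongr; exact enorm_sub_sq_le _ _)
    _ ≤ 2 * (2 * ‖x‖ₑ ^ 2 + 2 * ‖nonlinearity v i k‖ₑ ^ 2)
        + 4 * ‖Complex.I * Real.pi * k i * pressureCoeff v k‖ₑ ^ 2 := by
        gcongr
        norm_num
    _ ≤ 2 * (2 * (ENNReal.ofReal (bessel k ^ 2) * ‖v i k‖ₑ ^ 2) + 2 * ‖nonlinearity v i k‖ₑ ^ 2)
        + 4 * (ENNReal.ofReal (bessel k ^ 1) * ‖pressureCoeff v k‖ₑ ^ 2) := by gcongr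
    _ = _ := by ring

variable (hv : ∀ i k, v i (-k) = (starRingEnd ℂ) (v i k))

include hv

lemma nonlinearity_neg (i : Fin 2) (k : Fin 2 → ℤ) :
    nonlinearity v i (-k) = (starRingEnd ℂ) (nonlinearity v i k) := by
  have hc : ∀ j, conv (v j) (v i) (-k) = (starRingEnd ℂ) (conv (v j) (v i) k) := fun j => by
    rw [conv, conv, Complex.conj_tsum, ← (Equiv.neg (Fin 2 → ℤ)).tsum_eq]
    refine tsum_congr fun p => ?_
    have h : -k - -p = -(k - p) := by abel
    rw [Equiv.neg_apply, h, hv, hv, map_mul]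
  simp only [nonlinearity, hc, map_sum, map_mul, Complex.conj_I, Complex.conj_ofReal, Pi.neg_apply,
    Int.cast_neg, map_intCast]
  exact Finset.sum_congr rfl fun j _ => by ring

lemma pressureCoeff_neg (k : Fin 2 → ℤ) :
    pressureCoeff v (-k) = (starRingEnd ℂ) (pressureCoeff v k) := by
  simp only [pressureCoeff, nonlinearity_neg hv, map_div₀, map_mul, map_add, Complex.conj_I,
    Complex.conj_ofReal, Pi.neg_apply, Int.cast_neg, map_intCast, map_pow, neg_sq]
  congr 1
  ring

lemma fourierField_neg (i : Fin 2) (k : Fin 2 → ℤ) :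
    fourierField univ v i (-k) = (starRingEnd ℂ) (fourierField univ v i k) := by
  simp only [fourierField, indicator_of_mem (mem_univ _), nonlinearity_neg hv,
    pressureCoeff_neg hv, hv, map_sub, map_mul, map_neg, Complex.conj_I, Complex.conj_ofReal,
    Pi.neg_apply, Int.cast_neg, map_intCast, neg_sq]
  ring

end Estimates

/-! ### From the Fourier limit to a strong solution. -/

section Existence

variable {T : ℝ}

lemma boxFourierCoeff_zero_freq {d : ℕ} (f : L2 d) :
    boxFourierCoeff f 0 = (1 / 2 ^ d : ℂ) * ((∫ x in box d, f x : ℝ) : ℂ) := by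
  simp [boxFourierCoeff, integral_complex_ofReal]

/-- Global existence of strong solutions of the two-dimensional Navier-Stokes equations. -/
theorem exists_isNavierStokesSolution (hT : 0 ≤ T) {v₀ : Fin 2 → L2 2} (h1 : ∀ i, MemH 1 (v₀ i))
    (hσ : v₀ ∈ L2sigmaG) : ∃ v, IsNavierStokesSolution T v₀ v := by
  have ha1 : ∀ i, weightSq 1 (boxFourierCoeff (v₀ i)) ≠ ⊤ := fun i =>
    memH_iff_weightSq.1 (by simpa using h1 i)
  obtain ⟨w, hw0, hneg, hdv, hW1, hW2, hint, heq, hwm⟩ := exists_fourier_limit hT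
    (a := fun i => boxFourierCoeff (v₀ i)) (fun i k => boxFourierCoeff_neg (v₀ i) k)
    (sum_mul_boxFourierCoeff_of_mem_L2sigmaG hσ) ha1
  rw [← Measure.restrict_congr_set Ioo_ae_eq_Ioc] at hW2 hwm
  set B : ℝ≥0∞ := ∑ i, weightSq 1 (boxFourierCoeff (v₀ i)) with hB
  have hBtop : B ≠ ⊤ := by simpa [hB] using ha1
  set W : ℝ → ℝ≥0∞ := fun t => ∑ i, weightSq 2 (w t i) with hW
  have hWtop : ∫⁻ t in Ioo 0 T, W t ≠ ⊤ :=
    ne_top_of_le_ne_top (ENNReal.mul_ne_top ENNReal.ofReal_ne_top hBtop) hW2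
  have hWm : AEMeasurable W (volume.restrict (Ioo 0 T)) :=
    Finset.aemeasurable_fun_sum _ fun i _ =>
      AEMeasurable.tsum fun k => ((hwm i k).enorm.pow_const 2).const_mul _
  -- At these times the H² norm is finite, so pressure and time derivative are genuine L² functions;
  -- elsewhere `synth` may return its default value, which a null set of times permits.
  have hgood : ∀ᵐ t ∂(volume.restrict (Ioo 0 T)), t ∈ Icc 0 T ∧ W t ≠ ⊤ := by
    filter_upwards [ae_lt_top' hWm hWtop, ae_restrict_mem measurableSet_Ioo] with t ht ht'
    exact ⟨⟨ht'.1.le, ht'.2.le⟩, ht.ne⟩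
  set D : ℝ≥0∞ := 32 * (2 * B) * embeddingConst with hD
  have hDtop : D ≠ ⊤ := ENNReal.mul_ne_top (ENNReal.mul_ne_top ENNReal.ofNat_ne_top
    (ENNReal.mul_ne_top ENNReal.ofNat_ne_top hBtop)) embeddingConst_ne_top
  have hN : ∀ t ∈ Icc 0 T, ∑ i, normTwoSq (nonlinearity (w t) i) ≤ D * W t := fun t ht => by
    refine (sum_normTwoSq_nonlinearity_le (w t)).trans ?_
    rw [hD, mul_assoc _ embeddingConst]
    gcongr
    · exact hW1 t ht
    · exact sum_normOne_sq_le (w t)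
  have hP : ∀ t ∈ Icc 0 T, weightSq 1 (pressureCoeff (w t)) ≤ 2 * D * W t := fun t ht => by
    rw [mul_assoc]
    exact (weightSq_pressureCoeff_le (w t)).trans (mul_le_mul_right (hN t ht) 2)
  have hF : ∀ t ∈ Icc 0 T, ∀ i, normTwoSq (fourierField univ (w t) i) ≤
      4 * (1 + D + 2 * D) * W t := fun t ht i => by
    refine (normTwoSq_fourierField_le (w t) i).trans ?_
    rw [mul_assoc, add_mul, add_mul, one_mul]
    gcongr
    · exact Finset.single_le_sum (f := fun i => weightSq 2 (w t i)) (fun i _ => zero_le)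
        (Finset.mem_univ i)
    · exact (Finset.single_le_sum (f := fun i => normTwoSq (nonlinearity (w t) i))
        (fun i _ => zero_le) (Finset.mem_univ i)).trans (hN t ht)
    · exact hP t ht
  have hFtop : 4 * (1 + D + 2 * D) ≠ ⊤ := by
    simp [ENNReal.mul_eq_top, hDtop]
  have hv : ∀ t ∈ Icc 0 T, ∀ i k, boxFourierCoeff (synth (w t i)) k = w t i k := fun t ht i k => by
    refine boxFourierCoeff_synth (summable_of_normTwoSq_ne_top ?_) (hneg t ht i) k
    refine ne_top_of_le_ne_top (ENNReal.mul_ne_top ENNReal.ofNat_ne_top hBtop)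
      ((normTwoSq_le_weightSq 1 _).trans (le_trans ?_ (hW1 t ht)))
    exact Finset.single_le_sum (f := fun i => weightSq 1 (w t i)) (fun i _ => zero_le)
      (Finset.mem_univ i)
  have hv' : ∀ᵐ t ∂(volume.restrict (Ioo 0 T)), ∀ i k,
      boxFourierCoeff (synth (fourierField univ (w t) i)) k = fourierField univ (w t) i k := by
    filter_upwards [hgood] with t ht i k
    exact boxFourierCoeff_synth (summable_of_normTwoSq_ne_top
      (ne_top_of_le_ne_top (ENNReal.mul_ne_top hFtop ht.2) (hF t ht.1 i)))
      (fourierField_neg (hneg t ht.1) i) k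
  have hp : ∀ᵐ t ∂(volume.restrict (Ioo 0 T)), ∀ k,
      boxFourierCoeff (synth (pressureCoeff (w t))) k = pressureCoeff (w t) k := by
    filter_upwards [hgood] with t ht k
    exact boxFourierCoeff_synth (summable_of_normTwoSq_ne_top
      (ne_top_of_le_ne_top (ENNReal.mul_ne_top (ENNReal.mul_ne_top ENNReal.ofNat_ne_top hDtop) ht.2)
        ((normTwoSq_le_weightSq 1 _).trans (hP t ht.1))))
      (pressureCoeff_neg (hneg t ht.1)) k
  have hder : ∀ i, IsTimeDeriv T (fun t => synth (w t i))
      fun t => synth (fourierField univ (w t) i) := by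
    intro i
    refine isTimeDeriv_of_boxFourierCoeff (memLp_two_of_boxFourierCoeff (fun k => ?_) ?_)
      fun k t ht => ?_
    · refine (aemeasurable_fourierField (S := univ) hwm i k).aestronglyMeasurable.congr ?_
      filter_upwards [hv'] with t ht
      exact (ht i k).symm
    · refine lt_of_le_of_lt ?_ (ENNReal.mul_lt_top hFtop.lt_top hWtop.lt_top)
      rw [← lintegral_const_mul' _ _ hFtop]
      refine lintegral_mono_ae ?_
      filter_upwards [hgood, hv'] with t ht hvt
      simp only [hvt]
      exact hF t ht.1 i
    · rw [hv t ht, hv 0 (left_mem_Icc.2 hT), heq i k t ht]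
      congr 1
      refine intervalIntegral.integral_congr_ae ?_
      filter_upwards [ae_uIoc_of_ae_Ioo hv' ht] with s hs hs'
      exact (hs hs' i k).symm
  have hsob : ∀ t ∈ Icc 0 T, ∀ i, sobolevNorm 2 (synth (w t i)) ^ 2 ≤ 2 ^ 2 * W t :=
    fun t ht i => by
    have h2 := sobolevNorm_sq_eq_weightSq 2 (synth (w t i))
    rw [Nat.cast_ofNat, funext (hv t ht i)] at h2
    rw [h2]
    gcongr
    exact Finset.single_le_sum (f := fun i => weightSq 2 (w t i)) (fun i _ => zero_le)
      (Finset.mem_univ i)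
  have hsobp : ∀ᵐ t ∂(volume.restrict (Ioo 0 T)),
      sobolevNorm 1 (synth (pressureCoeff (w t))) ^ 2 ≤ 2 ^ 2 * (2 * D) * W t := by
    filter_upwards [hgood, hp] with t ht hpt
    have h2 := sobolevNorm_sq_eq_weightSq 1 (synth (pressureCoeff (w t)))
    rw [Nat.cast_one, funext hpt] at h2
    rw [h2, mul_assoc]
    gcongr
    exact hP t ht.1
  have hsobtop : (2 : ℝ≥0∞) ^ 2 * (2 * D) ≠ ⊤ :=
    ENNReal.mul_ne_top (by simp) (ENNReal.mul_ne_top ENNReal.ofNat_ne_top hDtop)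
  refine ⟨fun t i => synth (w t i), fun i => ⟨⟨_, hder i⟩, ?_⟩, ?_,
    fun t i => synth (fourierField univ (w t) i), fun t => synth (pressureCoeff (w t)), hder,
    ⟨?_, ?_, ?_⟩, ?_⟩
  · refine lt_of_le_of_lt (setLIntegral_mono' measurableSet_Ioo fun t ht =>
      hsob t ⟨ht.1.le, ht.2.le⟩ i) ?_
    rw [lintegral_const_mul' _ _ (by simp)]
    exact ENNReal.mul_lt_top (by simp) hWtop.lt_top
  · funext i
    refine eq_of_boxFourierCoeff_eq fun k => ?_
    rw [hv 0 (left_mem_Icc.2 hT), hw0]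
  · refine aestronglyMeasurable_of_boxFourierCoeff fun k => ?_
    refine (aemeasurable_pressureCoeff hwm k).aestronglyMeasurable.congr ?_
    filter_upwards [hp] with t ht
    exact (ht k).symm
  · refine lt_of_le_of_lt (lintegral_mono_ae hsobp) ?_
    rw [lintegral_const_mul' _ _ hsobtop]
    exact ENNReal.mul_lt_top hsobtop.lt_top hWtop.lt_top
  · filter_upwards [hp] with t ht
    have h2 := boxFourierCoeff_zero_freq (synth (pressureCoeff (w t)))
    rw [ht] at h2
    simpa [pressureCoeff] using h2.symm
  · filter_upwards [hgood, hv', hp, hsobp] with t ht hvt hpt hst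
    have hm2 : ∀ i, MemH 2 (synth (w t i)) := fun i => by
      have h2 : sobolevNorm 2 (synth (w t i)) ^ 2 ≠ ⊤ :=
        ne_top_of_le_ne_top (ENNReal.mul_ne_top (by simp) ht.2) (hsob t ht.1 i)
      exact lt_top_iff_ne_top.2 fun h3 => h2 (by rw [h3]; simp)
    have hm1 : MemH 1 (synth (pressureCoeff (w t))) := by
      have h2 := ne_top_of_le_ne_top (ENNReal.mul_ne_top hsobtop ht.2) hst
      exact lt_top_iff_ne_top.2 fun h3 => h2 (by rw [h3]; simp)
    have hd : ∀ k : Fin 2 → ℤ, ∑ i, (k i : ℂ) * boxFourierCoeff (synth (w t i)) k = 0 := fun k => by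
      simp only [hv t ht.1]
      exact hdv t ht.1 k
    have hc : (fun i => boxFourierCoeff (synth (w t i))) = w t :=
      funext fun i => funext fun k => hv t ht.1 i k
    refine ⟨fun i => (momentum_iff hm2 hd hm1 _ i).2 fun k => ?_,
      (divergence_eq_zero_iff fun i => (hm2 i).mono one_le_two).2 hd⟩
    rw [hvt i k, hpt k, hv t ht.1, hc, fourierField, indicator_of_mem (mem_univ k),
      indicator_of_mem (mem_univ k)]

end Existence

end

end ScaledStokes

theorem proposition5p2 (T : ℝ) (hT : 0 < T) :
    ∃ C : ℝ, 0 < C ∧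
      ∀ (v₀ : Fin 2 → ScaledStokes.L2 2) (u₀ : Fin 3 → ScaledStokes.L2 3),
        (∀ i, ScaledStokes.MemH 1 (v₀ i)) → v₀ ∈ ScaledStokes.L2sigmaG →
        (∀ i, ScaledStokes.MemH (3 / 2) (u₀ i)) → u₀ ∈ ScaledStokes.L2sigmaOmega →
        (∀ i, ScaledStokes.VerticalMeanZero (u₀ i)) →
        (∀ ε δ : ℝ, 0 < ε → 0 < δ →
          ∃ (v : ℝ → Fin 2 → ScaledStokes.L2 2) (u : ℝ → Fin 3 → ScaledStokes.L2 3),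
            ScaledStokes.IsStrongSolution T ε δ v₀ u₀ v u ∧
            ∀ (v₁ : ℝ → Fin 2 → ScaledStokes.L2 2) (u₁ : ℝ → Fin 3 → ScaledStokes.L2 3),
              ScaledStokes.IsStrongSolution T ε δ v₀ u₀ v₁ u₁ →
              ∀ t ∈ Set.Icc 0 T, v₁ t = v t ∧ u₁ t = u t) ∧
        (∀ δ : ℝ, 1 ≤ δ → ∀ u : ℝ → ℝ → Fin 3 → ScaledStokes.L2 3,
          (∀ ε ∈ Set.Ioc (0 : ℝ) 1, ScaledStokes.IsScaledStokesSolution T ε δ u₀ (u ε)) →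
          ⨆ ε ∈ Set.Ioc (0 : ℝ) 1,
              ScaledStokes.normL4H T (3 / 2) (fun t => ScaledStokes.rescale ε (u ε t)) ≤
            ENNReal.ofReal (C / δ ^ (1 / 4 : ℝ)) * ScaledStokes.sobolevNormVec (3 / 2) u₀) := by
  -- The decay estimate already holds with constant 1, independently of `T`.
  refine ⟨1, one_pos, fun v₀ u₀ hv₀ hvσ hu₀ huσ hum => ⟨fun ε δ hε hδ => ?_, fun δ hδ u hu => ?_⟩⟩
  · obtain ⟨v, hv⟩ := ScaledStokes.exists_isNavierStokesSolution hT.le hv₀ hvσ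
    have hs := ScaledStokes.isScaledStokesSolution_stokesFlow (ε := ε) hT hδ hu₀ huσ hum
    refine ⟨v, ScaledStokes.stokesFlow δ u₀, ⟨hv, hs⟩, fun v₁ u₁ h t ht =>
      ⟨h.navierStokes.unique hT.le hv ht, funext fun i =>
        ScaledStokes.eq_of_boxFourierCoeff_eq fun k => ?_⟩⟩
    rw [h.stokes.boxFourierCoeff_eq hT hε ht, hs.boxFourierCoeff_eq hT hε ht]
  · exact iSup₂_le fun ε hε =>
      (hu ε hε).normL4H_le hT hε.1 hε.2 (one_pos.trans_le hδ) hum (3 / 2)
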